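/- **Setting.** A crossed module $\Psi$ is a homomorphism $\psi\colon G_1\to G_0$, $\alpha\mapsto\underline\alpha$, with a right action of $G_0$ on the group $G_1$ by automorphisms such that $\underline{\alpha^x}=x^{-1}\underline\alpha x$ and $\beta^{\underline\alpha}=\alpha^{-1}\beta\alpha$. Its strict categorical group $\mathcal S(\Psi)$ has objects $G_0$, arrows $(x,\alpha)\colon x\to x\underline\alpha$ composed by multiplying the $\alpha$'s, and tensor product $(x,\alpha)(y,\beta)=(xy,\alpha^y\beta)$. Two categorical groups are equivalent if there is a (strong) monoidal functor between them that is an equivalence of categories. Let $G_0,G_1$ be Lie groups, with $\psi$ and the action analytic. A weak endomorphism of $\Psi$ is a triple of analytic maps $f_0\colon G_0\to G_0$, $f_1\colon G_1\to G_1$, $\kappa\colon G_0\times G_0\to G_1$ with $f_0(1)=1$, $f_1(1)=1$ and $$f_0(\underline\alpha)=\underline{f_1(\alpha)},\quad f_0(x)f_0(y)\underline{\kappa_{x,y}}=f_0(xy),\quad f_1(\alpha)f_1(\beta)\kappa_{\underline\alpha,\underline\beta}=f_1(\alpha\beta),$$ $$\kappa_{x,y}^{f_0(z)}\kappa_{xy,z}=\kappa_{y,z}\kappa_{x,yz},\quad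 f_1(\alpha)^{f_0(x)}\kappa_{\underline\alpha,x}=f_1(\alpha^x)\kappa_{x,\underline{\alpha^x}}.$$ They form a monoid under $(f,\kappa)(g,\gamma)=(f\circ g,\beta)$, $\beta_{x,y}=f_1(\gamma_{x,y})\,\kappa_{g_0(x),g_0(y)}^{f_0(\underline{\gamma_{x,y}})}\,\kappa_{g_0(x)g_0(y),\underline{\gamma_{x,y}}}$. The *categorical group of centre-preserving weak automorphisms* of $\mathcal S(\Psi)$ is $\mathcal S(wAct^+(\Psi))$, where $wAct^+(\Psi)$ is the following crossed module. In degree $0$ it is the group of invertible weak endomorphisms with $f_1=\mathrm{id}$ on $\ker\psi$. In degree $1$ it is the group of invertible elements of the monoid of pointed analytic maps $G_0\to G_1$ with $(\chi_1\circ\chi_2)(x)=\chi_2(x)\,\chi_1(x\underline{\chi_2(x)})$. The structure map sends $\eta$ to $f_0(x)=x\underline{\eta(x)}$, $f_1(\alpha)=\alpha\,\eta(\underline\alpha)$, $\kappa_{x,y}=\eta(y)^{-1}(\eta(x)^y)^{-1}\eta(xy)$, and the action is $\eta^{(f,\kappa)}(x)=f_1^{-1}(\eta(f_0(x)))\,\gamma_{f_0(x),\underline{\eta(f_0(x))}}$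 with $(f,\kappa)^{-1}=(f^{-1},\gamma)$. **The two crossed modules.** Let $\Lambda^\vee$ be a lattice (a free abelian group of finite rank), $\Lambda=\mathrm{Hom}(\Lambda^\vee,\mathbb Z)$, $J$ an integral bilinear form on $\Lambda^\vee$ and $I(m,n)=J(m,n)+J(n,m)$. Put $\mathfrak t=\Lambda^\vee\otimes\mathbb R$ (to which $J$ is extended bilinearly), $T=\Lambda^\vee\otimes U(1)$, $\exp=\Lambda^\vee\otimes e^{2\pi i(-)}\colon\mathfrak t\to T$. The categorical group $\mathcal T\rtimes\{\pm1\}$ is $\mathcal S(\Theta')$ for the crossed module $\Theta'\colon \Lambda^\vee\times U(1)\to\mathfrak t\rtimes\{\pm1\}$, $(m,z)\mapsto(m,1)$, with $(m,z)^{(x,\epsilon)}=(\epsilon m,\,z\,e^{2\pi iJ(m,x)})$; here $\Lambda^\vee$ and $\{\pm1\}$ are discrete. Let $\widetilde{O(\Lambda^\vee,I)}$ be the group of pairs $(f,B)$, where $f$ is an isometry of $(\Lambda^\vee,I)$ and $B$ is an integral bilinear form on $\Lambda^\vee$ with $B-B^t=J-f^*J$, with multiplication $(f,B)(g,C)=(fg,\,g^*B+C)$.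 Let $E$ be its quotient by the normal subgroup of the pairs $(\mathrm{id},B)$ with $B$ symmetric and even, acting on $T$ through $f$. Let $\widetilde{\Lambda^\vee}$ be the central extension of $\Lambda^\vee$ by $\mathbb Z/2$ with cocycle $J^t$ modulo $2$, and let $2\Lambda^\vee$ be its central subgroup of elements $(2n,0)$. The crossed module $\Xi'$ is $$\xi'\colon\widetilde{\Lambda^\vee}/2\Lambda^\vee\to T\rtimes E,\qquad([n],\iota)\mapsto(\exp(n/2),\mathrm{id},B),$$ where $(\mathrm{id},B)$ is the unique class in $E$ with $B$ symmetric and $B(m,m)\equiv I(n,m)$ modulo $2$ for all $m$, with the action $$([n],\iota)^{(t,f,B)}=([f^{-1}n],\;\iota+B(f^{-1}n,f^{-1}n)).$$ **Theorem.** If $I$ is unimodular, that is, if $I^\sharp\colon\Lambda^\vee\to\Lambda$, $m\mapsto I(m,-)$, is an isomorphism, then the categorical group $\mathcal S(wAct^+(\Theta'))$ of centre-preserving weak automorphisms of $\mathcal T\rtimes\{\pm1\}$ is equivalent to the strict categorical group $\mathcal S(\Xi')$. -/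

import Mathlib

namespace CatTorus

universe u v

open scoped Manifold ContDiff TensorProduct
open CategoryTheory

/-! ### Crossed modules and the associated strict categorical groups -/

/-- A crossed module `bd : G₁ → G₀`, with `G₀` acting on `G₁` from the right;
`act α x` is written `α ^ x` on paper. -/
structure CrossedModule (G₁ G₀ : Type*) [Group G₁] [Group G₀] where
  bd : G₁ →* G₀
  act : G₁ → G₀ → G₁
  act_one : ∀ α, act α 1 = α
  act_mul : ∀ α x y, act α (x * y) = act (act α x) y
  mul_act : ∀ α β x, act (α * β) x = act α x * act β x
  bd_act : ∀ α x, bd (act α x) = x⁻¹ * bd α * x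
  peiffer : ∀ α β, act β (bd α) = α⁻¹ * β * α

namespace CrossedModule

section

variable {G₁ G₀ : Type*} [Group G₁] [Group G₀] (Ψ : CrossedModule G₁ G₀)

theorem one_act (x : G₀) : Ψ.act 1 x = 1 := by
  have h := Ψ.mul_act 1 1 x
  rw [one_mul] at h
  exact left_eq_mul.mp h

theorem inv_act (α : G₁) (x : G₀) : Ψ.act α⁻¹ x = (Ψ.act α x)⁻¹ := by
  rw [eq_inv_iff_mul_eq_one, ← Ψ.mul_act, inv_mul_cancel, Ψ.one_act]

end

variable {G₁ : Type v} {G₀ : Type u} [Group G₁] [Group G₀]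

/-- The strict categorical group `𝒮(Ψ)` of a crossed module `Ψ`: its objects are the elements of
`G₀`. -/
@[ext]
structure S (Ψ : CrossedModule G₁ G₀) : Type u where
  of : G₀

namespace S

variable {Ψ : CrossedModule G₁ G₀}

/-- The arrows of `𝒮(Ψ)`: an arrow is a pair `(x, α)` in `G₀ ⋉ G₁`, with source `x` and target
`x * bd α`. -/
@[ext]
structure Hom (x y : S Ψ) : Type v where
  label : G₁
  tgt : x.of * Ψ.bd label = y.of

instance : Category.{v} (S Ψ) where
  Hom x y := Hom x y
  id x := ⟨1, by simp⟩
  comp a b := ⟨a.label * b.label, by rw [map_mul, ← mul_assoc, a.tgt, b.tgt]⟩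
  id_comp a := Hom.ext (one_mul _)
  comp_id a := Hom.ext (mul_one _)
  assoc a b c := Hom.ext (mul_assoc _ _ _)

@[ext]
theorem hom_ext {x y : S Ψ} (a b : x ⟶ y) (h : Hom.label a = Hom.label b) : a = b :=
  Hom.ext h

instance : Groupoid.{v} (S Ψ) where
  inv a := ⟨(Hom.label a)⁻¹, by rw [map_inv, ← Hom.tgt a]; simp⟩
  inv_comp a := Hom.ext (inv_mul_cancel _)
  comp_inv a := Hom.ext (mul_inv_cancel _)

/-- The arrow with trivial label between equal objects. -/
def idIso (x y : S Ψ) (h : x.of = y.of) : x ≅ y where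
  hom := ⟨1, by simpa using h⟩
  inv := ⟨1, by simpa using h.symm⟩
  hom_inv_id := Hom.ext (one_mul _)
  inv_hom_id := Hom.ext (one_mul _)

@[simp]
theorem idIso_hom_label (x y : S Ψ) (h : x.of = y.of) : Hom.label (idIso x y h).hom = 1 := rfl

@[simp]
theorem idIso_inv_label (x y : S Ψ) (h : x.of = y.of) : Hom.label (idIso x y h).inv = 1 := rfl

/-- The strict monoidal structure given by the multiplications of `G₀` and of
`G₀ ⋉ G₁`, that is, `(x, α) (y, β) = (x * y, α ^ y * β)`. -/
instance : MonoidalCategoryStruct (S Ψ) where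
  tensorObj x y := ⟨x.of * y.of⟩
  tensorUnit := ⟨1⟩
  tensorHom {_ _ y _} a b := ⟨Ψ.act (Hom.label a) y.of * Hom.label b, by
    rw [map_mul, Ψ.bd_act, ← Hom.tgt a, ← Hom.tgt b]; group⟩
  whiskerLeft _ {_ _} b := ⟨Hom.label b, by rw [mul_assoc, Hom.tgt b]⟩
  whiskerRight a y := ⟨Ψ.act (Hom.label a) y.of, by
    rw [Ψ.bd_act, ← Hom.tgt a]; group⟩
  associator x y z := idIso _ _ (mul_assoc x.of y.of z.of)
  leftUnitor x := idIso _ _ (one_mul x.of)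
  rightUnitor x := idIso _ _ (mul_one x.of)

theorem comp_label {x y z : S Ψ} (a : x ⟶ y) (b : y ⟶ z) :
    Hom.label (a ≫ b) = Hom.label a * Hom.label b := rfl

theorem id_label (x : S Ψ) : Hom.label (𝟙 x) = 1 := rfl

theorem tensorHom_label {x y x' y' : S Ψ} (a : x ⟶ y) (b : x' ⟶ y') :
    Hom.label (MonoidalCategoryStruct.tensorHom a b)
      = Ψ.act (Hom.label a) x'.of * Hom.label b := rfl

theorem whiskerLeft_label (z : S Ψ) {x y : S Ψ} (a : x ⟶ y) :
    Hom.label (MonoidalCategoryStruct.whiskerLeft z a) = Hom.label a := rfl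

theorem whiskerRight_label (z : S Ψ) {x y : S Ψ} (a : x ⟶ y) :
    Hom.label (MonoidalCategoryStruct.whiskerRight a z) = Ψ.act (Hom.label a) z.of := rfl

theorem associator_label (x y z : S Ψ) :
    Hom.label (MonoidalCategoryStruct.associator x y z).hom = 1 := rfl

theorem leftUnitor_label (x : S Ψ) :
    Hom.label (MonoidalCategoryStruct.leftUnitor x).hom = 1 := rfl

theorem rightUnitor_label (x : S Ψ) :
    Hom.label (MonoidalCategoryStruct.rightUnitor x).hom = 1 := rfl

theorem tensorObj_of (x y : S Ψ) : (MonoidalCategoryStruct.tensorObj x y).of = x.of * y.of := rfl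

theorem tensorUnit_of : (MonoidalCategoryStruct.tensorUnit (S Ψ)).of = 1 := rfl

/-- Naturality of the action with respect to an arrow `y ⟶ y'`. -/
theorem act_tgt {x y : S Ψ} (a : x ⟶ y) (α : G₁) :
    Ψ.act α x.of * Hom.label a = Hom.label a * Ψ.act α y.of := by
  rw [← Hom.tgt a, Ψ.act_mul, Ψ.peiffer]; group

instance : MonoidalCategory (S Ψ) where
  tensorHom_def a b := by
    ext; simp only [tensorHom_label, comp_label, whiskerLeft_label, whiskerRight_label]
  id_tensorHom_id x y := by
    ext; simp only [tensorHom_label, id_label, Ψ.one_act, mul_one]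
  tensorHom_comp_tensorHom {x₁ y₁ z₁ x₂ y₂ z₂} a b c d := by
    ext
    simp only [tensorHom_label, comp_label, Ψ.mul_act, mul_assoc]
    rw [← mul_assoc (Hom.label b), ← act_tgt b, mul_assoc]
  whiskerLeft_id x y := by ext; rfl
  id_whiskerRight x y := by
    ext; simp only [whiskerRight_label, id_label, Ψ.one_act]
  associator_naturality a b c := by
    ext
    simp only [comp_label, tensorHom_label, associator_label, Ψ.mul_act, ← Ψ.act_mul,
      tensorObj_of, mul_one, one_mul, mul_assoc]
  leftUnitor_naturality a := by
    ext; simp only [comp_label, whiskerLeft_label, leftUnitor_label, mul_one, one_mul]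
  rightUnitor_naturality a := by
    ext
    simp only [comp_label, whiskerRight_label, rightUnitor_label, tensorUnit_of, Ψ.act_one,
      mul_one, one_mul]
  pentagon w x y z := by
    ext
    simp only [comp_label, whiskerLeft_label, whiskerRight_label, associator_label, Ψ.one_act,
      mul_one]
  triangle x y := by
    ext
    simp only [comp_label, whiskerLeft_label, whiskerRight_label, associator_label,
      leftUnitor_label, rightUnitor_label, Ψ.one_act, mul_one]

end S

/-- Equivalence of categorical groups: there is a (strong) monoidal functor that is an equivalence
of the underlying groupoids. -/
def EquivalentCatGroups (C D : Type*) [Category C] [MonoidalCategory C] [Category D]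
    [MonoidalCategory D] : Prop :=
  ∃ F : C ⥤ D, Nonempty F.Monoidal ∧ F.IsEquivalence

end CrossedModule

/-! ### Weak endomorphisms of a Lie crossed module -/

/-- A Lie crossed module: `G₀` and `G₁` are Lie groups, and the structure map and the action are
analytic (the smoothness exponent `ω` means real analytic). -/
structure LieCrossedModule {E₁ H₁ E₀ H₀ : Type*}
    [NormedAddCommGroup E₁] [NormedSpace ℝ E₁] [TopologicalSpace H₁] (I₁ : ModelWithCorners ℝ E₁ H₁)
    [NormedAddCommGroup E₀] [NormedSpace ℝ E₀] [TopologicalSpace H₀] (I₀ : ModelWithCorners ℝ E₀ H₀)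
    (G₁ G₀ : Type*)
    [Group G₁] [TopologicalSpace G₁] [ChartedSpace H₁ G₁] [LieGroup I₁ ω G₁]
    [Group G₀] [TopologicalSpace G₀] [ChartedSpace H₀ G₀] [LieGroup I₀ ω G₀]
    extends CrossedModule G₁ G₀ where
  bd_analytic : ContMDiff I₁ I₀ ω bd
  act_analytic : ContMDiff (I₁.prod I₀) I₁ ω (fun p : G₁ × G₀ => act p.1 p.2)

namespace LieCrossedModule

variable {E₁ H₁ E₀ H₀ : Type*}
    [NormedAddCommGroup E₁] [NormedSpace ℝ E₁] [TopologicalSpace H₁] {I₁ : ModelWithCorners ℝ E₁ H₁}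
    [NormedAddCommGroup E₀] [NormedSpace ℝ E₀] [TopologicalSpace H₀] {I₀ : ModelWithCorners ℝ E₀ H₀}
    {G₁ G₀ : Type*}
    [Group G₁] [TopologicalSpace G₁] [ChartedSpace H₁ G₁] [LieGroup I₁ ω G₁]
    [Group G₀] [TopologicalSpace G₀] [ChartedSpace H₀ G₀] [LieGroup I₀ ω G₀]

/-- A weak endomorphism `(p, κ)` of `Ψ`: pointed analytic maps `p₀`, `p₁` and an analytic map `κ`
satisfying (W1)-(W5). -/
@[ext]
structure WeakEnd (Ψ : LieCrossedModule I₁ I₀ G₁ G₀) where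
  p₀ : G₀ → G₀
  p₁ : G₁ → G₁
  κ : G₀ → G₀ → G₁
  p₀_one : p₀ 1 = 1
  p₁_one : p₁ 1 = 1
  w1 : ∀ α, p₀ (Ψ.bd α) = Ψ.bd (p₁ α)
  w2 : ∀ x y, p₀ x * p₀ y * Ψ.bd (κ x y) = p₀ (x * y)
  w3 : ∀ α β, p₁ α * p₁ β * κ (Ψ.bd α) (Ψ.bd β) = p₁ (α * β)
  w4 : ∀ x y z, Ψ.act (κ x y) (p₀ z) * κ (x * y) z = κ y z * κ x (y * z)
  w5 : ∀ α x, Ψ.act (p₁ α) (p₀ x) * κ (Ψ.bd α) x = p₁ (Ψ.act α x) * κ x (Ψ.bd (Ψ.act α x))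
  p₀_analytic : ContMDiff I₀ I₀ ω p₀
  p₁_analytic : ContMDiff I₁ I₁ ω p₁
  κ_analytic : ContMDiff (I₀.prod I₀) I₁ ω (fun q : G₀ × G₀ => κ q.1 q.2)

namespace WeakEnd

variable {Ψ : LieCrossedModule I₁ I₀ G₁ G₀} (F G : WeakEnd Ψ)

/-- The effect on labels of arrows of the functor `𝒮(Ψ) ⥤ 𝒮(Ψ)` that belongs to `F`. -/
def hat (x : G₀) (α : G₁) : G₁ := F.p₁ α * F.κ x (Ψ.bd α)

theorem κ_one_one : F.κ 1 1 = 1 := by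
  have h := F.w3 1 1
  simpa [F.p₁_one] using h

theorem κ_one_left (z : G₀) : F.κ 1 z = 1 := by
  have h := F.w4 1 1 z
  simpa [F.κ_one_one, Ψ.one_act] using h

theorem κ_one_right (x : G₀) : F.κ x 1 = 1 := by
  have h := F.w4 x 1 1
  simpa [F.κ_one_one, F.p₀_one, Ψ.act_one] using h

theorem hat_one_left (α : G₁) : F.hat 1 α = F.p₁ α := by
  simp [hat, F.κ_one_left]

theorem p₀_mul_bd (x : G₀) (α : G₁) : F.p₀ (x * Ψ.bd α) = F.p₀ x * Ψ.bd (F.hat x α) := by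
  rw [← F.w2, F.w1, hat, map_mul, mul_assoc]

theorem hat_mul (x : G₀) (α β : G₁) :
    F.hat x (α * β) = F.hat x α * F.hat (x * Ψ.bd α) β := by
  have h4 := F.w4 x (Ψ.bd α) (Ψ.bd β)
  rw [F.w1, Ψ.peiffer] at h4
  simp only [hat, ← F.w3, map_mul]
  rw [mul_assoc, ← h4]
  group

theorem κ_hat_left (z x : G₀) (α : G₁) :
    F.κ z x * F.hat (z * x) α = F.hat x α * F.κ z (x * Ψ.bd α) := by
  have h4 := F.w4 z x (Ψ.bd α)
  rw [F.w1, Ψ.peiffer] at h4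
  simp only [hat]
  rw [mul_assoc (F.p₁ α), ← h4]
  group

theorem κ_hat_right (x z : G₀) (α : G₁) :
    F.κ x z * F.hat (x * z) (Ψ.act α z)
      = Ψ.act (F.hat x α) (F.p₀ z) * F.κ (x * Ψ.bd α) z := by
  have h : z * Ψ.bd (Ψ.act α z) = Ψ.bd α * z := by rw [Ψ.bd_act]; group
  rw [F.κ_hat_left, h]
  simp only [hat, Ψ.mul_act]
  rw [mul_assoc (Ψ.act (F.p₁ α) (F.p₀ z)), F.w4, ← mul_assoc, F.w5]

theorem hat_one_right (x : G₀) : F.hat x 1 = 1 := by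
  simp [hat, F.p₁_one, F.κ_one_right]

/-- The Künneth map of a composite, as in `(f, κ) (g, γ) = (f ∘ g, β)`, where
`β x y = f₁ (γ x y) * κ (g₀ x) (g₀ y) (γ x y)` with the three-variable notation
`κ x y z = κ x y ^ p₀ z * κ (x * y) z`. -/
def compκ (x y : G₀) : G₁ :=
  F.p₁ (G.κ x y) * (Ψ.act (F.κ (G.p₀ x) (G.p₀ y)) (F.p₀ (Ψ.bd (G.κ x y)))
    * F.κ (G.p₀ x * G.p₀ y) (Ψ.bd (G.κ x y)))

theorem compκ_eq (x y : G₀) :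
    compκ F G x y = F.κ (G.p₀ x) (G.p₀ y) * F.hat (G.p₀ x * G.p₀ y) (G.κ x y) := by
  simp only [compκ, hat, F.w1, Ψ.peiffer]
  group

theorem hat_comp (x : G₀) (α : G₁) :
    F.p₁ (G.p₁ α) * compκ F G x (Ψ.bd α) = F.hat (G.p₀ x) (G.hat x α) := by
  rw [compκ_eq, ← mul_assoc, G.w1, show F.p₁ (G.p₁ α) * F.κ (G.p₀ x) (Ψ.bd (G.p₁ α))
    = F.hat (G.p₀ x) (G.p₁ α) from rfl, ← F.hat_mul]
  rfl

/-- Horizontal composition of weak endomorphisms. -/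
def comp : WeakEnd Ψ where
  p₀ x := F.p₀ (G.p₀ x)
  p₁ α := F.p₁ (G.p₁ α)
  κ := compκ F G
  p₀_one := by rw [G.p₀_one, F.p₀_one]
  p₁_one := by rw [G.p₁_one, F.p₁_one]
  w1 α := by rw [G.w1, F.w1]
  w2 x y := by
    rw [compκ_eq, map_mul, ← mul_assoc, F.w2, ← F.p₀_mul_bd, G.w2]
  w3 α β := by
    have h := F.hat_mul 1 (G.p₁ α * G.p₁ β) (G.κ (Ψ.bd α) (Ψ.bd β))
    rw [F.hat_one_left, F.hat_one_left, G.w3, one_mul, map_mul] at h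
    rw [compκ_eq, G.w1, G.w1, ← mul_assoc, F.w3, h]
  w4 x y z := by
    simp only [compκ_eq]
    have h1 := F.κ_hat_right (G.p₀ x * G.p₀ y) (G.p₀ z) (G.κ x y)
    have h2 := F.hat_mul (G.p₀ x * G.p₀ y * G.p₀ z) (Ψ.act (G.κ x y) (G.p₀ z)) (G.κ (x * y) z)
    have h3 := F.κ_hat_left (G.p₀ x) (G.p₀ y * G.p₀ z) (G.κ y z)
    have h4 := F.hat_mul (G.p₀ x * (G.p₀ y * G.p₀ z)) (G.κ y z) (G.κ x (y * z))
    have e1 : G.p₀ x * G.p₀ y * G.p₀ z * Ψ.bd (Ψ.act (G.κ x y) (G.p₀ z))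
        = G.p₀ (x * y) * G.p₀ z := by
      rw [Ψ.bd_act, ← G.w2 x y]; group
    have e2 : G.p₀ x * (G.p₀ y * G.p₀ z) * Ψ.bd (G.κ y z) = G.p₀ x * G.p₀ (y * z) := by
      rw [← G.w2 y z]; group
    rw [G.w2] at h1 h3
    rw [e1, G.w4] at h2
    rw [e2] at h4
    rw [Ψ.mul_act, mul_assoc, ← mul_assoc _ (F.κ _ _) (F.hat _ _), ← h1, mul_assoc, ← h2,
      ← mul_assoc, F.w4, mul_assoc (G.p₀ x), h4, mul_assoc, ← mul_assoc (F.κ (G.p₀ x) _), h3]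
    simp only [mul_assoc]
  w5 α x := by
    have h1 := F.κ_hat_right 1 (G.p₀ x) (G.p₁ α)
    have h2 := F.hat_mul (G.p₀ x) (Ψ.act (G.p₁ α) (G.p₀ x)) (G.κ (Ψ.bd α) x)
    have e1 : G.p₀ x * Ψ.bd (Ψ.act (G.p₁ α) (G.p₀ x)) = G.p₀ (Ψ.bd α) * G.p₀ x := by
      rw [Ψ.bd_act, G.w1]; group
    rw [F.κ_one_left, one_mul, one_mul, one_mul, F.hat_one_left, ← G.w1] at h1
    rw [e1, G.w5] at h2
    rw [hat_comp, compκ_eq, ← mul_assoc, ← h1, ← h2]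
    rfl
  p₀_analytic := F.p₀_analytic.comp G.p₀_analytic
  p₁_analytic := F.p₁_analytic.comp G.p₁_analytic
  κ_analytic := by
    have hγ : ContMDiff (I₀.prod I₀) I₁ ω (fun q : G₀ × G₀ => G.κ q.1 q.2) := G.κ_analytic
    have hx : ContMDiff (I₀.prod I₀) I₀ ω (fun q : G₀ × G₀ => G.p₀ q.1) :=
      G.p₀_analytic.comp contMDiff_fst
    have hy : ContMDiff (I₀.prod I₀) I₀ ω (fun q : G₀ × G₀ => G.p₀ q.2) :=
      G.p₀_analytic.comp contMDiff_snd
    have hb : ContMDiff (I₀.prod I₀) I₀ ω (fun q : G₀ × G₀ => Ψ.bd (G.κ q.1 q.2)) :=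
      Ψ.bd_analytic.comp hγ
    exact (F.p₁_analytic.comp hγ).mul
      ((Ψ.act_analytic.comp ((F.κ_analytic.comp (hx.prodMk hy)).prodMk
        (F.p₀_analytic.comp hb))).mul
        (F.κ_analytic.comp ((hx.mul hy).prodMk hb)))

/-- The identity. -/
def one : WeakEnd Ψ where
  p₀ x := x
  p₁ α := α
  κ _ _ := 1
  p₀_one := rfl
  p₁_one := rfl
  w1 _ := rfl
  w2 x y := by simp
  w3 α β := by simp
  w4 x y z := by simp [Ψ.one_act]
  w5 α x := by simp
  p₀_analytic := contMDiff_id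
  p₁_analytic := contMDiff_id
  κ_analytic := contMDiff_const

/-- The monoid of weak endomorphisms. -/
instance : Monoid (WeakEnd Ψ) where
  mul := comp
  one := one
  mul_assoc F G K := by
    refine WeakEnd.ext rfl rfl ?_
    funext x y
    change compκ (comp F G) K x y = compκ F (comp G K) x y
    have e : ∀ a α, (comp F G).hat a α = F.hat (G.p₀ a) (G.hat a α) := fun a α =>
      hat_comp F G a α
    rw [compκ_eq, compκ_eq, e]
    change compκ F G _ _ * _ = F.κ (G.p₀ (K.p₀ x)) (G.p₀ (K.p₀ y)) * F.hat _ (compκ G K x y)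
    rw [compκ_eq F G, compκ_eq G K, F.hat_mul, mul_assoc, ← G.w2 (K.p₀ x)]
    rfl
  one_mul F := by
    refine WeakEnd.ext rfl rfl ?_
    funext x y
    change compκ one F x y = _
    rw [compκ_eq]; simp [hat, one]
  mul_one F := by
    refine WeakEnd.ext rfl rfl ?_
    funext x y
    change compκ F one x y = _
    rw [compκ_eq, show (one : WeakEnd Ψ).κ x y = 1 from rfl, F.hat_one_right, mul_one]
    rfl

theorem mul_p₀ (x : G₀) : (F * G).p₀ x = F.p₀ (G.p₀ x) := rfl

theorem mul_p₁ (α : G₁) : (F * G).p₁ α = F.p₁ (G.p₁ α) := rfl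

theorem mul_κ (x y : G₀) : (F * G).κ x y = F.κ (G.p₀ x) (G.p₀ y)
    * F.hat (G.p₀ x * G.p₀ y) (G.κ x y) := compκ_eq F G x y

theorem mul_hat (x : G₀) (α : G₁) : (F * G).hat x α = F.hat (G.p₀ x) (G.hat x α) :=
  hat_comp F G x α

theorem one_p₀ (x : G₀) : (1 : WeakEnd Ψ).p₀ x = x := rfl

theorem one_p₁ (α : G₁) : (1 : WeakEnd Ψ).p₁ α = α := rfl

theorem one_hat (x : G₀) (α : G₁) : (1 : WeakEnd Ψ).hat x α = α := mul_one α

theorem hat_analytic : ContMDiff (I₀.prod I₁) I₁ ω (fun q : G₀ × G₁ => F.hat q.1 q.2) :=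
  (F.p₁_analytic.comp contMDiff_snd).mul
    (F.κ_analytic.comp (contMDiff_fst.prodMk (Ψ.bd_analytic.comp contMDiff_snd)))

end WeakEnd

/-- Pointed analytic maps `G₀ → G₁`. -/
@[ext]
structure PointedMap (Ψ : LieCrossedModule I₁ I₀ G₁ G₀) where
  fn : G₀ → G₁
  map_one : fn 1 = 1
  analytic : ContMDiff I₀ I₁ ω fn

namespace PointedMap

variable {Ψ : LieCrossedModule I₁ I₀ G₁ G₀}

/-- Pointed maps form a monoid under `(χ₁ ∘ χ₂) x = χ₂ x * χ₁ (x * bd (χ₂ x))`. -/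
instance : Monoid (PointedMap Ψ) where
  mul χ₁ χ₂ :=
    { fn := fun x => χ₂.fn x * χ₁.fn (x * Ψ.bd (χ₂.fn x))
      map_one := by simp [χ₁.map_one, χ₂.map_one]
      analytic := χ₂.analytic.mul
        (χ₁.analytic.comp (contMDiff_id.mul (Ψ.bd_analytic.comp χ₂.analytic))) }
  one := ⟨fun _ => 1, rfl, contMDiff_const⟩
  mul_assoc χ₁ χ₂ χ₃ := by
    refine PointedMap.ext ?_
    funext x
    change χ₃.fn x * (χ₂.fn _ * χ₁.fn _) = χ₃.fn x * χ₂.fn _ * χ₁.fn _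
    change _ = _ * χ₁.fn (x * Ψ.bd (χ₃.fn x * χ₂.fn (x * Ψ.bd (χ₃.fn x))))
    rw [map_mul, mul_assoc, mul_assoc]
  one_mul χ := by
    refine PointedMap.ext ?_
    funext x
    exact mul_one _
  mul_one χ := by
    refine PointedMap.ext ?_
    funext x
    change 1 * χ.fn (x * Ψ.bd 1) = χ.fn x
    simp

theorem mul_fn (χ₁ χ₂ : PointedMap Ψ) (x : G₀) :
    (χ₁ * χ₂).fn x = χ₂.fn x * χ₁.fn (x * Ψ.bd (χ₂.fn x)) := rfl

theorem one_fn (x : G₀) : (1 : PointedMap Ψ).fn x = 1 := rfl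

/-- The weak endomorphism `δ η`. -/
def delta (η : PointedMap Ψ) : WeakEnd Ψ where
  p₀ x := x * Ψ.bd (η.fn x)
  p₁ α := α * η.fn (Ψ.bd α)
  κ x y := (η.fn y)⁻¹ * (Ψ.act (η.fn x) y)⁻¹ * η.fn (x * y)
  p₀_one := by simp [η.map_one]
  p₁_one := by simp [η.map_one]
  w1 α := by simp
  w2 x y := by
    simp only [map_mul, map_inv, Ψ.bd_act]; group
  w3 α β := by
    simp only [map_mul, Ψ.peiffer]; group
  w4 x y z := by
    simp only [Ψ.act_mul, Ψ.mul_act, Ψ.inv_act, Ψ.peiffer, mul_assoc]; group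
  w5 α x := by
    have h : x * Ψ.bd (Ψ.act α x) = Ψ.bd α * x := by rw [Ψ.bd_act]; group
    rw [h]
    simp only [Ψ.act_mul, Ψ.mul_act, Ψ.peiffer]; group
  p₀_analytic := contMDiff_id.mul (Ψ.bd_analytic.comp η.analytic)
  p₁_analytic := contMDiff_id.mul (η.analytic.comp Ψ.bd_analytic)
  κ_analytic := by
    have hx : ContMDiff (I₀.prod I₀) I₁ ω (fun q : G₀ × G₀ => η.fn q.1) :=
      η.analytic.comp contMDiff_fst
    have hy : ContMDiff (I₀.prod I₀) I₁ ω (fun q : G₀ × G₀ => η.fn q.2) :=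
      η.analytic.comp contMDiff_snd
    exact (hy.inv.mul (Ψ.act_analytic.comp (hx.prodMk contMDiff_snd)).inv).mul
      (η.analytic.comp (contMDiff_fst.mul contMDiff_snd))

theorem delta_hat (η : PointedMap Ψ) (x : G₀) (α : G₁) :
    (delta η).hat x α = (η.fn x)⁻¹ * α * η.fn (x * Ψ.bd α) := by
  simp only [WeakEnd.hat, delta, Ψ.peiffer]; group

/-- `δ` as a homomorphism of monoids. -/
def deltaHom : PointedMap Ψ →* WeakEnd Ψ where
  toFun := delta
  map_one' := by
    refine WeakEnd.ext ?_ ?_ ?_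
    · funext x; change x * Ψ.bd 1 = x; simp
    · funext x; exact mul_one _
    · funext x y; change 1⁻¹ * (Ψ.act 1 y)⁻¹ * 1 = (1 : G₁); simp [Ψ.one_act]
  map_mul' χ₁ χ₂ := by
    refine WeakEnd.ext ?_ ?_ ?_
    · funext x
      simp only [WeakEnd.mul_p₀, delta, mul_fn, map_mul, mul_assoc]
    · funext α
      simp only [WeakEnd.mul_p₁, delta, mul_fn, map_mul, mul_assoc]
    · funext x y
      have h : x * Ψ.bd (χ₂.fn x) * (y * Ψ.bd (χ₂.fn y))
          * Ψ.bd ((delta χ₂).κ x y) = x * y * Ψ.bd (χ₂.fn (x * y)) := (delta χ₂).w2 x y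
      rw [WeakEnd.mul_κ, delta_hat]
      change _ = _ * (_ * _ * χ₁.fn (x * Ψ.bd (χ₂.fn x) * (y * Ψ.bd (χ₂.fn y))
          * Ψ.bd ((delta χ₂).κ x y)))
      rw [h]
      simp only [delta, mul_fn, Ψ.mul_act, Ψ.act_mul, Ψ.peiffer]
      group

/-- The right action of an invertible weak endomorphism `F` on pointed maps,
`η ^ F = fun x => f₁⁻¹ (η (f₀ x)) * γ (f₀ x) (η (f₀ x))`, where `γ` is the Künneth map of `F⁻¹`. -/
def pull (η : PointedMap Ψ) (F : (WeakEnd Ψ)ˣ) : PointedMap Ψ where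
  fn x := (↑F⁻¹ : WeakEnd Ψ).p₁ (η.fn ((F : WeakEnd Ψ).p₀ x))
    * (↑F⁻¹ : WeakEnd Ψ).κ ((F : WeakEnd Ψ).p₀ x) (Ψ.bd (η.fn ((F : WeakEnd Ψ).p₀ x)))
  map_one := by
    rw [WeakEnd.p₀_one, η.map_one, WeakEnd.p₁_one, _root_.map_one, WeakEnd.κ_one_right, one_mul]
  analytic := by
    have h := η.analytic.comp (F : WeakEnd Ψ).p₀_analytic
    exact (↑F⁻¹ : WeakEnd Ψ).hat_analytic.comp ((F : WeakEnd Ψ).p₀_analytic.prodMk h)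

theorem pull_fn (η : PointedMap Ψ) (F : (WeakEnd Ψ)ˣ) (x : G₀) :
    (pull η F).fn x
      = (↑F⁻¹ : WeakEnd Ψ).hat ((F : WeakEnd Ψ).p₀ x) (η.fn ((F : WeakEnd Ψ).p₀ x)) := rfl

theorem inv_p₀ (F : (WeakEnd Ψ)ˣ) (x : G₀) :
    (↑F⁻¹ : WeakEnd Ψ).p₀ ((F : WeakEnd Ψ).p₀ x) = x := by
  rw [← WeakEnd.mul_p₀, Units.inv_mul, WeakEnd.one_p₀]

theorem p₀_inv (F : (WeakEnd Ψ)ˣ) (x : G₀) :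
    (F : WeakEnd Ψ).p₀ ((↑F⁻¹ : WeakEnd Ψ).p₀ x) = x := by
  rw [← WeakEnd.mul_p₀, Units.mul_inv, WeakEnd.one_p₀]

theorem hat_pull (η : PointedMap Ψ) (F : (WeakEnd Ψ)ˣ) (x : G₀) :
    (F : WeakEnd Ψ).hat x ((pull η F).fn x) = η.fn ((F : WeakEnd Ψ).p₀ x) := by
  have h := WeakEnd.mul_hat (F : WeakEnd Ψ) (↑F⁻¹) ((F : WeakEnd Ψ).p₀ x)
    (η.fn ((F : WeakEnd Ψ).p₀ x))
  rw [Units.mul_inv, WeakEnd.one_hat, inv_p₀] at h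
  exact h.symm

theorem p₀_pull (η : PointedMap Ψ) (F : (WeakEnd Ψ)ˣ) (x : G₀) :
    (F : WeakEnd Ψ).p₀ (x * Ψ.bd ((pull η F).fn x))
      = (F : WeakEnd Ψ).p₀ x * Ψ.bd (η.fn ((F : WeakEnd Ψ).p₀ x)) := by
  rw [WeakEnd.p₀_mul_bd, hat_pull]

theorem pull_one (F : (WeakEnd Ψ)ˣ) : pull 1 F = 1 := by
  refine PointedMap.ext ?_
  funext x
  rw [pull_fn, one_fn, WeakEnd.hat_one_right, one_fn]

theorem pull_mul (χ₁ χ₂ : PointedMap Ψ) (F : (WeakEnd Ψ)ˣ) :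
    pull (χ₁ * χ₂) F = pull χ₁ F * pull χ₂ F := by
  refine PointedMap.ext ?_
  funext x
  rw [mul_fn, pull_fn χ₁, p₀_pull, pull_fn, mul_fn, WeakEnd.hat_mul]
  rfl

theorem pull_id (η : PointedMap Ψ) : pull η 1 = η := by
  refine PointedMap.ext ?_
  funext x
  exact WeakEnd.one_hat x _

theorem pull_pull (η : PointedMap Ψ) (F G : (WeakEnd Ψ)ˣ) :
    pull η (F * G) = pull (pull η F) G := by
  refine PointedMap.ext ?_
  funext x
  rw [pull_fn, pull_fn, pull_fn, mul_inv_rev, Units.val_mul, Units.val_mul, WeakEnd.mul_hat,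
    WeakEnd.mul_p₀, inv_p₀]

theorem mul_delta_pull (η : PointedMap Ψ) (F : (WeakEnd Ψ)ˣ) :
    (F : WeakEnd Ψ) * delta (pull η F) = delta η * (F : WeakEnd Ψ) := by
  set f : WeakEnd Ψ := (F : WeakEnd Ψ) with hf
  set η' := pull η F with hη
  have hp : ∀ x, f.hat x (η'.fn x) = η.fn (f.p₀ x) := hat_pull η F
  refine WeakEnd.ext ?_ ?_ ?_
  · funext x
    exact p₀_pull η F x
  · funext α
    rw [WeakEnd.mul_p₁, WeakEnd.mul_p₁]
    have h := f.hat_mul 1 α (η'.fn (Ψ.bd α))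
    rw [one_mul, hp, WeakEnd.hat_one_left, WeakEnd.hat_one_left, f.w1] at h
    exact h
  · funext x y
    rw [WeakEnd.mul_κ, WeakEnd.mul_κ, delta_hat, f.w2]
    have h1 := f.κ_hat_right x y (η'.fn x)
    have h2 := f.κ_hat_left (x * Ψ.bd (η'.fn x)) y (η'.fn y)
    have h3 := f.hat_mul (x * y) (Ψ.act (η'.fn x) y) (η'.fn y)
    have e3 : x * y * Ψ.bd (Ψ.act (η'.fn x) y) = x * Ψ.bd (η'.fn x) * y := by
      rw [Ψ.bd_act]; group
    have h4 := f.hat_mul (x * y) (Ψ.act (η'.fn x) y * η'.fn y) ((delta η').κ x y)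
    have e4 : Ψ.act (η'.fn x) y * η'.fn y * (delta η').κ x y = η'.fn (x * y) := by
      simp only [delta]; group
    have e5 : x * y * Ψ.bd (Ψ.act (η'.fn x) y * η'.fn y)
        = (delta η').p₀ x * (delta η').p₀ y := by
      rw [map_mul, Ψ.bd_act]; simp only [delta]; group
    rw [e3] at h3
    rw [e4, e5, hp] at h4
    rw [hp] at h1 h2
    have h5 : Ψ.act (η.fn (f.p₀ x)) (f.p₀ y) * (η.fn (f.p₀ y)
        * f.κ ((delta η').p₀ x) ((delta η').p₀ y))
        = f.κ x y * f.hat (x * y) (Ψ.act (η'.fn x) y * η'.fn y) := by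
      rw [h3, ← mul_assoc (f.κ x y), h1, mul_assoc, h2]
      rfl
    have h6 : f.κ ((delta η').p₀ x) ((delta η').p₀ y)
        = (η.fn (f.p₀ y))⁻¹ * ((Ψ.act (η.fn (f.p₀ x)) (f.p₀ y))⁻¹
          * (f.κ x y * f.hat (x * y) (Ψ.act (η'.fn x) y * η'.fn y))) := by
      rw [← h5]; group
    rw [h6, h4]
    simp only [delta]
    group

theorem pull_delta (χ : PointedMap Ψ) (η : (PointedMap Ψ)ˣ) :
    pull χ (Units.map deltaHom η) = (↑η⁻¹ : PointedMap Ψ) * χ * (η : PointedMap Ψ) := by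
  refine PointedMap.ext ?_
  funext x
  have h : ∀ x, (η : PointedMap Ψ).fn x * (↑η⁻¹ : PointedMap Ψ).fn
      (x * Ψ.bd ((η : PointedMap Ψ).fn x)) = 1 := fun x => by
    rw [← mul_fn, Units.inv_mul, one_fn]
  rw [pull_fn, ← map_inv]
  change (delta _).hat _ _ = _
  rw [delta_hat, mul_fn, mul_fn]
  change ((↑η⁻¹ : PointedMap Ψ).fn (x * Ψ.bd ((η : PointedMap Ψ).fn x)))⁻¹
    * χ.fn (x * Ψ.bd ((η : PointedMap Ψ).fn x)) * _ = _
  rw [inv_eq_of_mul_eq_one_left (h x), mul_assoc]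
  rfl

end PointedMap

variable (Ψ : LieCrossedModule I₁ I₀ G₁ G₀)

/-- The weak actor crossed module: the group of invertible pointed (analytic) maps, mapping to the
group of invertible (analytic) weak endomorphisms. -/
def wAct : CrossedModule (PointedMap Ψ)ˣ (WeakEnd Ψ)ˣ where
  bd := Units.map PointedMap.deltaHom
  act η F :=
    { val := PointedMap.pull η F
      inv := PointedMap.pull ↑η⁻¹ F
      val_inv := by rw [← PointedMap.pull_mul, Units.mul_inv, PointedMap.pull_one]
      inv_val := by rw [← PointedMap.pull_mul, Units.inv_mul, PointedMap.pull_one] }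
  act_one η := Units.ext (PointedMap.pull_id _)
  act_mul η F G := Units.ext (PointedMap.pull_pull _ F G)
  mul_act η χ F := Units.ext (PointedMap.pull_mul _ _ F)
  bd_act η F := by
    rw [mul_assoc, eq_inv_mul_iff_mul_eq]
    exact Units.ext (PointedMap.mul_delta_pull _ F)
  peiffer η χ := Units.ext (PointedMap.pull_delta _ η)

/-- The centre-preserving weak automorphisms: those that restrict to the identity on
`π₁(Ψ) = ker bd`. -/
def centrePreserving : Subgroup (WeakEnd Ψ)ˣ where
  carrier := {F | ∀ α, Ψ.bd α = 1 → (F : WeakEnd Ψ).p₁ α = α}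
  one_mem' _ _ := rfl
  mul_mem' {F G} hF hG α h := by
    change (F : WeakEnd Ψ).p₁ ((G : WeakEnd Ψ).p₁ α) = α
    rw [hG α h, hF α h]
  inv_mem' {F} hF α h := by
    change (↑F⁻¹ : WeakEnd Ψ).p₁ α = α
    conv_lhs => rw [← hF α h]
    rw [← WeakEnd.mul_p₁, Units.inv_mul, WeakEnd.one_p₁]

/-- The crossed module `wAct⁺(Ψ)` of centre-preserving weak automorphisms, a sub-crossed module of
`wAct Ψ`. -/
def wActPlus : CrossedModule (PointedMap Ψ)ˣ (centrePreserving Ψ) where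
  bd := (wAct Ψ).bd.codRestrict (centrePreserving Ψ) (fun η α h => by
    change α * (η : PointedMap Ψ).fn (Ψ.bd α) = α
    rw [h, PointedMap.map_one, mul_one])
  act η F := (wAct Ψ).act η F
  act_one := (wAct Ψ).act_one
  act_mul η F G := (wAct Ψ).act_mul η F G
  mul_act η χ F := (wAct Ψ).mul_act η χ F
  bd_act η F := Subtype.ext ((wAct Ψ).bd_act η F)
  peiffer η χ := (wAct Ψ).peiffer η χ

end LieCrossedModule

/-! ### Discrete Lie groups -/

/-- A copy of `X`, with the discrete topology and regarded as a `0`-dimensional manifold. -/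
def Disc (X : Type*) : Type _ := X

namespace Disc

/-- The identity `X → Disc X`. -/
def mk {X : Type*} (x : X) : Disc X := x

/-- The identity `Disc X → X`. -/
def get {X : Type*} (x : Disc X) : X := x

variable (X : Type*)

instance [Group X] : Group (Disc X) := inferInstanceAs (Group X)

instance : TopologicalSpace (Disc X) := ⊥

instance : DiscreteTopology (Disc X) := ⟨rfl⟩

noncomputable instance : ChartedSpace (EuclideanSpace ℝ (Fin 0)) (Disc X) :=
  ChartedSpace.ofDiscreteTopology

instance : IsManifold (𝓡 0) ω (Disc X) := IsManifold.of_discreteTopology ω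

instance [Group X] : LieGroup (𝓡 0) ω (Disc X) where
  contMDiff_mul := contMDiff_of_discreteTopology
  contMDiff_inv := contMDiff_of_discreteTopology

end Disc

/-! ### The categorical group `𝒯 ⋊ {±1}` -/

section Torus

variable (L : Type u) [AddCommGroup L]

/-- The Lie algebra `𝔱 = ℝ ⊗ L` of the torus of a (coweight) lattice `L`. -/
def LieAlg : Type u := ℝ ⊗[ℤ] L

namespace LieAlg

noncomputable instance : AddCommGroup (LieAlg L) := inferInstanceAs (AddCommGroup (ℝ ⊗[ℤ] L))

noncomputable instance : Module ℝ (LieAlg L) := inferInstanceAs (Module ℝ (ℝ ⊗[ℤ] L))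

variable [Module.Finite ℤ L]

instance : Module.Finite ℝ (LieAlg L) := inferInstanceAs (Module.Finite ℝ (ℝ ⊗[ℤ] L))

/-- A norm on `𝔱`, obtained from a choice of coordinates. As `𝔱` is finite dimensional, the
notion of an analytic map does not depend on this choice. -/
noncomputable instance : NormedAddCommGroup (LieAlg L) :=
  NormedAddCommGroup.induced _ _ (Module.finBasis ℝ (LieAlg L)).equivFun.toLinearMap
    (Module.finBasis ℝ (LieAlg L)).equivFun.injective

noncomputable instance : NormedSpace ℝ (LieAlg L) :=
  NormedSpace.induced ℝ _ _ (Module.finBasis ℝ (LieAlg L)).equivFun.toLinearMap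

end LieAlg

variable {L}

/-- The inclusion `L → 𝔱`, `m ↦ 1 ⊗ m`. -/
noncomputable def latticeIncl : L →+ LieAlg L := (TensorProduct.mk ℤ ℝ L 1).toAddMonoidHom

/-- The real bilinear extension of a bilinear form `J` on `L` to `𝔱`. -/
noncomputable def realExt (J : LinearMap.BilinForm ℤ L) : LieAlg L →ₗ[ℝ] LieAlg L →ₗ[ℝ] ℝ :=
  LinearMap.BilinForm.baseChange ℝ J

theorem realExt_latticeIncl (J : LinearMap.BilinForm ℤ L) (m n : L) :
    realExt J (latticeIncl m) (latticeIncl n) = J m n := by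
  refine (LinearMap.BilinForm.baseChange_tmul (A := ℝ) J 1 m 1 n).trans ?_
  simp

/-- The isomorphism `ℝ/ℤ ≅ U(1)`, as a homomorphism `r ↦ exp (2πi r)` from `ℝ`. -/
noncomputable def e : ℝ →+ Additive Circle :=
  Circle.expHom.comp (AddMonoidHom.mulLeft (2 * Real.pi))

theorem e_int (k : ℤ) : e k = 0 := by
  change Additive.ofMul (Circle.exp (2 * Real.pi * k)) = 0
  rw [mul_comm, Circle.exp_int_mul_two_pi]; rfl

variable (L)

/-- The group `𝔱 ⋊ {±1}`, as a manifold the product of `𝔱` and the discrete space `{±1}`. -/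
def Theta₀ : Type u := LieAlg L × Disc ℤˣ

/-- The group `L × U(1)`, with `L` discrete. -/
abbrev Theta₁ : Type u := Disc (Multiplicative L) × Circle

namespace Theta₀

variable {L}

/-- The element `(x, ε)` of `𝔱 ⋊ {±1}`. -/
def mk (x : LieAlg L) (ε : ℤˣ) : Theta₀ L := (x, Disc.mk ε)

/-- The first component. -/
def pt (p : Theta₀ L) : LieAlg L := p.1

/-- The second component. -/
def sgn (p : Theta₀ L) : ℤˣ := p.2.get

@[ext]
theorem ext {p q : Theta₀ L} (h : p.pt = q.pt) (h' : p.sgn = q.sgn) : p = q := Prod.ext h h'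

noncomputable instance : Mul (Theta₀ L) :=
  ⟨fun p q => mk (p.pt + (p.sgn : ℤ) • q.pt) (p.sgn * q.sgn)⟩

noncomputable instance : One (Theta₀ L) := ⟨mk 0 1⟩

noncomputable instance : Inv (Theta₀ L) := ⟨fun p => mk (-((p.sgn : ℤ) • p.pt)) p.sgn⟩

theorem mul_pt (p q : Theta₀ L) : (p * q).pt = p.pt + (p.sgn : ℤ) • q.pt := rfl
theorem mul_sgn (p q : Theta₀ L) : (p * q).sgn = p.sgn * q.sgn := rfl
theorem one_pt : (1 : Theta₀ L).pt = 0 := rfl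
theorem one_sgn : (1 : Theta₀ L).sgn = 1 := rfl
theorem inv_pt (p : Theta₀ L) : p⁻¹.pt = -((p.sgn : ℤ) • p.pt) := rfl
theorem inv_sgn (p : Theta₀ L) : p⁻¹.sgn = p.sgn := rfl

noncomputable instance : Group (Theta₀ L) :=
  Group.ofLeftAxioms
    (fun p q r => by
      refine Theta₀.ext ?_ ?_
      · simp only [mul_pt, mul_sgn, smul_add, smul_smul, Units.val_mul, add_assoc]
      · exact mul_assoc _ _ _)
    (fun p => by
      refine Theta₀.ext ?_ ?_
      · simp [mul_pt, one_pt, one_sgn]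
      · exact one_mul _)
    (fun p => by
      refine Theta₀.ext ?_ ?_
      · simp [mul_pt, one_pt, inv_pt, inv_sgn]
      · exact Int.units_mul_self p.sgn)

variable [Module.Finite ℤ L]

noncomputable instance : TopologicalSpace (Theta₀ L) :=
  inferInstanceAs (TopologicalSpace (LieAlg L × Disc ℤˣ))

noncomputable instance :
    ChartedSpace (ModelProd (LieAlg L) (EuclideanSpace ℝ (Fin 0))) (Theta₀ L) :=
  inferInstanceAs (ChartedSpace _ (LieAlg L × Disc ℤˣ))

instance : IsManifold (𝓘(ℝ, LieAlg L).prod (𝓡 0)) ω (Theta₀ L) :=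
  inferInstanceAs (IsManifold (𝓘(ℝ, LieAlg L).prod (𝓡 0)) ω (LieAlg L × Disc ℤˣ))

theorem pt_analytic : ContMDiff (𝓘(ℝ, LieAlg L).prod (𝓡 0)) 𝓘(ℝ, LieAlg L) ω (pt (L := L)) :=
  contMDiff_fst (M := LieAlg L) (N := Disc ℤˣ)

theorem sgn_analytic : ContMDiff (𝓘(ℝ, LieAlg L).prod (𝓡 0)) (𝓡 0) ω
    (fun p : Theta₀ L => Disc.mk p.sgn) :=
  contMDiff_snd (M := LieAlg L) (N := Disc ℤˣ)

theorem sgn_real_analytic : ContMDiff (𝓘(ℝ, LieAlg L).prod (𝓡 0)) 𝓘(ℝ) ω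
    (fun p : Theta₀ L => ((p.sgn : ℤ) : ℝ)) :=
  (contMDiff_of_discreteTopology (I := 𝓡 0) (M := Disc ℤˣ)
    (f := fun ε : Disc ℤˣ => ((ε.get : ℤ) : ℝ))).comp sgn_analytic

noncomputable instance : LieGroup (𝓘(ℝ, LieAlg L).prod (𝓡 0)) ω (Theta₀ L) where
  contMDiff_mul := by
    have h1 : ContMDiff _ 𝓘(ℝ, LieAlg L) ω
        (fun p : Theta₀ L × Theta₀ L => p.1.pt + ((p.1.sgn : ℤ) : ℝ) • p.2.pt) :=
      (pt_analytic.comp contMDiff_fst).add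
        ((sgn_real_analytic.comp contMDiff_fst).smul (pt_analytic.comp contMDiff_snd))
    have h2 : ContMDiff _ (𝓡 0) ω (fun p : Theta₀ L × Theta₀ L =>
        Disc.mk p.1.sgn * Disc.mk p.2.sgn) :=
      (sgn_analytic.comp contMDiff_fst).mul (sgn_analytic.comp contMDiff_snd)
    refine (h1.prodMk h2).congr fun p => ?_
    refine Prod.ext ?_ rfl
    change p.1.pt + (p.1.sgn : ℤ) • p.2.pt = p.1.pt + ((p.1.sgn : ℤ) : ℝ) • p.2.pt
    rw [Int.cast_smul_eq_zsmul]
  contMDiff_inv := by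
    have h1 : ContMDiff _ 𝓘(ℝ, LieAlg L) ω
        (fun p : Theta₀ L => -(((p.sgn : ℤ) : ℝ) • p.pt)) :=
      (sgn_real_analytic.smul pt_analytic).neg
    refine (h1.prodMk sgn_analytic).congr fun p => ?_
    refine Prod.ext ?_ rfl
    change -((p.sgn : ℤ) • p.pt) = -(((p.sgn : ℤ) : ℝ) • p.pt)
    rw [Int.cast_smul_eq_zsmul]

end Theta₀

variable {L}

namespace Theta₁

set_option linter.unusedSectionVars false

/-- The element `(m, z)` of `L × U(1)`. -/
def mk (m : L) (z : Circle) : Theta₁ L := (Disc.mk (Multiplicative.ofAdd m), z)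

/-- The first component. -/
def lat (α : Theta₁ L) : L := Multiplicative.toAdd α.1.get

theorem ext {α β : Theta₁ L} (h : α.lat = β.lat) (h' : α.2 = β.2) : α = β := Prod.ext h h'

theorem mk_lat (m : L) (z : Circle) : (mk m z).lat = m := rfl
theorem mk_snd (m : L) (z : Circle) : (mk m z).2 = z := rfl
theorem mul_lat (α β : Theta₁ L) : (α * β).lat = α.lat + β.lat := rfl
theorem inv_lat (α : Theta₁ L) : (α⁻¹).lat = -α.lat := rfl
theorem one_lat : (1 : Theta₁ L).lat = 0 := rfl

theorem lat_analytic {E H M : Type*} [NormedAddCommGroup E] [NormedSpace ℝ E] [TopologicalSpace H]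
    (I : ModelWithCorners ℝ E H) [TopologicalSpace M] [ChartedSpace H M] (f : L → M) :
    ContMDiff ((𝓡 0).prod (𝓡 1)) I ω (fun α : Theta₁ L => f α.lat) :=
  (contMDiff_of_discreteTopology (I := 𝓡 0) (M := Disc (Multiplicative L))
    (f := fun m => f (Multiplicative.toAdd m.get))).comp contMDiff_fst

end Theta₁

/-- The crossed module `Θ'` underlying `𝒯 ⋊ {±1}`: the structure map is
`(m, z) ↦ (m, 1)`, and `(m, z) ^ (x, ε) = (ε m, z * exp (2πi J(m, x)))`. -/
noncomputable def thetaCM (J : LinearMap.BilinForm ℤ L) :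
    CrossedModule (Theta₁ L) (Theta₀ L) where
  bd :=
    { toFun := fun α => Theta₀.mk (latticeIncl α.lat) 1
      map_one' := Theta₀.ext (map_zero latticeIncl) rfl
      map_mul' := fun α β => by
        refine Theta₀.ext ?_ ?_
        · change latticeIncl (α.lat + β.lat)
            = latticeIncl α.lat + ((1 : ℤˣ) : ℤ) • latticeIncl β.lat
          rw [map_add, Units.val_one, one_smul]
        · rfl }
  act α p := Theta₁.mk ((p.sgn : ℤ) • α.lat)
    (α.2 * Additive.toMul (e (realExt J (latticeIncl α.lat) p.pt)))
  act_one α := by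
    refine Theta₁.ext ?_ ?_
    · rw [Theta₁.mk_lat, Theta₀.one_sgn, Units.val_one, one_smul]
    · rw [Theta₁.mk_snd, Theta₀.one_pt, map_zero, map_zero, toMul_zero, mul_one]
  act_mul α x y := by
    refine Theta₁.ext ?_ ?_
    · simp only [Theta₁.mk_lat, Theta₀.mul_sgn, Units.val_mul, smul_smul]
      rw [mul_comm]
    · simp only [Theta₁.mk_lat, Theta₁.mk_snd, Theta₀.mul_pt, map_add, toMul_add, map_zsmul,
        LinearMap.smul_apply, mul_assoc]
  mul_act α β x := by
    refine Theta₁.ext ?_ ?_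
    · simp only [Theta₁.mk_lat, Theta₁.mul_lat, smul_add]
    · simp only [Theta₁.mk_snd, Theta₁.mul_lat, map_add, LinearMap.add_apply, toMul_add,
        Prod.snd_mul]
      exact mul_mul_mul_comm _ _ _ _
  bd_act α x := by
    rw [mul_assoc, eq_inv_mul_iff_mul_eq]
    refine Theta₀.ext ?_ ?_
    · change x.pt + (x.sgn : ℤ) • latticeIncl ((x.sgn : ℤ) • α.lat)
        = latticeIncl α.lat + ((1 : ℤˣ) : ℤ) • x.pt
      rw [map_zsmul, smul_smul, ← Units.val_mul, Int.units_mul_self, Units.val_one, one_smul,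
        one_smul, add_comm]
    · exact mul_comm x.sgn 1
  peiffer α β := by
    refine Theta₁.ext ?_ ?_
    · change ((1 : ℤˣ) : ℤ) • β.lat = -α.lat + β.lat + α.lat
      rw [Units.val_one, one_smul]; abel
    · change β.2 * Additive.toMul (e (realExt J (latticeIncl β.lat) (latticeIncl α.lat)))
        = α.2⁻¹ * β.2 * α.2
      rw [realExt_latticeIncl, e_int, toMul_zero, mul_one, mul_right_comm, inv_mul_cancel, one_mul]

/-- `Θ'` as a Lie crossed module. -/
noncomputable def thetaPrime [Module.Finite ℤ L] (J : LinearMap.BilinForm ℤ L) :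
    LieCrossedModule ((𝓡 0).prod (𝓡 1)) (𝓘(ℝ, LieAlg L).prod (𝓡 0)) (Theta₁ L) (Theta₀ L) where
  toCrossedModule := thetaCM J
  bd_analytic :=
    (Theta₁.lat_analytic 𝓘(ℝ, LieAlg L) latticeIncl).prodMk (contMDiff_const (c := (1 : Disc ℤˣ)))
  act_analytic := by
    have h1 : ContMDiff (((𝓡 0).prod (𝓡 1)).prod (𝓘(ℝ, LieAlg L).prod (𝓡 0))) (𝓡 0) ω
        (fun q : Theta₁ L × Theta₀ L =>
          Disc.mk (Multiplicative.ofAdd ((q.2.sgn : ℤ) • q.1.lat))) :=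
      (contMDiff_of_discreteTopology (I := (𝓡 0).prod (𝓡 0)) (I' := 𝓡 0)
        (M := Disc (Multiplicative L) × Disc ℤˣ) (M' := Disc (Multiplicative L))
        (f := fun r => Disc.mk (Multiplicative.ofAdd
          ((r.2.get : ℤ) • (Multiplicative.toAdd r.1.get : L))))).comp
        ((contMDiff_fst.comp contMDiff_fst).prodMk (Theta₀.sgn_analytic.comp contMDiff_snd))
    have h2 : ContMDiff (((𝓡 0).prod (𝓡 1)).prod (𝓘(ℝ, LieAlg L).prod (𝓡 0)))
        𝓘(ℝ, LieAlg L →L[ℝ] ℝ) ω (fun q : Theta₁ L × Theta₀ L =>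
          LinearMap.toContinuousLinearMap (realExt J (latticeIncl q.1.lat))) :=
      (Theta₁.lat_analytic 𝓘(ℝ, LieAlg L →L[ℝ] ℝ)
        (fun m => LinearMap.toContinuousLinearMap (realExt J (latticeIncl m)))).comp contMDiff_fst
    have h3 := h2.clm_apply (Theta₀.pt_analytic.comp
      (contMDiff_snd (I := (𝓡 0).prod (𝓡 1)) (M := Theta₁ L)))
    have h4 := (contMDiff_const (I := ((𝓡 0).prod (𝓡 1)).prod (𝓘(ℝ, LieAlg L).prod (𝓡 0)))
      (I' := 𝓘(ℝ)) (n := ω) (c := 2 * Real.pi)).smul h3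
    exact h1.prodMk ((contMDiff_snd.comp contMDiff_fst).mul (contMDiff_circleExp.comp h4))

/-! ### The crossed module `Ξ'` -/

/-- The bilinear form `(m, n) ↦ B (f m, f n)`. -/
def pullForm (f : L ≃ₗ[ℤ] L) (B : LinearMap.BilinForm ℤ L) : LinearMap.BilinForm ℤ L :=
  B.compl₁₂ f.toLinearMap f.toLinearMap

theorem pullForm_apply (f : L ≃ₗ[ℤ] L) (B : LinearMap.BilinForm ℤ L) (m n : L) :
    pullForm f B m n = B (f m) (f n) := rfl

/-- The symmetrisation `I = J + Jᵗ`, as the map `I♯ : m ↦ I(m, -)`. -/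
def symm (J : LinearMap.BilinForm ℤ L) : LinearMap.BilinForm ℤ L := J + J.flip

theorem symm_apply (J : LinearMap.BilinForm ℤ L) (m n : L) : symm J m n = J m n + J n m := rfl

/-- The group of pairs `(f, B)` of an isometry `f` of `(L, I)` and an integral bilinear form `B`
with `B - Bᵗ = J - f^* J`, a subgroup of the semidirect product of the isometry group with the
group of bilinear forms, on which isometries act from the right by `f^*`. -/
@[ext]
structure OTilde (J : LinearMap.BilinForm ℤ L) where
  f : L ≃ₗ[ℤ] L
  B : LinearMap.BilinForm ℤ L
  isometry : ∀ m n, symm J (f m) (f n) = symm J m n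
  cond : ∀ m n, B m n - B n m = J m n - J (f m) (f n)

namespace OTilde

variable {J : LinearMap.BilinForm ℤ L}

instance : Mul (OTilde J) :=
  ⟨fun p q => ⟨p.f * q.f, pullForm q.f p.B + q.B,
    fun m n => (p.isometry _ _).trans (q.isometry m n),
    fun m n => by
      have h1 := p.cond (q.f m) (q.f n)
      have h2 := q.cond m n
      simp only [LinearMap.add_apply, pullForm_apply, LinearEquiv.mul_apply]
      linarith⟩⟩

instance : One (OTilde J) := ⟨⟨1, 0, fun _ _ => rfl, fun _ _ => by simp⟩⟩

instance : Inv (OTilde J) :=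
  ⟨fun p => ⟨p.f⁻¹, -pullForm p.f⁻¹ p.B,
    fun m n => by
      have h := p.isometry (p.f⁻¹ m) (p.f⁻¹ n)
      rw [← LinearEquiv.mul_apply, ← LinearEquiv.mul_apply, mul_inv_cancel] at h
      exact h.symm,
    fun m n => by
      have h := p.cond (p.f⁻¹ m) (p.f⁻¹ n)
      rw [← LinearEquiv.mul_apply, ← LinearEquiv.mul_apply, mul_inv_cancel] at h
      simp only [LinearMap.neg_apply, pullForm_apply]
      simp only [LinearEquiv.coe_one, id_eq] at h
      linarith⟩⟩

theorem mul_f (p q : OTilde J) : (p * q).f = p.f * q.f := rfl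
theorem mul_B (p q : OTilde J) (m n : L) :
    (p * q).B m n = p.B (q.f m) (q.f n) + q.B m n := rfl
theorem one_f : (1 : OTilde J).f = 1 := rfl
theorem one_B (m n : L) : (1 : OTilde J).B m n = 0 := rfl
theorem inv_f (p : OTilde J) : p⁻¹.f = p.f⁻¹ := rfl
theorem inv_B (p : OTilde J) (m n : L) : p⁻¹.B m n = -p.B (p.f⁻¹ m) (p.f⁻¹ n) := rfl

theorem ext' {p q : OTilde J} (h : p.f = q.f) (h' : ∀ m n, p.B m n = q.B m n) : p = q :=
  OTilde.ext h (LinearMap.ext₂ h')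

instance : Group (OTilde J) :=
  Group.ofLeftAxioms
    (fun p q r => ext' (mul_assoc _ _ _) fun m n => by
      simp only [mul_B, mul_f, LinearEquiv.mul_apply, add_assoc])
    (fun p => ext' (one_mul _) fun m n => by simp only [mul_B, one_B, zero_add])
    (fun p => ext' (inv_mul_cancel p.f) fun m n => by
      simp only [mul_B, inv_B, one_B, ← LinearEquiv.mul_apply, inv_mul_cancel]
      exact neg_add_cancel _)

theorem inv_f_apply (p : OTilde J) (m : L) : p.f (p.f⁻¹ m) = m := by
  rw [← LinearEquiv.mul_apply, mul_inv_cancel]; rfl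

theorem f_inv_apply (p : OTilde J) (m : L) : p.f⁻¹ (p.f m) = m := by
  rw [← LinearEquiv.mul_apply, inv_mul_cancel]; rfl

/-- The subgroup of even symmetric bilinear forms, that is, of the pairs `(id, B)` with `B`
symmetric and all `B(m, m)` even. -/
def even (J : LinearMap.BilinForm ℤ L) : Subgroup (OTilde J) where
  carrier := {p | p.f = 1 ∧ (∀ m n, p.B m n = p.B n m) ∧ ∀ m, Even (p.B m m)}
  one_mem' := ⟨rfl, fun _ _ => rfl, fun _ => Even.zero⟩
  mul_mem' {p q} hp hq := by
    obtain ⟨hp1, hp2, hp3⟩ := hp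
    obtain ⟨hq1, hq2, hq3⟩ := hq
    refine ⟨by rw [mul_f, hp1, hq1, one_mul], fun m n => ?_, fun m => ?_⟩
    · rw [mul_B, mul_B, hp2, hq2]
    · rw [mul_B]; exact (hp3 _).add (hq3 _)
  inv_mem' {p} hp := by
    obtain ⟨hp1, hp2, hp3⟩ := hp
    refine ⟨by rw [inv_f, hp1, inv_one], fun m n => ?_, fun m => ?_⟩
    · rw [inv_B, inv_B, hp2]
    · rw [inv_B]; exact (hp3 _).neg

instance : (even J).Normal where
  conj_mem p hp q := by
    obtain ⟨hp1, hp2, hp3⟩ := hp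
    have hB : ∀ m n, (q * p * q⁻¹).B m n = p.B (q.f⁻¹ m) (q.f⁻¹ n) := fun m n => by
      simp only [mul_B, inv_B, inv_f, hp1, LinearEquiv.coe_one, id_eq]; ring
    refine ⟨by rw [mul_f, mul_f, hp1, mul_one, ← mul_f, mul_inv_cancel]; rfl, fun m n => ?_,
      fun m => ?_⟩
    · rw [hB, hB, hp2]
    · rw [hB]; exact hp3 _

end OTilde

/-- The group `E`, the quotient of `OTilde J` by the even symmetric bilinear forms. -/
abbrev E (J : LinearMap.BilinForm ℤ L) : Type u := OTilde J ⧸ OTilde.even J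

/-- The central extension `L~` of `L` by `ℤ/2` with cocycle `Jᵗ` modulo `2`. -/
@[ext]
structure LTilde (J : LinearMap.BilinForm ℤ L) where
  n : L
  ι : ZMod 2

namespace LTilde

variable {J : LinearMap.BilinForm ℤ L}

instance : Mul (LTilde J) := ⟨fun a b => ⟨a.n + b.n, a.ι + b.ι + (J.flip a.n b.n : ℤ)⟩⟩

instance : One (LTilde J) := ⟨⟨0, 0⟩⟩

instance : Inv (LTilde J) := ⟨fun a => ⟨-a.n, -a.ι + (J.flip a.n a.n : ℤ)⟩⟩

theorem mul_n (a b : LTilde J) : (a * b).n = a.n + b.n := rfl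
theorem mul_ι (a b : LTilde J) : (a * b).ι = a.ι + b.ι + (J b.n a.n : ℤ) := rfl
theorem one_n : (1 : LTilde J).n = 0 := rfl
theorem one_ι : (1 : LTilde J).ι = 0 := rfl
theorem inv_n (a : LTilde J) : a⁻¹.n = -a.n := rfl
theorem inv_ι (a : LTilde J) : a⁻¹.ι = -a.ι + (J a.n a.n : ℤ) := rfl

instance : Group (LTilde J) :=
  Group.ofLeftAxioms
    (fun a b c => LTilde.ext (add_assoc _ _ _) (by
      simp only [mul_ι, mul_n, map_add, LinearMap.add_apply, Int.cast_add]; ring))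
    (fun a => LTilde.ext (zero_add _) (by
      simp [mul_ι, one_n, one_ι]))
    (fun a => LTilde.ext (neg_add_cancel _) (by
      simp only [mul_ι, inv_n, inv_ι, one_ι, map_neg, Int.cast_neg]; ring))

theorem two_cast : (((2 : ℤ) : ZMod 2)) = 0 := rfl

theorem two_zero : (2 : ZMod 2) = 0 := rfl

theorem even_cast {k : ℤ} (h : Even k) : (k : ZMod 2) = 0 :=
  (ZMod.intCast_zmod_eq_zero_iff_dvd k 2).2 (by exact_mod_cast h.two_dvd)

/-- The subgroup `2L` of `L~`, consisting of the elements `(2n, 0)`. -/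
def two (J : LinearMap.BilinForm ℤ L) : Subgroup (LTilde J) where
  carrier := {a | ∃ n : L, a = ⟨(2 : ℤ) • n, 0⟩}
  one_mem' := ⟨0, LTilde.ext (smul_zero _).symm rfl⟩
  mul_mem' := by
    rintro _ _ ⟨m, rfl⟩ ⟨n, rfl⟩
    refine ⟨m + n, LTilde.ext (smul_add _ _ _).symm ?_⟩
    simp [mul_ι, two_zero]
  inv_mem' := by
    rintro _ ⟨m, rfl⟩
    refine ⟨-m, LTilde.ext (smul_neg _ _).symm ?_⟩
    simp [inv_ι, two_zero]

theorem mem_two (a : LTilde J) : a ∈ two J ↔ ∃ n : L, a = ⟨(2 : ℤ) • n, 0⟩ := Iff.rfl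

instance : (two J).Normal where
  conj_mem := by
    rintro _ ⟨m, rfl⟩ a
    refine ⟨m, LTilde.ext ?_ ?_⟩
    · simp only [mul_n, inv_n]; abel
    · simp only [mul_ι, mul_n, inv_n, inv_ι, map_neg, map_add, map_smul, LinearMap.neg_apply,
        LinearMap.smul_apply, smul_eq_mul, Int.cast_neg, Int.cast_add, Int.cast_mul, two_cast]
      ring

/-- The automorphism `(n, ι) ↦ (f⁻¹ n, ι + B(f⁻¹ n, f⁻¹ n))` of `L~`. -/
def rightMul (p : OTilde J) : LTilde J →* LTilde J where
  toFun a := ⟨p.f⁻¹ a.n, a.ι + (p.B (p.f⁻¹ a.n) (p.f⁻¹ a.n) : ℤ)⟩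
  map_one' := LTilde.ext (map_zero _) (by simp [one_n, one_ι])
  map_mul' a b := by
    refine LTilde.ext (map_add _ _ _) ?_
    have h := p.cond (p.f⁻¹ a.n) (p.f⁻¹ b.n)
    rw [p.inv_f_apply, p.inv_f_apply] at h
    have h' := p.isometry (p.f⁻¹ a.n) (p.f⁻¹ b.n)
    rw [p.inv_f_apply, p.inv_f_apply, symm_apply, symm_apply] at h'
    have hk : (p.B (p.f⁻¹ a.n) (p.f⁻¹ b.n) + p.B (p.f⁻¹ b.n) (p.f⁻¹ a.n) + J b.n a.n)
        = J (p.f⁻¹ b.n) (p.f⁻¹ a.n)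
          + (2 : ℤ) * (p.B (p.f⁻¹ b.n) (p.f⁻¹ a.n) + J (p.f⁻¹ a.n) (p.f⁻¹ b.n) - J a.n b.n) := by
      linarith
    have hk2 := congrArg (Int.cast : ℤ → ZMod 2) hk
    simp only [Int.cast_add, Int.cast_mul, two_cast, zero_mul, add_zero] at hk2
    simp only [mul_ι, mul_n, map_add, LinearMap.add_apply, Int.cast_add]
    linear_combination hk2

theorem rightMul_n (p : OTilde J) (a : LTilde J) : (rightMul p a).n = p.f⁻¹ a.n := rfl
theorem rightMul_ι (p : OTilde J) (a : LTilde J) :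
    (rightMul p a).ι = a.ι + (p.B (p.f⁻¹ a.n) (p.f⁻¹ a.n) : ℤ) := rfl

/-- The induced endomorphism of `L~ / 2L`. -/
def rightMulQuot (p : OTilde J) : LTilde J ⧸ two J →* LTilde J ⧸ two J :=
  QuotientGroup.map _ _ (rightMul p) (by
    rintro _ ⟨n, rfl⟩
    refine ⟨p.f⁻¹ n, LTilde.ext (map_smul _ _ _) ?_⟩
    simp [rightMul_ι, two_zero])

theorem rightMulQuot_mk (p : OTilde J) (a : LTilde J) :
    rightMulQuot p (a : LTilde J ⧸ two J) = (rightMul p a : LTilde J) := rfl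

/-- The right action of `E` on `L~ / 2L`. -/
def rightAct (J : LinearMap.BilinForm ℤ L) : E J →* (Monoid.End (LTilde J ⧸ two J))ᵐᵒᵖ :=
  QuotientGroup.lift (OTilde.even J)
    { toFun := fun p => MulOpposite.op (rightMulQuot p)
      map_one' := by
        refine congrArg MulOpposite.op (MonoidHom.ext fun a => ?_)
        induction a using QuotientGroup.induction_on with | _ a
        rw [rightMulQuot_mk]
        refine congrArg _ (LTilde.ext rfl ?_)
        rw [rightMul_ι, OTilde.one_B, Int.cast_zero, add_zero]
      map_mul' := fun p q => by
        refine congrArg MulOpposite.op (MonoidHom.ext fun a => ?_)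
        induction a using QuotientGroup.induction_on with | _ a
        change _ = rightMulQuot q (rightMulQuot p (a : LTilde J ⧸ two J))
        rw [rightMulQuot_mk, rightMulQuot_mk, rightMulQuot_mk]
        have hn : (p * q).f⁻¹ a.n = q.f⁻¹ (p.f⁻¹ a.n) := by
          rw [OTilde.mul_f, mul_inv_rev, LinearEquiv.mul_apply]
        refine congrArg _ (LTilde.ext hn ?_)
        rw [rightMul_ι, rightMul_ι, rightMul_ι, rightMul_n, hn, OTilde.mul_B, q.inv_f_apply,
          Int.cast_add, add_assoc] }
    (fun p hp => by
      obtain ⟨hp1, -, hp3⟩ := hp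
      refine congrArg MulOpposite.op (MonoidHom.ext fun a => ?_)
      induction a using QuotientGroup.induction_on with | _ a
      rw [rightMulQuot_mk]
      refine congrArg _ (LTilde.ext ?_ ?_)
      · rw [rightMul_n, hp1, inv_one]; rfl
      · rw [rightMul_ι, even_cast (hp3 _), add_zero])

theorem rightAct_mk (p : OTilde J) (a : LTilde J) :
    (rightAct J (p : E J)).unop (a : LTilde J ⧸ two J) = (rightMul p a : LTilde J) := rfl

end LTilde

variable (L) in
/-- The torus `T = U(1) ⊗ L` (as an abstract group). -/
abbrev Tor : Type u := Additive Circle ⊗[ℤ] L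

/-- The exponential map `𝔱 = ℝ ⊗ L → U(1) ⊗ L = T`, `r ⊗ n ↦ exp (2πi r) ⊗ n`. -/
noncomputable def texp : LieAlg L →+ Tor L :=
  (LinearMap.rTensor L e.toIntLinearMap).toAddMonoidHom

/-- The action of `E` on `T`, through the action of isometries on `L`. -/
noncomputable def torAct (J : LinearMap.BilinForm ℤ L) : E J →* MulAut (Multiplicative (Tor L)) :=
  QuotientGroup.lift (OTilde.even J)
    { toFun := fun p =>
        AddEquiv.toMultiplicative (LinearEquiv.lTensor (Additive Circle) p.f).toAddEquiv
      map_one' := by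
        refine MulEquiv.ext fun t => ?_
        exact LinearMap.congr_fun (LinearMap.lTensor_id (R := ℤ) (Additive Circle) L) t
      map_mul' := fun p q => by
        refine MulEquiv.ext fun t => ?_
        exact LinearMap.lTensor_comp_apply (R := ℤ) (Additive Circle) p.f.toLinearMap
          q.f.toLinearMap t }
    (fun p hp => by
      refine MulEquiv.ext fun t => ?_
      change LinearMap.lTensor (Additive Circle) p.f.toLinearMap t = t
      rw [hp.1]
      exact LinearMap.congr_fun (LinearMap.lTensor_id (R := ℤ) (Additive Circle) L) t)

theorem texp_natural (f : L ≃ₗ[ℤ] L) (r : ℝ) (n : L) :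
    LinearMap.lTensor (Additive Circle) f.toLinearMap (texp (r • latticeIncl n))
      = texp (r • latticeIncl (f n)) := rfl

theorem texp_int (n : L) : texp (latticeIncl n) = 0 := by
  change (e 1) ⊗ₜ[ℤ] n = 0
  have h := e_int 1
  rw [Int.cast_one] at h
  rw [h, TensorProduct.zero_tmul]

/-- The group `T ⋊ E`. -/
abbrev TorE (J : LinearMap.BilinForm ℤ L) : Type u := Multiplicative (Tor L) ⋊[torAct J] E J

/-- The pair `(id, I♯(n) ⊗ I♯(n))`. -/
def sqForm (J : LinearMap.BilinForm ℤ L) (n : L) : OTilde J where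
  f := 1
  B := LinearMap.BilinForm.linMulLin (symm J n) (symm J n)
  isometry _ _ := rfl
  cond a b := by
    simp [LinearMap.BilinForm.linMulLin_apply, mul_comm]

theorem sqForm_B (J : LinearMap.BilinForm ℤ L) (n a b : L) :
    (sqForm J n).B a b = symm J n a * symm J n b := rfl

/-- The class of `sqForm J n` is the unique class in `E` of a symmetric bilinear form `B` with
`B(m, m) ≡ I(n, m)` modulo `2`. -/
theorem mk_eq_mk_sqForm (J : LinearMap.BilinForm ℤ L) (n : L) (p : OTilde J) :
    (p : E J) = (sqForm J n : E J) ↔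
      p.f = 1 ∧ (∀ a b, p.B a b = p.B b a) ∧ ∀ m, p.B m m ≡ symm J n m [ZMOD 2] := by
  have hpar : ∀ x k : ℤ, Even (-x + k * k) ↔ x ≡ k [ZMOD 2] := fun x k => by
    rw [Int.modEq_iff_dvd, even_iff_two_dvd]
    have h2 : (2 : ℤ) ∣ k * k - k := by
      have := (Int.even_mul_pred_self k).two_dvd
      rwa [mul_sub, mul_one] at this
    rw [show -x + k * k = (k - x) + (k * k - k) by ring]
    exact (Int.dvd_add_left h2)
  rw [QuotientGroup.eq]
  have hB : ∀ a b, (p⁻¹ * sqForm J n).B a b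
      = -p.B (p.f⁻¹ a) (p.f⁻¹ b) + symm J n a * symm J n b := fun _ _ => rfl
  have hf : (p⁻¹ * sqForm J n).f = p.f⁻¹ := mul_one _
  constructor
  · rintro ⟨h1, h2, h3⟩
    rw [hf, inv_eq_one] at h1
    simp only [hB, h1, inv_one, LinearEquiv.coe_one, id_eq] at h2 h3
    refine ⟨h1, fun a b => ?_, fun m => (hpar _ _).1 (h3 m)⟩
    have := h2 a b
    linarith [mul_comm (symm J n a) (symm J n b)]
  · rintro ⟨h1, h2, h3⟩
    refine ⟨by rw [hf, h1, inv_one], fun a b => ?_, fun m => ?_⟩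
    · rw [hB, hB, h2, mul_comm (symm J n a)]
    · rw [hB, h1]; exact (hpar _ _).2 (h3 m)

/-- The structure map of `Ξ'`: it sends `([n], ι)` to `(exp (n / 2), id, B)`, where `(id, B)` is
the class in `E` of the symmetric bilinear forms with `B(m, m) ≡ I(n, m)` modulo `2`. -/
noncomputable def xiHom (J : LinearMap.BilinForm ℤ L) : LTilde J ⧸ LTilde.two J →* TorE J :=
  QuotientGroup.lift (LTilde.two J)
    { toFun := fun a =>
        ⟨Multiplicative.ofAdd (texp ((1 / 2 : ℝ) • latticeIncl a.n)), (sqForm J a.n : E J)⟩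
      map_one' := by
        refine SemidirectProduct.ext ?_ ?_
        · change Multiplicative.ofAdd (texp ((1 / 2 : ℝ) • latticeIncl (0 : L))) = 1
          rw [map_zero, smul_zero, map_zero]; rfl
        · refine ((mk_eq_mk_sqForm J 0 1).2 ⟨rfl, fun _ _ => rfl, fun m => ?_⟩).symm
          rw [OTilde.one_B, map_zero]; rfl
      map_mul' := fun a b => by
        refine SemidirectProduct.ext ?_ ?_
        · change Multiplicative.ofAdd (texp ((1 / 2 : ℝ) • latticeIncl (a.n + b.n)))
            = Multiplicative.ofAdd (texp ((1 / 2 : ℝ) • latticeIncl a.n))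
              * torAct J (sqForm J a.n : E J)
                (Multiplicative.ofAdd (texp ((1 / 2 : ℝ) • latticeIncl b.n)))
          rw [map_add, smul_add, map_add, ofAdd_add]
          rfl
        · refine ((mk_eq_mk_sqForm J (a.n + b.n) (sqForm J a.n * sqForm J b.n)).2
            ⟨mul_one _, fun c d => ?_, fun m => ?_⟩).symm
          · change symm J a.n c * symm J a.n d + symm J b.n c * symm J b.n d
              = symm J a.n d * symm J a.n c + symm J b.n d * symm J b.n c
            ring
          · rw [map_add]
            exact ((mk_eq_mk_sqForm J a.n _).1 rfl).2.2 m |>.add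
              (((mk_eq_mk_sqForm J b.n _).1 rfl).2.2 m) }
    (fun a ha => by
      obtain ⟨n, rfl⟩ := ha
      refine SemidirectProduct.ext ?_ ?_
      · change Multiplicative.ofAdd (texp ((1 / 2 : ℝ) • latticeIncl ((2 : ℤ) • n))) = 1
        rw [map_zsmul, ← Int.cast_smul_eq_zsmul ℝ, smul_smul]
        norm_num
        exact texp_int n
      · refine ((mk_eq_mk_sqForm J _ 1).2 ⟨rfl, fun _ _ => rfl, fun m => ?_⟩).symm
        rw [OTilde.one_B, map_smul, LinearMap.smul_apply, smul_eq_mul]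
        exact ((Int.modEq_zero_iff_dvd).2 (dvd_mul_right _ _)).symm)

/-- The crossed module `Ξ'`. -/
noncomputable def xiPrime (J : LinearMap.BilinForm ℤ L) :
    CrossedModule (LTilde J ⧸ LTilde.two J) (TorE J) where
  bd := xiHom J
  act a g := (LTilde.rightAct J g.right).unop a
  act_one a := by
    rw [SemidirectProduct.one_right, map_one]; rfl
  act_mul a g h := by
    rw [SemidirectProduct.mul_right, map_mul]; rfl
  mul_act a b g := map_mul _ _ _
  bd_act a g := by
    obtain ⟨t, q⟩ := g
    induction a using QuotientGroup.induction_on with | _ a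
    induction q using QuotientGroup.induction_on with | _ q
    rw [mul_assoc, eq_inv_mul_iff_mul_eq]
    refine SemidirectProduct.ext ?_ ?_
    · change t * Multiplicative.ofAdd (LinearMap.lTensor (Additive Circle) q.f.toLinearMap
          (texp ((1 / 2 : ℝ) • latticeIncl (q.f⁻¹ a.n))))
        = Multiplicative.ofAdd (texp ((1 / 2 : ℝ) • latticeIncl a.n))
          * torAct J (sqForm J a.n : E J) t
      have h1 : torAct J (sqForm J a.n : E J) t = t :=
        LinearMap.congr_fun (LinearMap.lTensor_id (R := ℤ) (Additive Circle) L) t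
      rw [h1, texp_natural, q.inv_f_apply, mul_comm]
    · change ((q : E J) * (sqForm J (q.f⁻¹ a.n) : E J)) = (sqForm J a.n : E J) * (q : E J)
      rw [← mul_inv_eq_iff_eq_mul]
      refine (mk_eq_mk_sqForm J a.n (q * sqForm J (q.f⁻¹ a.n) * q⁻¹)).2 ⟨?_, ?_⟩
      · change q.f * 1 * q.f⁻¹ = 1
        rw [mul_one, mul_inv_cancel]
      · have hI : ∀ m, symm J (q.f⁻¹ a.n) (q.f⁻¹ m) = symm J a.n m := fun m => by
          rw [← q.isometry, q.inv_f_apply, q.inv_f_apply]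
        have hB : ∀ c d, (q * sqForm J (q.f⁻¹ a.n) * q⁻¹).B c d
            = symm J a.n c * symm J a.n d := fun c d => by
          rw [OTilde.mul_B, OTilde.mul_B, OTilde.inv_B, sqForm_B, OTilde.inv_f, hI, hI]
          change q.B (q.f⁻¹ c) (q.f⁻¹ d) + _ + _ = _
          ring
        refine ⟨fun c d => ?_, fun m => ?_⟩
        · rw [hB, hB, mul_comm]
        · rw [hB]
          exact ((mk_eq_mk_sqForm J a.n _).1 rfl).2.2 m
  peiffer a b := by
    induction a using QuotientGroup.induction_on with | _ a
    induction b using QuotientGroup.induction_on with | _ b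
    rw [mul_assoc, eq_inv_mul_iff_mul_eq]
    change ((a * LTilde.rightMul (sqForm J a.n) b : LTilde J) : LTilde J ⧸ LTilde.two J)
      = ((b * a : LTilde J) : LTilde J ⧸ LTilde.two J)
    refine congrArg _ (LTilde.ext ?_ ?_)
    · change a.n + b.n = b.n + a.n
      exact add_comm _ _
    · have h := ((mk_eq_mk_sqForm J a.n _).1 rfl).2.2 b.n
      have h' := (ZMod.intCast_eq_intCast_iff _ _ 2).2 h
      rw [symm_apply, Int.cast_add] at h'
      change a.ι + (b.ι + ((sqForm J a.n).B b.n b.n : ℤ)) + (J b.n a.n : ℤ)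
        = b.ι + a.ι + (J a.n b.n : ℤ)
      rw [h']
      have h2 : (2 : ZMod 2) = 0 := rfl
      linear_combination (J b.n a.n : ZMod 2) * h2

end Torus
end CatTorus

/-! Both categorical groups receive a monoidal equivalence from a third one, `S (xiCover J)`. In
`xiCover` the torus `T` is replaced by its universal cover `𝔱` and `E` by `OTilde J`, and degree one
is enlarged to compensate: it consists of `(n, ι)` in `L~` together with a chosen lift `(n/2, id,
S)` of its image, where `S` is symmetric and `S(m,m) ≡ I(n,m)` modulo 2. Inverting one leg of the
span gives the theorem.

The leg towards `Ξ'` is a strict homomorphism. The kernel on objects consists of the `(m, id, S)`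
with `m` in `L` and `S` even, and the kernel in degree one lies bijectively over it, so passing to
the quotient changes nothing up to equivalence.

The leg towards the actor sends `(a, f, B)` to the normal form `f₀(x,ε) = (fx + (1-ε)a, ε)`,
`f₁(m,z) = (fm, z exp(-2πi J(fm,a)))`, `κ = exp(2πi ε B(x,y))`, where `(x,ε)` is the first argument
of `κ` and `y` the `𝔱`-part of the second. Normal forms multiply only up to explicit circle-valued
pointed maps (`normalFormCoh`), which is why this leg is a weak homomorphism.

It is fully faithful (`exists_xiMap_eq`, `eq_of_xiMap_eq`): a pointed map `η` whose image under `δ`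
is a normal form has constant lattice part on each sheet of `𝔱 ⋊ {±1}`, namely 0 and some `-n`. On
`𝔱` its circle part refines `B` quadratically, and compatibility with the reflection forces it to be
`exp(πi (B(y,y) + J(n,y)))`; only a sign at the reflection remains free, and that sign is `ι`.

It is essentially surjective (`exists_normalForm_eq`). For a centre-preserving weak automorphism
with lattice part `f`, the commutator of `κ` on `𝔱` is a biadditive pairing into `U(1)`. The fifth
axiom computes it on lattice vectors as `J - f^*J`, and continuity extends this to `𝔱`
(`commPairing_eq`). A commutator is antisymmetric, so `f` preserves `I`, and `J - f^*J = B - Bᵗ` for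
an integral `B`. After division by the normal form of `f` and `B`, the Künneth map is a
`U(1)`-cocycle of `𝔱 ⋊ {±1}` that is symmetric on `𝔱`. Commutators with the reflection split the
corresponding central extension analytically (`exists_coboundary`). What is left is a character `L →
{±1}`, which a form `l ⊗ l` absorbs. -/

namespace CatTorus

universe u v u' v'

open scoped Manifold ContDiff TensorProduct
open CategoryTheory

/-! ### Weak homomorphisms of crossed modules -/

namespace CrossedModule

/-- A weak homomorphism between crossed modules. -/
structure WeakHom {H₁ H₀ G₁ G₀ : Type*} [Group H₁] [Group H₀] [Group G₁] [Group G₀]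
    (Ω : CrossedModule H₁ H₀) (Ψ : CrossedModule G₁ G₀) where
  p₀ : H₀ → G₀
  p₁ : H₁ → G₁
  κ : H₀ → H₀ → G₁
  p₀_one : p₀ 1 = 1
  p₁_one : p₁ 1 = 1
  w1 : ∀ α, p₀ (Ω.bd α) = Ψ.bd (p₁ α)
  w2 : ∀ x y, p₀ x * p₀ y * Ψ.bd (κ x y) = p₀ (x * y)
  w3 : ∀ α β, p₁ α * p₁ β * κ (Ω.bd α) (Ω.bd β) = p₁ (α * β)
  w4 : ∀ x y z, Ψ.act (κ x y) (p₀ z) * κ (x * y) z = κ y z * κ x (y * z)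
  w5 : ∀ α x, Ψ.act (p₁ α) (p₀ x) * κ (Ω.bd α) x = p₁ (Ω.act α x) * κ x (Ω.bd (Ω.act α x))

namespace WeakHom

variable {H₁ : Type v} {H₀ : Type u} {G₁ : Type v'} {G₀ : Type u'}
  [Group H₁] [Group H₀] [Group G₁] [Group G₀]
  {Ω : CrossedModule H₁ H₀} {Ψ : CrossedModule G₁ G₀} (F : WeakHom Ω Ψ)

/-- The effect of the associated functor on labels of arrows. -/
def hat (x : H₀) (α : H₁) : G₁ := F.p₁ α * F.κ x (Ω.bd α)

theorem κ_one_one : F.κ 1 1 = 1 := by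
  have h := F.w3 1 1
  simpa [F.p₁_one] using h

theorem κ_one_left (z : H₀) : F.κ 1 z = 1 := by
  have h := F.w4 1 1 z
  simpa [F.κ_one_one, Ψ.one_act] using h

theorem κ_one_right (x : H₀) : F.κ x 1 = 1 := by
  have h := F.w4 x 1 1
  simpa [F.κ_one_one, F.p₀_one, Ψ.act_one] using h

theorem hat_one_right (x : H₀) : F.hat x 1 = 1 := by
  simp [hat, F.p₁_one, F.κ_one_right]

theorem p₀_mul_bd (x : H₀) (α : H₁) : F.p₀ (x * Ω.bd α) = F.p₀ x * Ψ.bd (F.hat x α) := by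
  rw [← F.w2, F.w1, hat, map_mul, mul_assoc]

/-- This is functoriality. It comes from w4 at `(x, bd α, bd β)`, where the Peiffer identity turns
the action of `p₀ (bd β) = bd (p₁ β)` into conjugation. -/
theorem hat_mul (x : H₀) (α β : H₁) :
    F.hat x (α * β) = F.hat x α * F.hat (x * Ω.bd α) β := by
  have h4 := F.w4 x (Ω.bd α) (Ω.bd β)
  rw [F.w1, Ψ.peiffer] at h4
  simp only [hat, ← F.w3, map_mul]
  rw [mul_assoc, ← h4]
  group

/-- Naturality of `κ` in its second variable, again from w4 with `bd α` as last argument. -/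
theorem κ_hat_left (z x : H₀) (α : H₁) :
    F.κ z x * F.hat (z * x) α = F.hat x α * F.κ z (x * Ω.bd α) := by
  have h4 := F.w4 z x (Ω.bd α)
  rw [F.w1, Ψ.peiffer] at h4
  simp only [hat]
  rw [mul_assoc (F.p₁ α), ← h4]
  group

/-- Naturality of `κ` in its first variable. As `bd α * z = z * bd (α ^ z)`, it reduces to the
second variable, and w5 makes the exchange. -/
theorem κ_hat_right (x z : H₀) (α : H₁) :
    F.κ x z * F.hat (x * z) (Ω.act α z)
      = Ψ.act (F.hat x α) (F.p₀ z) * F.κ (x * Ω.bd α) z := by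
  have h : z * Ω.bd (Ω.act α z) = Ω.bd α * z := by rw [Ω.bd_act]; group
  rw [F.κ_hat_left, h]
  simp only [hat, Ψ.mul_act]
  rw [mul_assoc (Ψ.act (F.p₁ α) (F.p₀ z)), F.w4, ← mul_assoc, F.w5]

/-- The functor of groupoids associated with a weak homomorphism. -/
def toFunctor : S Ω ⥤ S Ψ where
  obj x := ⟨F.p₀ x.of⟩
  map {x _} a := ⟨F.hat x.of (S.Hom.label a), by rw [← F.p₀_mul_bd, S.Hom.tgt a]⟩
  map_id x := S.hom_ext _ _ (F.hat_one_right x.of)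
  map_comp {x y _} a b := S.hom_ext _ _ (by
    change F.hat x.of (S.Hom.label a * S.Hom.label b)
      = F.hat x.of (S.Hom.label a) * F.hat y.of (S.Hom.label b)
    rw [F.hat_mul, S.Hom.tgt a])

/-- The arrow of `S Ψ` with a given label. -/
def arrowIso (x y : S Ψ) (α : G₁) (h : x.of * Ψ.bd α = y.of) : x ≅ y :=
  letI f : x ⟶ y := ⟨α, h⟩
  ⟨f, Groupoid.inv f, Groupoid.comp_inv f, Groupoid.inv_comp f⟩

/-- The monoidal structure of the functor associated with a weak homomorphism. -/
def coreMonoidal : F.toFunctor.CoreMonoidal where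
  εIso := S.idIso _ _ F.p₀_one.symm
  μIso x y := arrowIso _ _ (F.κ x.of y.of) (F.w2 x.of y.of)
  μIso_hom_natural_left {x y} a z := S.hom_ext _ _ (by
    change Ψ.act (F.hat x.of (S.Hom.label a)) (F.p₀ z.of) * F.κ y.of z.of
      = F.κ x.of z.of * F.hat (x.of * z.of) (Ω.act (S.Hom.label a) z.of)
    rw [F.κ_hat_right, S.Hom.tgt a])
  μIso_hom_natural_right {x y} z a := S.hom_ext _ _ (by
    change F.hat x.of (S.Hom.label a) * F.κ z.of y.of
      = F.κ z.of x.of * F.hat (z.of * x.of) (S.Hom.label a)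
    rw [F.κ_hat_left, S.Hom.tgt a])
  associativity x y z := S.hom_ext _ _ (by
    change Ψ.act (F.κ x.of y.of) (F.p₀ z.of) * (F.κ (x.of * y.of) z.of * F.hat _ 1)
      = 1 * (F.κ y.of z.of * F.κ x.of (y.of * z.of))
    rw [F.hat_one_right, mul_one, one_mul, F.w4])
  left_unitality x := S.hom_ext _ _ (by
    change 1 = Ψ.act 1 (F.p₀ x.of) * (F.κ 1 x.of * F.hat _ 1)
    rw [F.hat_one_right, F.κ_one_left, Ψ.one_act, mul_one, mul_one])
  right_unitality x := S.hom_ext _ _ (by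
    change 1 = 1 * (F.κ x.of 1 * F.hat _ 1)
    rw [F.hat_one_right, F.κ_one_right, mul_one, mul_one])

/-- A weak homomorphism that is bijective on fibres of the structure maps and surjective up to
the image of the structure map induces an equivalence. -/
theorem toFunctor_isEquivalence
    (hinj : ∀ α β, Ω.bd α = Ω.bd β → F.p₁ α = F.p₁ β → α = β)
    (hsurj : ∀ x η, Ψ.bd η = F.p₀ x → ∃ α, Ω.bd α = x ∧ F.p₁ α = η)
    (hess : ∀ y, ∃ x η, F.p₀ x * Ψ.bd η = y) : F.toFunctor.IsEquivalence where
  faithful := ⟨fun {x y} a b hab => S.hom_ext _ _ (by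
    have hl : F.hat x.of (S.Hom.label a) = F.hat x.of (S.Hom.label b) :=
      congrArg S.Hom.label hab
    have hb : Ω.bd (S.Hom.label a) = Ω.bd (S.Hom.label b) :=
      mul_left_cancel ((S.Hom.tgt a).trans (S.Hom.tgt b).symm)
    refine hinj _ _ hb ?_
    rw [hat, hat, hb] at hl
    exact mul_right_cancel hl)⟩
  full := ⟨fun {x y} b => by
    have hb : F.p₀ x.of * Ψ.bd (S.Hom.label b) = F.p₀ y.of := S.Hom.tgt b
    -- A preimage of `b` must lie over `x⁻¹ y`. By w2 the label of `b` times `κ⁻¹` lies over `p₀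
    -- (x⁻¹ y)`, so surjectivity on that fibre supplies it.
    have h2 := F.w2 x.of (x.of⁻¹ * y.of)
    rw [mul_inv_cancel_left, ← hb, mul_assoc] at h2
    obtain ⟨α, h, h'⟩ := hsurj (x.of⁻¹ * y.of)
      (S.Hom.label b * (F.κ x.of (x.of⁻¹ * y.of))⁻¹)
      (by rw [map_mul, map_inv, ← mul_left_cancel h2, mul_inv_cancel_right])
    refine ⟨⟨α, by rw [h, mul_inv_cancel_left]⟩, S.hom_ext _ _ ?_⟩
    change F.p₁ α * F.κ x.of (Ω.bd α) = _
    rw [h, h', inv_mul_cancel_right]⟩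
  essSurj := ⟨fun y => by
    obtain ⟨x, η, h⟩ := hess y.of
    exact ⟨⟨x⟩, ⟨arrowIso _ _ η h⟩⟩⟩

end WeakHom

/-- Equivalences of categorical groups out of a common source give an equivalence of their
targets. -/
theorem equivalentCatGroups_of_span {B C D : Type*} [Category B] [MonoidalCategory B]
    [Category C] [MonoidalCategory C] [Category D] [MonoidalCategory D]
    (F : B ⥤ C) (G : B ⥤ D) (hF : F.CoreMonoidal) (hG : G.CoreMonoidal)
    (hF' : F.IsEquivalence) (hG' : G.IsEquivalence) : EquivalentCatGroups C D := by
  let _ := hF.toMonoidal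
  let _ := hG.toMonoidal
  let _ : F.asEquivalence.functor.Monoidal := hF.toMonoidal
  -- A quasi-inverse of a monoidal equivalence is again monoidal, so the span can be traversed
  -- backwards along `F`.
  let _ := F.asEquivalence.inverseMonoidal
  exact ⟨F.asEquivalence.inverse ⋙ G, ⟨inferInstance⟩, inferInstance⟩

end CrossedModule

/-! ### Real extensions of lattice data -/

section RealExtension

variable {L : Type u} [AddCommGroup L]

theorem LieAlg.induction_on {P : LieAlg L → Prop} (h0 : ∀ (r : ℝ) (n : L), P (r • latticeIncl n))
    (hadd : ∀ x y, P x → P y → P (x + y)) (x : LieAlg L) : P x := by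
  have hP : ∀ (r : ℝ) (n : L), P (r ⊗ₜ[ℤ] n : ℝ ⊗[ℤ] L) := fun r n => by
    have h : r • latticeIncl n = (r ⊗ₜ[ℤ] n : ℝ ⊗[ℤ] L) := by
      change r • ((1 : ℝ) ⊗ₜ[ℤ] n : ℝ ⊗[ℤ] L) = _
      rw [TensorProduct.smul_tmul', smul_eq_mul, mul_one]
    exact h ▸ h0 r n
  exact TensorProduct.induction_on (motive := P) x
    (by simpa [TensorProduct.zero_tmul] using! hP 0 0) hP hadd

/-- `L` spans `𝔱` over `ℝ`, so identities between real extensions reduce to their integral versions.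
-/
theorem LieAlg.bilin_ext {A B : LieAlg L →ₗ[ℝ] LieAlg L →ₗ[ℝ] ℝ}
    (h : ∀ m n, A (latticeIncl m) (latticeIncl n) = B (latticeIncl m) (latticeIncl n)) :
    A = B := by
  refine LinearMap.ext fun x => LinearMap.ext fun y => ?_
  induction x using LieAlg.induction_on with
  | h0 r m =>
    rw [map_smul, map_smul, LinearMap.smul_apply, LinearMap.smul_apply]
    congr 1
    induction y using LieAlg.induction_on with
    | h0 s n => rw [map_smul, map_smul, h]
    | hadd y y' hy hy' => rw [map_add, map_add, hy, hy']
  | hadd x x' hx hx' =>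
    rw [map_add, map_add, LinearMap.add_apply, LinearMap.add_apply, hx, hx']

/-- The real extension of a lattice automorphism. -/
noncomputable def extMap (f : L ≃ₗ[ℤ] L) : LieAlg L →ₗ[ℝ] LieAlg L :=
  LinearMap.baseChange ℝ f.toLinearMap

@[simp]
theorem extMap_latticeIncl (f : L ≃ₗ[ℤ] L) (m : L) :
    extMap f (latticeIncl m) = latticeIncl (f m) := rfl

theorem LieAlg.linear_ext {M : Type*} [AddCommGroup M] [Module ℝ M] {A B : LieAlg L →ₗ[ℝ] M}
    (h : ∀ m, A (latticeIncl m) = B (latticeIncl m)) : A = B := by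
  refine LinearMap.ext fun x => ?_
  induction x using LieAlg.induction_on with
  | h0 r m => rw [map_smul, map_smul, h]
  | hadd x x' hx hx' => rw [map_add, map_add, hx, hx']

@[simp]
theorem extMap_mul_apply (f g : L ≃ₗ[ℤ] L) (x : LieAlg L) :
    extMap (f * g) x = extMap f (extMap g x) :=
  LinearMap.congr_fun (f := extMap (f * g)) (g := extMap f ∘ₗ extMap g)
    (LieAlg.linear_ext fun _ => rfl) x

@[simp]
theorem extMap_one_apply (x : LieAlg L) : extMap (1 : L ≃ₗ[ℤ] L) x = x :=
  LinearMap.congr_fun (f := extMap 1) (g := LinearMap.id) (LieAlg.linear_ext fun _ => rfl) x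

theorem realExt_comm {B : LinearMap.BilinForm ℤ L} (h : ∀ m n, B m n = B n m) (x y : LieAlg L) :
    realExt B x y = realExt B y x :=
  LinearMap.congr_fun (LinearMap.congr_fun (LieAlg.bilin_ext (A := realExt B)
    (B := (realExt B).flip) fun m n => by
      rw [LinearMap.flip_apply, realExt_latticeIncl, realExt_latticeIncl, h]) x) y

@[simp]
theorem realExt_add (B C : LinearMap.BilinForm ℤ L) (x y : LieAlg L) :
    realExt (B + C) x y = realExt B x y + realExt C x y :=
  LinearMap.congr_fun (LinearMap.congr_fun (LieAlg.bilin_ext (A := realExt (B + C))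
    (B := realExt B + realExt C) fun m n => by
      simp only [LinearMap.add_apply, realExt_latticeIncl, Int.cast_add]) x) y

@[simp]
theorem realExt_zero (x y : LieAlg L) :
    realExt (0 : LinearMap.BilinForm ℤ L) x y = 0 :=
  LinearMap.congr_fun (LinearMap.congr_fun (LieAlg.bilin_ext
    (A := realExt (0 : LinearMap.BilinForm ℤ L)) (B := 0) fun m n => by
      simp [realExt_latticeIncl]) x) y

@[simp]
theorem realExt_pullForm (f : L ≃ₗ[ℤ] L) (B : LinearMap.BilinForm ℤ L) (x y : LieAlg L) :
    realExt (pullForm f B) x y = realExt B (extMap f x) (extMap f y) :=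
  LinearMap.congr_fun (LinearMap.congr_fun (LieAlg.bilin_ext (A := realExt (pullForm f B))
    (B := (realExt B).compl₁₂ (extMap f) (extMap f)) fun m n => by
      simp only [LinearMap.compl₁₂_apply, extMap_latticeIncl, realExt_latticeIncl,
        pullForm_apply]) x) y

variable {J : LinearMap.BilinForm ℤ L}

theorem OTilde.realExt_cond (p : OTilde J) (x y : LieAlg L) :
    realExt p.B x y - realExt p.B y x
      = realExt J x y - realExt J (extMap p.f x) (extMap p.f y) :=
  LinearMap.congr_fun (LinearMap.congr_fun (LieAlg.bilin_ext
    (A := realExt p.B - (realExt p.B).flip)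
    (B := realExt J - (realExt J).compl₁₂ (extMap p.f) (extMap p.f)) fun m n => by
      simp only [LinearMap.sub_apply, LinearMap.flip_apply, LinearMap.compl₁₂_apply,
        extMap_latticeIncl, realExt_latticeIncl]
      exact_mod_cast p.cond m n) x) y

@[simp]
theorem OTilde.realExt_mul_B (p q : OTilde J) (x y : LieAlg L) :
    realExt (p * q).B x y = realExt p.B (extMap q.f x) (extMap q.f y) + realExt q.B x y := by
  change realExt (pullForm q.f p.B + q.B) x y = _
  rw [realExt_add, realExt_pullForm]

/-- A free module is flat, so `ℤ → ℝ` stays injective after tensoring with `L`. -/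
theorem latticeIncl_injective [Module.Free ℤ L] :
    Function.Injective (latticeIncl : L → LieAlg L) := by
  have h := Module.Flat.rTensor_preserves_injective_linearMap (M := L)
    (Algebra.linearMap ℤ ℝ) (by exact Int.cast_injective)
  have h2 := h.comp (TensorProduct.lid ℤ L).symm.injective
  have h3 : (latticeIncl : L → LieAlg L)
      = (LinearMap.rTensor L (Algebra.linearMap ℤ ℝ)) ∘ (TensorProduct.lid ℤ L).symm := by
    funext m
    simp [latticeIncl]
    rfl
  rw [h3]
  exact h2

end RealExtension

/-! ### The exponential map with values in the circle -/

/-- The map `r ↦ exp (2πi r)` with values in the circle. -/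
noncomputable def cexp (r : ℝ) : Circle := Additive.toMul (e r)

theorem cexp_add (r s : ℝ) : cexp (r + s) = cexp r * cexp s := by
  rw [cexp, map_add]; rfl

theorem cexp_sub (r s : ℝ) : cexp (r - s) = cexp r / cexp s := by
  rw [cexp, map_sub]; rfl

@[simp]
theorem cexp_zero : cexp 0 = 1 := by rw [cexp, map_zero]; rfl

theorem cexp_neg (r : ℝ) : cexp (-r) = (cexp r)⁻¹ := by
  rw [cexp, map_neg]; rfl

@[simp]
theorem cexp_int (k : ℤ) : cexp k = 1 := by rw [cexp, e_int]; rfl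

theorem cexp_eq_circleExp (r : ℝ) : cexp r = Circle.exp (2 * Real.pi * r) := rfl

theorem cexp_surjective (z : Circle) : ∃ r, cexp r = z := by
  refine ⟨Complex.arg z / (2 * Real.pi), ?_⟩
  rw [cexp_eq_circleExp, mul_div_cancel₀ _ (by positivity), Circle.exp_arg]

theorem cexp_eq_one_iff (r : ℝ) : cexp r = 1 ↔ ∃ k : ℤ, r = k := by
  rw [cexp_eq_circleExp, Circle.exp_eq_one]
  refine exists_congr fun k => ?_
  rw [mul_comm, mul_left_inj' (by positivity)]

theorem cexp_eq_iff (r s : ℝ) : cexp r = cexp s ↔ ∃ k : ℤ, r - s = k := by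
  rw [← cexp_eq_one_iff, cexp_sub, div_eq_one]

theorem cexp_continuous : Continuous cexp :=
  Circle.exp.continuous.comp (continuous_const.mul continuous_id)

/-- A real number is determined by the values of `cexp` on its real multiples. -/
theorem eq_of_cexp_mul {a b : ℝ} (h : ∀ t : ℝ, cexp (t * a) = cexp (t * b)) : a = b := by
  by_contra hab
  have hab' : a - b ≠ 0 := sub_ne_zero.mpr hab
  -- At this `t` the two phases would differ by half a turn.
  obtain ⟨k, hk⟩ := (cexp_eq_iff _ _).1 (h (1 / (2 * (a - b))))
  have h2 : (1 : ℝ) / (2 * (a - b)) * a - 1 / (2 * (a - b)) * b = 1 / 2 := by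
    field_simp
  rw [h2] at hk
  have : (1 : ℤ) = 2 * k := by
    have : (1 : ℝ) = 2 * k := by linarith
    exact_mod_cast this
  omega

section Analytic

variable {E H M : Type*} [NormedAddCommGroup E] [NormedSpace ℝ E] [TopologicalSpace H]
  {I : ModelWithCorners ℝ E H} [TopologicalSpace M] [ChartedSpace H M]

theorem cexp_analytic {f : M → ℝ} (hf : ContMDiff I 𝓘(ℝ) ω f) :
    ContMDiff I (𝓡 1) ω (fun x => cexp (f x)) :=
  contMDiff_circleExp.comp ((contMDiff_const (I := I) (I' := 𝓘(ℝ)) (c := 2 * Real.pi)).smul hf)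

variable {L : Type u} [AddCommGroup L] [Module.Finite ℤ L]

theorem realExt_analytic (B : LinearMap.BilinForm ℤ L) {f g : M → LieAlg L}
    (hf : ContMDiff I 𝓘(ℝ, LieAlg L) ω f) (hg : ContMDiff I 𝓘(ℝ, LieAlg L) ω g) :
    ContMDiff I 𝓘(ℝ) ω (fun x => realExt B (f x) (g x)) :=
  (((realExt B).toContinuousBilinearMap.contMDiff).comp hf).clm_apply hg

theorem linear_analytic {E' : Type*} [NormedAddCommGroup E'] [NormedSpace ℝ E']
    (A : LieAlg L →ₗ[ℝ] E') {f : M → LieAlg L}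
    (hf : ContMDiff I 𝓘(ℝ, LieAlg L) ω f) : ContMDiff I 𝓘(ℝ, E') ω (fun x => A (f x)) :=
  (LinearMap.toContinuousLinearMap A).contMDiff.comp hf

end Analytic

/-! ### Normal forms of weak automorphisms of `Θ'` -/

section NormalForm

variable {L : Type u} [AddCommGroup L]

namespace Theta₀

/-- The sign as a real number. -/
def rsgn (X : Theta₀ L) : ℝ := ((X.sgn : ℤ) : ℝ)

@[simp] theorem mk_pt (x : LieAlg L) (ε : ℤˣ) : (mk x ε).pt = x := rfl
@[simp] theorem mk_sgn (x : LieAlg L) (ε : ℤˣ) : (mk x ε).sgn = ε := rfl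
@[simp] theorem rsgn_mk_one (x : LieAlg L) : (mk x 1).rsgn = 1 := by simp [rsgn]
@[simp] theorem rsgn_mk_neg_one (x : LieAlg L) : (mk x (-1)).rsgn = -1 := by simp [rsgn]
@[simp] theorem rsgn_mk_sgn (x : LieAlg L) (X : Theta₀ L) : (mk x X.sgn).rsgn = X.rsgn := rfl
@[simp] theorem rsgn_mul (X Y : Theta₀ L) : (X * Y).rsgn = X.rsgn * Y.rsgn := by
  simp [rsgn, mul_sgn]
@[simp] theorem rsgn_one : (1 : Theta₀ L).rsgn = 1 := by simp [rsgn, one_sgn]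
theorem rsgn_sq (X : Theta₀ L) : X.rsgn * X.rsgn = 1 := by
  rw [rsgn, ← Int.cast_mul, ← Units.val_mul, Int.units_mul_self]; simp
theorem mul_pt_real (X Y : Theta₀ L) : (X * Y).pt = X.pt + X.rsgn • Y.pt := by
  rw [mul_pt, rsgn, Int.cast_smul_eq_zsmul]
theorem mk_eta (X : Theta₀ L) : mk X.pt X.sgn = X := rfl

theorem latticeIncl_sgn_smul (X : Theta₀ L) (m : L) :
    latticeIncl ((X.sgn : ℤ) • m) = X.rsgn • latticeIncl m := by
  rw [map_zsmul, rsgn, Int.cast_smul_eq_zsmul]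

variable [Module.Finite ℤ L]

theorem disc_analytic {E H M : Type*} [NormedAddCommGroup E] [NormedSpace ℝ E]
    [TopologicalSpace H] (I : ModelWithCorners ℝ E H) [TopologicalSpace M] [ChartedSpace H M]
    (f : ℤˣ → M) :
    ContMDiff (𝓘(ℝ, LieAlg L).prod (𝓡 0)) I ω (fun X : Theta₀ L => f X.sgn) :=
  (contMDiff_of_discreteTopology (I := 𝓡 0) (M := Disc ℤˣ)
    (f := fun ε : Disc ℤˣ => f ε.get)).comp sgn_analytic

theorem mk_analytic {E H M : Type*} [NormedAddCommGroup E] [NormedSpace ℝ E]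
    [TopologicalSpace H] {I : ModelWithCorners ℝ E H} [TopologicalSpace M] [ChartedSpace H M]
    {f : M → LieAlg L} {s : M → ℤˣ} (hf : ContMDiff I 𝓘(ℝ, LieAlg L) ω f)
    (hs : ContMDiff I (𝓡 0) ω (fun x => Disc.mk (s x))) :
    ContMDiff I (𝓘(ℝ, LieAlg L).prod (𝓡 0)) ω (fun x => mk (f x) (s x)) :=
  hf.prodMk hs

end Theta₀

namespace Theta₁

set_option linter.unusedSectionVars false

@[simp] theorem mk_lat' (m : L) (z : Circle) : (mk m z).lat = m := rfl
@[simp] theorem mk_snd' (m : L) (z : Circle) : (mk m z).2 = z := rfl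
@[simp] theorem mul_lat' (α β : Theta₁ L) : (α * β).lat = α.lat + β.lat := rfl
@[simp] theorem one_lat' : (1 : Theta₁ L).lat = 0 := rfl
@[simp] theorem inv_lat' (α : Theta₁ L) : (α⁻¹).lat = -α.lat := rfl
theorem mk_mul_mk (m n : L) (z w : Circle) : mk m z * mk n w = mk (m + n) (z * w) := rfl
theorem mk_eta (α : Theta₁ L) : mk α.lat α.2 = α := rfl

end Theta₁

/-- The semidirect product of `𝔱` and the group `OTilde J`. -/
@[ext]
structure TOTilde (J : LinearMap.BilinForm ℤ L) where
  x : LieAlg L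
  q : OTilde J

namespace TOTilde

variable {J : LinearMap.BilinForm ℤ L}

noncomputable instance : Mul (TOTilde J) := ⟨fun a b => ⟨a.x + extMap a.q.f b.x, a.q * b.q⟩⟩
noncomputable instance : One (TOTilde J) := ⟨⟨0, 1⟩⟩
noncomputable instance : Inv (TOTilde J) := ⟨fun a => ⟨-extMap a.q.f⁻¹ a.x, a.q⁻¹⟩⟩

@[simp] theorem mul_x (a b : TOTilde J) : (a * b).x = a.x + extMap a.q.f b.x := rfl
@[simp] theorem mul_q (a b : TOTilde J) : (a * b).q = a.q * b.q := rfl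
@[simp] theorem one_x : (1 : TOTilde J).x = 0 := rfl
@[simp] theorem one_q : (1 : TOTilde J).q = 1 := rfl
@[simp] theorem inv_x (a : TOTilde J) : a⁻¹.x = -extMap a.q.f⁻¹ a.x := rfl
@[simp] theorem inv_q (a : TOTilde J) : a⁻¹.q = a.q⁻¹ := rfl

noncomputable instance : Group (TOTilde J) :=
  Group.ofLeftAxioms
    (fun a b c => TOTilde.ext (by simp [OTilde.mul_f, add_assoc]) (mul_assoc _ _ _))
    (fun a => TOTilde.ext (by simp [OTilde.one_f]) (one_mul _))
    (fun a => TOTilde.ext (by simp [OTilde.inv_f]) (inv_mul_cancel _))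

end TOTilde

variable [Module.Finite ℤ L] (J : LinearMap.BilinForm ℤ L)

theorem thetaPrime_act (α : Theta₁ L) (X : Theta₀ L) : (thetaPrime J).act α X
    = Theta₁.mk ((X.sgn : ℤ) • α.lat) (α.2 * cexp (realExt J (latticeIncl α.lat) X.pt)) := rfl

theorem thetaPrime_bd (α : Theta₁ L) :
    (thetaPrime J).bd α = Theta₀.mk (latticeIncl α.lat) 1 := rfl

open LieCrossedModule

variable {J}

/-- The weak automorphism of `Θ'` that belongs to an element of `𝔱 ⋊ OTilde J`. -/
noncomputable def normalForm (a : TOTilde J) : WeakEnd (thetaPrime J) where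
  p₀ X := Theta₀.mk (extMap a.q.f X.pt + (1 - X.rsgn) • a.x) X.sgn
  p₁ α := Theta₁.mk (a.q.f α.lat) (α.2 * cexp (-realExt J (latticeIncl (a.q.f α.lat)) a.x))
  κ X Y := Theta₁.mk 0 (cexp (X.rsgn * realExt a.q.B X.pt Y.pt))
  p₀_one := Theta₀.ext (by simp [Theta₀.one_pt]) rfl
  p₁_one := Theta₁.ext (by simp) (by simp)
  w1 α := Theta₀.ext (by simp [thetaPrime_bd]) rfl
  w2 X Y := Theta₀.ext
    (by simp [thetaPrime_bd, Theta₀.mul_pt_real]; module)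
    (by simp [thetaPrime_bd, Theta₀.mul_sgn])
  w3 α β := by
    -- `B` is integral on `L`, so `κ` is trivial there and w3 is mere additivity.
    refine Theta₁.ext (by simp) ?_
    simp only [thetaPrime_bd, Theta₁.mk_mul_mk, Theta₁.mk_snd', Theta₀.rsgn_mk_one, one_mul,
      Theta₀.mk_pt, realExt_latticeIncl, cexp_int, mul_one, Theta₁.mul_lat', map_add,
      LinearMap.add_apply, Prod.snd_mul, neg_add, cexp_add]
    exact mul_mul_mul_comm _ _ _ _
  w4 X Y Z := by
    refine Theta₁.ext (by simp [thetaPrime_act]) ?_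
    simp only [thetaPrime_act, Theta₁.mk_mul_mk, Theta₁.mk_snd', Theta₁.mk_lat', map_zero,
      LinearMap.zero_apply, cexp_zero, mul_one, ← cexp_add, Theta₀.mul_pt_real, Theta₀.rsgn_mul,
      map_add, map_smul, LinearMap.add_apply, LinearMap.smul_apply, smul_eq_mul]
    congr 1
    linear_combination Y.rsgn * realExt a.q.B Y.pt Z.pt * X.rsgn_sq
  w5 α X := by
    refine Theta₁.ext (by simp [thetaPrime_act]) ?_
    -- w5 compares `κ` for the two orders of a lattice vector and a point, so it is where `B - Bᵗ =
    -- J - f^*J` is needed.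
    have h := a.q.realExt_cond (latticeIncl α.lat) X.pt
    rw [extMap_latticeIncl] at h
    have hf := map_zsmul a.q.f (X.sgn : ℤ) α.lat
    simp only [thetaPrime_act, thetaPrime_bd, Theta₁.mk_mul_mk, Theta₁.mk_snd', Theta₁.mk_lat',
      hf, Theta₀.latticeIncl_sgn_smul, Theta₀.mk_pt, Theta₀.rsgn_mk_one, one_mul,
      map_add, map_smul, LinearMap.smul_apply, smul_eq_mul, mul_assoc, ← cexp_add]
    congr 2
    linear_combination h - realExt a.q.B X.pt (latticeIncl α.lat) * X.rsgn_sq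
  p₀_analytic := Theta₀.mk_analytic
    ((linear_analytic _ Theta₀.pt_analytic).add
      ((contMDiff_const.sub Theta₀.sgn_real_analytic).smul contMDiff_const))
    Theta₀.sgn_analytic
  p₁_analytic := by
    refine ContMDiff.prodMk (Theta₁.lat_analytic (𝓡 0) fun m =>
      Disc.mk (Multiplicative.ofAdd (a.q.f m))) (contMDiff_snd.mul ?_)
    exact Theta₁.lat_analytic (𝓡 1) fun m => cexp (-realExt J (latticeIncl (a.q.f m)) a.x)
  κ_analytic := contMDiff_const.prodMk (cexp_analytic
    ((Theta₀.sgn_real_analytic.comp contMDiff_fst).mul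
      (realExt_analytic _ (Theta₀.pt_analytic.comp contMDiff_fst)
        (Theta₀.pt_analytic.comp contMDiff_snd))))

theorem LieCrossedModule.WeakEnd.ext_theta {F G : WeakEnd (thetaPrime J)}
    (h0 : ∀ X, (F.p₀ X).pt = (G.p₀ X).pt)
    (h0' : ∀ X, (F.p₀ X).sgn = (G.p₀ X).sgn) (h1 : ∀ α, (F.p₁ α).lat = (G.p₁ α).lat)
    (h1' : ∀ α, (F.p₁ α).2 = (G.p₁ α).2) (hκ : ∀ X Y, (F.κ X Y).lat = (G.κ X Y).lat)
    (hκ' : ∀ X Y, (F.κ X Y).2 = (G.κ X Y).2) : F = G :=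
  WeakEnd.ext (funext fun X => Theta₀.ext (h0 X) (h0' X))
    (funext fun α => Theta₁.ext (h1 α) (h1' α))
    (funext fun X => funext fun Y => Theta₁.ext (hκ X Y) (hκ' X Y))

theorem LieCrossedModule.PointedMap.ext_theta {η χ : PointedMap (thetaPrime J)}
    (h : ∀ X, (η.fn X).lat = (χ.fn X).lat) (h' : ∀ X, (η.fn X).2 = (χ.fn X).2) : η = χ :=
  PointedMap.ext (funext fun X => Theta₁.ext (h X) (h' X))

/-- The invertible pointed map given by a pointed analytic map to the circle. -/
noncomputable def circleMap (J : LinearMap.BilinForm ℤ L) (h : Theta₀ L → Circle) (h1 : h 1 = 1)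
    (ha : ContMDiff (𝓘(ℝ, LieAlg L).prod (𝓡 0)) (𝓡 1) ω h) : (PointedMap (thetaPrime J))ˣ where
  val := ⟨fun X => Theta₁.mk 0 (h X), by rw [h1]; rfl, contMDiff_const.prodMk ha⟩
  inv := ⟨fun X => Theta₁.mk 0 (h X)⁻¹, by rw [h1, inv_one]; rfl, contMDiff_const.prodMk ha.inv⟩
  val_inv := PointedMap.ext_theta
    (fun X => by simp [PointedMap.mul_fn, PointedMap.one_fn])
    (fun X => by
      have hX : X * Theta₀.mk 0 1 = X := mul_one X
      simp [PointedMap.mul_fn, PointedMap.one_fn, thetaPrime_bd, hX])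
  inv_val := PointedMap.ext_theta
    (fun X => by simp [PointedMap.mul_fn, PointedMap.one_fn])
    (fun X => by
      have hX : X * Theta₀.mk 0 1 = X := mul_one X
      simp [PointedMap.mul_fn, PointedMap.one_fn, thetaPrime_bd, hX])

section circleMap

variable (h : Theta₀ L → Circle) (h1 : h 1 = 1)
    (ha : ContMDiff (𝓘(ℝ, LieAlg L).prod (𝓡 0)) (𝓡 1) ω h)

@[simp]
theorem circleMap_fn (X : Theta₀ L) :
    (circleMap J h h1 ha : PointedMap (thetaPrime J)).fn X = Theta₁.mk 0 (h X) := rfl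

theorem thetaPrime_bd_circle (z : Circle) : (thetaPrime J).bd (Theta₁.mk 0 z) = 1 :=
  Theta₀.ext (by simp [thetaPrime_bd, Theta₀.one_pt]) rfl

theorem mul_circleMap_fn (η : PointedMap (thetaPrime J)) (X : Theta₀ L) :
    (η * (circleMap J h h1 ha : PointedMap (thetaPrime J))).fn X
      = Theta₁.mk 0 (h X) * η.fn X := by
  rw [PointedMap.mul_fn, circleMap_fn, thetaPrime_bd_circle, mul_one]

theorem delta_circleMap_p₀ (X : Theta₀ L) :
    (PointedMap.delta (circleMap J h h1 ha : PointedMap (thetaPrime J))).p₀ X = X := by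
  change X * (thetaPrime J).bd (Theta₁.mk 0 (h X)) = X
  rw [thetaPrime_bd_circle, mul_one]

theorem delta_circleMap_p₁ (α : Theta₁ L) :
    (PointedMap.delta (circleMap J h h1 ha : PointedMap (thetaPrime J))).p₁ α
      = Theta₁.mk α.lat (α.2 * h ((thetaPrime J).bd α)) :=
  Theta₁.ext (add_zero _) rfl

/-- The elements `(0, z)` are fixed by the action, so `δ` changes `κ` by an ordinary group
coboundary with values in `U(1)`. -/
theorem delta_circleMap_κ (X Y : Theta₀ L) :
    (PointedMap.delta (circleMap J h h1 ha : PointedMap (thetaPrime J))).κ X Y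
      = Theta₁.mk 0 ((h Y)⁻¹ * (h X)⁻¹ * h (X * Y)) := by
  refine Theta₁.ext ?_ ?_
  · simp [PointedMap.delta, thetaPrime_act]
  · simp [PointedMap.delta, thetaPrime_act]

end circleMap

theorem LieCrossedModule.WeakEnd.hat_circle (F : WeakEnd (thetaPrime J)) (X : Theta₀ L) (z : Circle) :
    F.hat X (Theta₁.mk 0 z) = F.p₁ (Theta₁.mk 0 z) := by
  rw [WeakEnd.hat, thetaPrime_bd_circle, F.κ_one_right, mul_one]

section

variable (a : TOTilde J)

@[simp] theorem normalForm_p₀_pt (X : Theta₀ L) :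
    ((normalForm a).p₀ X).pt = extMap a.q.f X.pt + (1 - X.rsgn) • a.x := rfl
@[simp] theorem normalForm_p₀_sgn (X : Theta₀ L) : ((normalForm a).p₀ X).sgn = X.sgn := rfl
@[simp] theorem normalForm_p₀_rsgn (X : Theta₀ L) : ((normalForm a).p₀ X).rsgn = X.rsgn := rfl
@[simp] theorem normalForm_p₁_lat (α : Theta₁ L) :
    ((normalForm a).p₁ α).lat = a.q.f α.lat := rfl
@[simp] theorem normalForm_p₁_snd (α : Theta₁ L) : ((normalForm a).p₁ α).2
    = α.2 * cexp (-realExt J (latticeIncl (a.q.f α.lat)) a.x) := rfl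
theorem normalForm_p₁_circle (z : Circle) :
    (normalForm a).p₁ (Theta₁.mk 0 z) = Theta₁.mk 0 z :=
  Theta₁.ext (by simp) (by simp)
@[simp] theorem normalForm_κ_lat (X Y : Theta₀ L) : ((normalForm a).κ X Y).lat = 0 := rfl
@[simp] theorem normalForm_κ_snd (X Y : Theta₀ L) :
    ((normalForm a).κ X Y).2 = cexp (X.rsgn * realExt a.q.B X.pt Y.pt) := rfl
theorem normalForm_κ (X Y : Theta₀ L) :
    (normalForm a).κ X Y = Theta₁.mk 0 (cexp (X.rsgn * realExt a.q.B X.pt Y.pt)) := rfl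

end

theorem normalForm_one : normalForm (1 : TOTilde J) = 1 :=
  WeakEnd.ext_theta (fun X => by simp [OTilde.one_f, WeakEnd.one_p₀])
    (fun _ => rfl) (fun _ => rfl) (fun α => by simp [WeakEnd.one_p₁])
    (fun _ _ => rfl) (fun X Y => by
      have h : realExt (1 : OTilde J).B X.pt Y.pt = 0 := realExt_zero _ _
      rw [normalForm_κ_snd, TOTilde.one_q, h, mul_zero, cexp_zero]; rfl)

/-- The coherence between `normalForm a * normalForm b` and `normalForm (a * b)`. -/
noncomputable def normalFormCoh (a b : TOTilde J) : (PointedMap (thetaPrime J))ˣ :=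
  -- The coboundary of this exponent cancels the terms of `κ` of `normalForm a`, evaluated at points
  -- moved by `normalForm b`, that contain the translation `b.x`. At a lattice point it equals `B -
  -- Bᵗ` and so also corrects the character in `p₁`.
  circleMap J (fun V => cexp (V.rsgn * realExt a.q.B (extMap b.q.f V.pt) b.x
    - (1 - V.rsgn) * realExt a.q.B b.x b.x - realExt a.q.B b.x (extMap b.q.f V.pt)))
    (by simp [Theta₀.one_pt])
    (cexp_analytic (by
      have hf := linear_analytic (extMap b.q.f) (Theta₀.pt_analytic (L := L))
      exact ((Theta₀.sgn_real_analytic.mul (realExt_analytic _ hf contMDiff_const)).sub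
        ((contMDiff_const.sub Theta₀.sgn_real_analytic).mul contMDiff_const)).sub
        (realExt_analytic _ contMDiff_const hf)))

/-- On objects the two sides already agree without the correction. In `p₁` the discrepancy is `J -
f^*J` paired with `b.x`, hence `B - Bᵗ` by the condition defining `OTilde`. In `κ` it is a
coboundary, because `ε² = 1`. -/
theorem normalForm_mul (a b : TOTilde J) :
    normalForm a * normalForm b
      * PointedMap.delta (normalFormCoh a b : PointedMap (thetaPrime J))
      = normalForm (a * b) := by
  have hκ : ∀ X Y, (normalForm a * normalForm b
      * PointedMap.delta (normalFormCoh a b : PointedMap (thetaPrime J))).κ X Y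
      = Theta₁.mk 0 (((normalForm a).κ ((normalForm b).p₀ X) ((normalForm b).p₀ Y)).2
        * ((normalForm b).κ X Y).2
        * ((PointedMap.delta (normalFormCoh a b : PointedMap (thetaPrime J))).κ X Y).2) :=
    fun X Y => by
      rw [WeakEnd.mul_κ, WeakEnd.mul_κ, normalFormCoh, delta_circleMap_κ, delta_circleMap_p₀,
        delta_circleMap_p₀, WeakEnd.hat_circle, normalForm_κ b, WeakEnd.hat_circle,
        WeakEnd.mul_p₁]
      simp only [normalForm_p₁_circle, normalForm_κ]
      refine Theta₁.ext (by simp) (by simp)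
  refine WeakEnd.ext_theta (fun X => ?_) (fun _ => ?_) (fun α => ?_) (fun α => ?_)
    (fun X Y => ?_) (fun X Y => ?_)
  · rw [WeakEnd.mul_p₀, WeakEnd.mul_p₀, normalFormCoh, delta_circleMap_p₀]
    simp [OTilde.mul_f]; module
  · rw [WeakEnd.mul_p₀, WeakEnd.mul_p₀, normalFormCoh, delta_circleMap_p₀]
    simp
  · rw [WeakEnd.mul_p₁, WeakEnd.mul_p₁, normalFormCoh, delta_circleMap_p₁]
    simp [OTilde.mul_f]
  · have h := a.q.realExt_cond (latticeIncl (b.q.f α.lat)) b.x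
    rw [extMap_latticeIncl] at h
    rw [WeakEnd.mul_p₁, WeakEnd.mul_p₁, normalFormCoh, delta_circleMap_p₁]
    simp only [normalForm_p₁_snd, normalForm_p₁_lat, Theta₁.mk_lat', Theta₁.mk_snd',
      thetaPrime_bd, Theta₀.rsgn_mk_one, Theta₀.mk_pt, extMap_latticeIncl, mul_assoc, ← cexp_add,
      TOTilde.mul_x, TOTilde.mul_q, OTilde.mul_f, LinearEquiv.mul_apply, map_add]
    congr 2
    linear_combination h
  · rw [hκ]; simp
  · rw [hκ, normalFormCoh, delta_circleMap_κ]
    simp only [normalForm_κ_snd, normalForm_p₀_rsgn, normalForm_p₀_pt, Theta₁.mk_snd',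
      ← cexp_add, ← cexp_neg, Theta₀.rsgn_mul, Theta₀.mul_pt_real, map_add, map_smul,
      LinearMap.add_apply, LinearMap.smul_apply, smul_eq_mul, TOTilde.mul_q,
      OTilde.realExt_mul_B]
    congr 1
    have h := X.rsgn_sq
    linear_combination (-realExt a.q.B b.x (extMap b.q.f Y.pt) + Y.rsgn * realExt a.q.B b.x b.x
      + Y.rsgn * realExt a.q.B (extMap b.q.f Y.pt) b.x - realExt a.q.B b.x b.x) * h

end NormalForm

/-! ### The weak homomorphism from the covering crossed module -/

section XiCover

/-- The identity at `(x, x⁻¹)` gives a right inverse of `a x` and a left inverse of `a x⁻¹`. The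
identity at `x⁻¹` gives a right inverse of `a x⁻¹`, so the one-sided inverses match. Thus normal
forms and `xiMap` are invertible without a formula for their inverses. -/
theorem isUnit_of_mul_unit {M G : Type*} [Monoid M] [Group G] (a : G → M) (u : G → G → Mˣ)
    (h : ∀ x y, a x * a y * u x y = a (x * y)) (h1 : a 1 = 1) (x : G) : IsUnit (a x) := by
  have hr : ∀ x, a x * (a x⁻¹ * u x x⁻¹) = 1 := fun x => by
    rw [← mul_assoc, h, mul_inv_cancel, h1]
  have hl : a x * (a x⁻¹ * u x x⁻¹) = 1 := hr x
  have hl' : ↑(u x x⁻¹) * a x * a x⁻¹ = 1 := by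
    have h2 : a x * a x⁻¹ = ↑(u x x⁻¹)⁻¹ := by
      rw [← Units.mul_eq_one_iff_eq_inv, mul_assoc, hr]
    rw [mul_assoc, h2, Units.mul_inv]
  have h3 : a x⁻¹ * (↑(u x x⁻¹) * a x) = 1 := by
    have h4 := hr x⁻¹
    rw [left_inv_eq_right_inv hl' h4]
    exact h4
  refine ⟨⟨a x, a x⁻¹ * u x x⁻¹, hl, ?_⟩, rfl⟩
  rw [mul_assoc, h3]

variable {L : Type u} [AddCommGroup L] {J : LinearMap.BilinForm ℤ L}

/-- The group of pairs of an element `(n, ι)` of `L~` and an element `(n / 2, id, S)` of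
`𝔱 ⋊ OTilde J` with `S` symmetric and `S(m, m) ≡ I(n, m)` modulo `2`. -/
def xiCoverGroup (J : LinearMap.BilinForm ℤ L) : Subgroup (LTilde J × TOTilde J) where
  carrier := {p | p.2.x = (1 / 2 : ℝ) • latticeIncl p.1.n ∧ p.2.q.f = 1 ∧
    (∀ a b, p.2.q.B a b = p.2.q.B b a) ∧ ∀ m, p.2.q.B m m ≡ symm J p.1.n m [ZMOD 2]}
  one_mem' := ⟨by simp [LTilde.one_n], rfl, fun _ _ => rfl, fun m => by
    simp [LTilde.one_n, OTilde.one_B]⟩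
  mul_mem' {p q} hp hq := by
    obtain ⟨hp1, hp2, hp3, hp4⟩ := hp
    obtain ⟨hq1, hq2, hq3, hq4⟩ := hq
    refine ⟨by simp [hp1, hp2, hq1, LTilde.mul_n], by simp [OTilde.mul_f, hp2, hq2],
      fun a b => ?_, fun m => ?_⟩
    · simp only [Prod.snd_mul, TOTilde.mul_q, OTilde.mul_B]
      rw [hp3, hq3]
    · simp only [Prod.snd_mul, TOTilde.mul_q, OTilde.mul_B, hq2, LinearEquiv.coe_one, id_eq,
        Prod.fst_mul, LTilde.mul_n, map_add, LinearMap.add_apply]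
      exact (hp4 m).add (hq4 m)
  inv_mem' {p} hp := by
    obtain ⟨hp1, hp2, hp3, hp4⟩ := hp
    refine ⟨by simp [hp1, hp2, LTilde.inv_n], by simp [OTilde.inv_f, hp2],
      fun a b => ?_, fun m => ?_⟩
    · simp only [Prod.snd_inv, TOTilde.inv_q, OTilde.inv_B]
      rw [hp3]
    · simp only [Prod.snd_inv, TOTilde.inv_q, OTilde.inv_B, hp2, inv_one, LinearEquiv.coe_one,
        id_eq, Prod.fst_inv, LTilde.inv_n, map_neg, LinearMap.neg_apply]
      exact (hp4 m).neg

theorem LTilde.rightMul_mul (p q : OTilde J) (a : LTilde J) :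
    rightMul (p * q) a = rightMul q (rightMul p a) := by
  have hn : (p * q).f⁻¹ a.n = q.f⁻¹ (p.f⁻¹ a.n) := by
    rw [OTilde.mul_f, mul_inv_rev, LinearEquiv.mul_apply]
  refine LTilde.ext hn ?_
  rw [rightMul_ι, rightMul_ι, rightMul_ι, rightMul_n, hn, OTilde.mul_B, q.inv_f_apply,
    Int.cast_add, add_assoc]

theorem LTilde.rightMul_one (a : LTilde J) : rightMul (1 : OTilde J) a = a :=
  LTilde.ext rfl (by rw [rightMul_ι, OTilde.one_B, Int.cast_zero, add_zero])

/-- The crossed module with structure map `xiCoverGroup J → 𝔱 ⋊ OTilde J`. -/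
noncomputable def xiCover (J : LinearMap.BilinForm ℤ L) :
    CrossedModule (xiCoverGroup J) (TOTilde J) where
  bd := (MonoidHom.snd _ _).comp (xiCoverGroup J).subtype
  act a g := ⟨(LTilde.rightMul g.q a.1.1, g⁻¹ * a.1.2 * g), by
    obtain ⟨⟨⟨n, ι⟩, ⟨x, q⟩⟩, h1, h2, h3, h4⟩ := a
    obtain ⟨y, p⟩ := g
    dsimp only at h1 h2 h3 h4
    have hB : ∀ c d, (p⁻¹ * q * p).B c d = q.B (p.f c) (p.f d) := fun c d => by
      rw [OTilde.mul_B, OTilde.mul_B, OTilde.inv_B, h2, LinearEquiv.coe_one, id_eq, id_eq,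
        OTilde.f_inv_apply, OTilde.f_inv_apply]
      ring
    refine ⟨?_, ?_, fun c d => ?_, fun m => ?_⟩
    · simp only [TOTilde.mul_x, TOTilde.mul_q, TOTilde.inv_x, TOTilde.inv_q, OTilde.mul_f,
        OTilde.inv_f, h1, h2, mul_one, LTilde.rightMul_n, map_smul, extMap_latticeIncl]
      abel
    · simp [OTilde.mul_f, OTilde.inv_f, h2]
    · exact (hB c d).trans ((h3 _ _).trans (hB d c).symm)
    · change (p⁻¹ * q * p).B m m ≡ symm J (p.f⁻¹ n) m [ZMOD 2]
      rw [hB, ← p.isometry, p.inv_f_apply]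
      exact h4 _⟩
  act_one a := Subtype.ext (Prod.ext (LTilde.rightMul_one _) (by simp))
  act_mul a g h := Subtype.ext (Prod.ext (LTilde.rightMul_mul _ _ _) (by simp [mul_assoc]))
  mul_act a b g := Subtype.ext (Prod.ext (map_mul _ _ _) (by simp [mul_assoc]))
  bd_act a g := rfl
  peiffer a b := by
    refine Subtype.ext (Prod.ext ?_ rfl)
    obtain ⟨⟨⟨n, ι⟩, ⟨x, q⟩⟩, h1, h2, h3, h4⟩ := a
    obtain ⟨⟨⟨n', ι'⟩, ⟨x', q'⟩⟩, -⟩ := b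
    dsimp only at h1 h2 h3 h4
    change LTilde.rightMul q ⟨n', ι'⟩ = (⟨n, ι⟩ : LTilde J)⁻¹ * ⟨n', ι'⟩ * ⟨n, ι⟩
    rw [mul_assoc, eq_inv_mul_iff_mul_eq]
    refine LTilde.ext ?_ ?_
    · simp only [LTilde.mul_n, LTilde.rightMul_n, h2, inv_one, LinearEquiv.coe_one, id_eq]
      exact add_comm _ _
    -- The commutator in `L~` of elements over `n` and `n'` is `I(n, n')` modulo 2, which the
    -- congruence identifies with the shift `S(n', n')` of `ι`.
    · have h' := (ZMod.intCast_eq_intCast_iff _ _ 2).2 (h4 n')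
      rw [symm_apply, Int.cast_add] at h'
      simp only [LTilde.mul_ι, LTilde.rightMul_n, LTilde.rightMul_ι, h2, inv_one,
        LinearEquiv.coe_one, id_eq, h']
      linear_combination (J n' n : ZMod 2) * LTilde.two_zero

/-! ### The equivalence between the cover and `Ξ'` -/

section ToXi

theorem xiCover_bd (a : xiCoverGroup J) : (xiCover J).bd a = a.1.2 := rfl

theorem texp_extMap (f : L ≃ₗ[ℤ] L) (x : LieAlg L) :
    LinearMap.lTensor (Additive Circle) f.toLinearMap (texp x) = texp (extMap f x) := by
  induction x using LieAlg.induction_on with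
  | h0 r m => rw [texp_natural, (extMap f).map_smul, extMap_latticeIncl]
  | hadd x y hx hy => rw [map_add, map_add, map_add, map_add, hx, hy]

/-- The strict homomorphism from `xiCover J` to `Ξ'`. -/
noncomputable def xiCoverToXi (J : LinearMap.BilinForm ℤ L) :
    (xiCover J).WeakHom (xiPrime J) where
  p₀ g := ⟨Multiplicative.ofAdd (texp g.x), (g.q : E J)⟩
  p₁ a := (a.1.1 : LTilde J ⧸ LTilde.two J)
  κ _ _ := 1
  p₀_one := SemidirectProduct.ext (by simp) rfl
  p₁_one := rfl
  w1 a := by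
    obtain ⟨⟨⟨n, ι⟩, ⟨x, q⟩⟩, h1, h2, h3, h4⟩ := a
    dsimp only at h1 h2 h3 h4
    refine SemidirectProduct.ext ?_ ?_
    · change Multiplicative.ofAdd (texp x)
        = Multiplicative.ofAdd (texp ((1 / 2 : ℝ) • latticeIncl n))
      rw [h1]
    · exact (mk_eq_mk_sqForm J n q).2 ⟨h2, h3, h4⟩
  w2 x y := by
    rw [map_one, mul_one]
    refine SemidirectProduct.ext ?_ rfl
    change Multiplicative.ofAdd (texp x.x) * Multiplicative.ofAdd
      (LinearMap.lTensor (Additive Circle) x.q.f.toLinearMap (texp y.x)) = _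
    rw [texp_extMap, ← ofAdd_add, ← map_add]
    rfl
  w3 a b := mul_one _
  w4 x y z := by rw [(xiPrime J).one_act]
  w5 a x := by rw [mul_one, mul_one]; rfl

theorem texp_surjective : Function.Surjective (texp : LieAlg L → Tor L) :=
  LinearMap.rTensor_surjective L (g := e.toIntLinearMap) fun z => cexp_surjective z.toMul

/-- Tensoring is right exact: apply `- ⊗ L` to `ℤ → ℝ → U(1)`. -/
theorem texp_eq_zero_iff (x : LieAlg L) : texp x = 0 ↔ ∃ n, x = latticeIncl n := by
  have hex : Function.Exact (Algebra.linearMap ℤ ℝ) e.toIntLinearMap := fun r =>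
    (cexp_eq_one_iff r).trans (exists_congr fun k => eq_comm)
  have h := rTensor_exact L hex fun z => cexp_surjective z.toMul
  refine (h x).trans ⟨?_, ?_⟩
  · rintro ⟨y, rfl⟩
    obtain ⟨n, rfl⟩ := (TensorProduct.lid ℤ L).symm.surjective y
    exact ⟨n, by simp [latticeIncl]; rfl⟩
  · rintro ⟨n, rfl⟩
    exact ⟨(1 : ℤ) ⊗ₜ[ℤ] n, by simp [latticeIncl]; rfl⟩

/-- The map is surjective on objects. The elements of degree one that become trivial are `(2m, 0)`
with a lift `(m, id, S)`, and the congruence modulo 2 then says that `S` is even; these lifts are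
exactly the objects that become trivial. -/
theorem xiCoverToXi_isEquivalence [Module.Free ℤ L] :
    (xiCoverToXi J).toFunctor.IsEquivalence := by
  refine CrossedModule.WeakHom.toFunctor_isEquivalence _ (fun a b hab h => ?_) (fun g c h => ?_)
    (fun g => ?_)
  · have h' : a.1.2 = b.1.2 := hab
    have hn : a.1.1.n = b.1.1.n := by
      have h2 := a.2.1.symm.trans ((congrArg TOTilde.x h').trans b.2.1)
      exact latticeIncl_injective (smul_right_injective _ (by norm_num) h2)
    obtain ⟨m, hm⟩ := (LTilde.mem_two _).1 (QuotientGroup.eq.1 h)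
    have hm' : (2 : ℤ) • m = 0 := by
      have := congrArg LTilde.n hm
      simp only [LTilde.mul_n, LTilde.inv_n, hn, neg_add_cancel] at this
      exact this.symm
    have h1 : a.1.1⁻¹ * b.1.1 = 1 := by
      rw [hm, hm']; rfl
    exact Subtype.ext (Prod.ext (inv_mul_eq_one.1 h1) h')
  · induction c using QuotientGroup.induction_on with | _ c
    have hl : Multiplicative.ofAdd (texp ((1 / 2 : ℝ) • latticeIncl c.n))
      = Multiplicative.ofAdd (texp g.x) := congrArg SemidirectProduct.left h
    have hr : (g.q : E J) = (sqForm J c.n : E J) := (congrArg SemidirectProduct.right h).symm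
    have hl' : texp (g.x - (1 / 2 : ℝ) • latticeIncl c.n) = 0 := by
      rw [map_sub, sub_eq_zero]
      exact (Multiplicative.ofAdd.injective hl).symm
    obtain ⟨m, hm⟩ := (texp_eq_zero_iff _).1 hl'
    obtain ⟨h1, h2, h3⟩ := (mk_eq_mk_sqForm J c.n g.q).1 hr
    -- The class of `c` fixes `n` only modulo `2L`. The equation `g.x = n/2 + m` selects the
    -- representative `n + 2m`.
    refine ⟨⟨(c * ⟨(2 : ℤ) • m, 0⟩, g), ?_, h1, h2, fun k => ?_⟩, rfl, ?_⟩
    · change g.x = (1 / 2 : ℝ) • latticeIncl (c.n + (2 : ℤ) • m)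
      rw [map_add, smul_add, map_zsmul, ← Int.cast_smul_eq_zsmul ℝ, smul_smul, ← sub_eq_iff_eq_add',
        hm]
      norm_num
    · change g.q.B k k ≡ symm J (c.n + (2 : ℤ) • m) k [ZMOD 2]
      rw [map_add, map_smul, LinearMap.add_apply, LinearMap.smul_apply, smul_eq_mul]
      refine (h3 k).trans (Int.modEq_iff_dvd.2 ⟨symm J m k, by ring⟩)
    · exact QuotientGroup.mk_mul_of_mem _ ⟨m, rfl⟩
  · obtain ⟨t, p⟩ := g
    induction p using QuotientGroup.induction_on with | _ p
    obtain ⟨x, hx⟩ := texp_surjective (Multiplicative.toAdd t)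
    refine ⟨⟨x, p⟩, 1, ?_⟩
    rw [map_one, mul_one]
    exact SemidirectProduct.ext (congrArg Multiplicative.ofAdd hx) rfl

end ToXi

end XiCover

/-! ### Quadratic pointed maps and the weak homomorphism to the actor -/

section XiMap

open LieCrossedModule

/-- The homomorphism `ZMod 2 → U(1)`, `k ↦ exp (πi k)`. -/
noncomputable def halfExp : ZMod 2 →+ Additive Circle :=
  ZMod.lift 2 ⟨(e.comp (AddMonoidHom.mulRight (1 / 2 : ℝ))).comp (Int.castAddHom ℝ), by
    change e (((2 : ℕ) : ℤ) * (1 / 2 : ℝ)) = 0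
    rw [show (((2 : ℕ) : ℤ) * (1 / 2 : ℝ)) = ((1 : ℤ) : ℝ) by norm_num, e_int]⟩

/-- The sign `exp (πi k)` in `U(1)`. -/
noncomputable def csign (k : ZMod 2) : Circle := Additive.toMul (halfExp k)

theorem csign_add (k l : ZMod 2) : csign (k + l) = csign k * csign l := by
  rw [csign, map_add]; rfl

theorem csign_intCast (k : ℤ) : csign k = cexp (k / 2) := by
  have h : halfExp (k : ZMod 2) = e (k * (1 / 2 : ℝ)) := ZMod.lift_coe 2 _ k
  rw [csign, h, mul_one_div]; rfl

theorem csign_zero : csign 0 = 1 := by rw [csign, map_zero]; rfl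

theorem csign_mul_self (k : ZMod 2) : csign k * csign k = 1 := by
  rw [← csign_add, CharTwo.add_self_eq_zero, csign_zero]

theorem csign_one : csign 1 = cexp (1 / 2) := by
  have h := csign_intCast 1
  rwa [Int.cast_one, Int.cast_one] at h

theorem csign_injective : Function.Injective csign := by
  have h : csign 1 ≠ 1 := fun h => by
    rw [csign_one, cexp_eq_one_iff] at h
    obtain ⟨k, hk⟩ := h
    have : (1 : ℝ) = 2 * k := by linarith
    have : (1 : ℤ) = 2 * k := by exact_mod_cast this
    omega
  intro a b hab
  fin_cases a <;> fin_cases b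
  · rfl
  · exact absurd (hab.symm.trans csign_zero) h
  · exact absurd (hab.trans csign_zero) h
  · rfl

theorem exists_csign_of_mul_self {z : Circle} (h : z * z = 1) : ∃ k : ℤ, z = csign k := by
  obtain ⟨r, rfl⟩ := cexp_surjective z
  rw [← cexp_add, cexp_eq_one_iff] at h
  obtain ⟨k, hk⟩ := h
  exact ⟨k, by rw [csign_intCast, ← hk]; congr 1; ring⟩

variable {L : Type u} [AddCommGroup L]

theorem Theta₀.cases {P : Theta₀ L → Prop} (h : ∀ y, P (Theta₀.mk y 1))
    (h' : ∀ y, P (Theta₀.mk y (-1))) (X : Theta₀ L) : P X := by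
  rcases Int.units_eq_one_or X.sgn with hX | hX
  · rw [← X.mk_eta, hX]; exact h _
  · rw [← X.mk_eta, hX]; exact h' _

theorem Theta₀.mk_one_mul (y z : LieAlg L) (δ : ℤˣ) : mk y 1 * mk z δ = mk (y + z) δ :=
  Theta₀.ext (by simp [mul_pt_real]) (one_mul δ)

theorem Theta₀.mk_neg_one_mul (y z : LieAlg L) (δ : ℤˣ) :
    mk y (-1) * mk z δ = mk (y - z) (-δ) :=
  Theta₀.ext (by simp [mul_pt_real, sub_eq_add_neg]) (neg_one_mul δ)

variable [Module.Finite ℤ L] {J : LinearMap.BilinForm ℤ L}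

/-- The pointed map `(y, ε) ↦ exp (2πi (S(y, y) + J(n, y)) / 2)` for `ε = 1`, and the product of
this with `(-n, k)` for `ε = -1`. -/
noncomputable def quadMap (S : LinearMap.BilinForm ℤ L) (n : L) (k : Circle) :
    PointedMap (thetaPrime J) where
  fn X := Theta₁.mk (if X.sgn = 1 then 0 else -n)
    (cexp (1 / 2 * realExt S X.pt X.pt + 1 / 2 * realExt J (latticeIncl n) X.pt)
      * if X.sgn = 1 then 1 else k)
  map_one := Theta₁.ext (by simp [Theta₀.one_sgn]) (by simp [Theta₀.one_sgn, Theta₀.one_pt])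
  analytic := ContMDiff.prodMk
    (Theta₀.disc_analytic (𝓡 0) fun ε => Disc.mk (Multiplicative.ofAdd (if ε = 1 then 0 else -n)))
    ((cexp_analytic
      ((contMDiff_const.mul (realExt_analytic _ Theta₀.pt_analytic Theta₀.pt_analytic)).add
        (contMDiff_const.mul (realExt_analytic _ contMDiff_const Theta₀.pt_analytic)))).mul
      (Theta₀.disc_analytic (𝓡 1) fun ε => if ε = 1 then 1 else k))

theorem quadMap_pos (S : LinearMap.BilinForm ℤ L) (n : L) (k : Circle) (y : LieAlg L) :
    (quadMap (J := J) S n k).fn (Theta₀.mk y 1) = Theta₁.mk 0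
      (cexp (1 / 2 * realExt S y y + 1 / 2 * realExt J (latticeIncl n) y)) := by
  simp [quadMap]

theorem quadMap_neg (S : LinearMap.BilinForm ℤ L) (n : L) (k : Circle) (y : LieAlg L) :
    (quadMap (J := J) S n k).fn (Theta₀.mk y (-1)) = Theta₁.mk (-n)
      (cexp (1 / 2 * realExt S y y + 1 / 2 * realExt J (latticeIncl n) y) * k) := by
  simp [quadMap]

/-- The pointed map that belongs to an element of `xiCoverGroup J`. -/
noncomputable def xiMap (a : xiCoverGroup J) : PointedMap (thetaPrime J) :=
  -- The shift by `J(n,n)` replaces the cocycle `Jᵗ` of `L~` by `J` modulo 2. Composition at `ε =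
  -- -1` evaluates the left factor at a point translated by `n'` and so produces exactly the sign
  -- `exp(πi J(n,n'))`.
  quadMap a.1.2.q.B a.1.1.n (csign (a.1.1.ι + (J a.1.1.n a.1.1.n : ℤ)))

theorem xiMap_mul (a b : xiCoverGroup J) :
    xiMap a * xiMap b * (normalFormCoh a.1.2 b.1.2 : PointedMap (thetaPrime J))
      = xiMap (a * b) := by
  obtain ⟨h1, h2, h3, h4⟩ := a.2
  obtain ⟨h1', h2', h3', h4'⟩ := b.2
  simp only [xiMap, Subgroup.coe_mul, Prod.fst_mul, Prod.snd_mul, LTilde.mul_n, LTilde.mul_ι,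
    TOTilde.mul_q]
  generalize a.1.2 = g at *
  generalize b.1.2 = g' at *
  generalize a.1.1.n = n at *
  generalize b.1.1.n = n' at *
  generalize a.1.1.ι = ι
  generalize b.1.1.ι = ι'
  have hk : csign (ι + ι' + (J n' n : ℤ) + (J (n + n') (n + n') : ℤ))
      = csign (ι' + (J n' n' : ℤ)) * csign (ι + (J n n : ℤ))
        * cexp (1 / 2 * realExt J (latticeIncl n) (latticeIncl n')) := by
    rw [realExt_latticeIncl, one_div_mul_eq_div, ← csign_intCast, ← csign_add, ← csign_add]
    congr 1
    simp only [map_add, LinearMap.add_apply, Int.cast_add]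
    linear_combination (J n' n : ZMod 2) * LTilde.two_zero
  rw [hk]
  refine PointedMap.ext (funext fun X => ?_)
  rw [normalFormCoh, mul_circleMap_fn, PointedMap.mul_fn]
  induction X using Theta₀.cases with
  | h y =>
    rw [quadMap_pos, thetaPrime_bd_circle, mul_one, quadMap_pos, quadMap_pos, Theta₁.mk_mul_mk,
      Theta₁.mk_mul_mk, add_zero, add_zero, ← cexp_add, ← cexp_add]
    congr 2
    simp only [h1', h2', Theta₀.rsgn_mk_one, Theta₀.mk_pt, extMap_one_apply,
      OTilde.realExt_mul_B, map_add, LinearMap.add_apply, map_smul, LinearMap.smul_apply,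
      smul_eq_mul, realExt_comm h3 y (latticeIncl n')]
    ring
  | h' y =>
    rw [quadMap_neg, thetaPrime_bd, Theta₀.mk_neg_one_mul, quadMap_neg, quadMap_neg,
      Theta₁.mk_mul_mk, Theta₁.mk_mul_mk]
    refine Theta₁.ext (by simp [add_comm]) ?_
    have hac : ∀ a b c d e k l : Circle, a * b * c = d * e →
        a * (b * l * (c * k)) = d * (l * k * e) := fun a b c d e k l h => by
      calc a * (b * l * (c * k)) = a * b * c * (l * k) := by ac_rfl
        _ = d * (l * k * e) := by rw [h]; ac_rfl
    refine hac _ _ _ _ _ _ _ ?_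
    rw [← cexp_add, ← cexp_add, ← cexp_add]
    congr 1
    simp only [h1', h2', Theta₀.rsgn_mk_neg_one, Theta₀.mk_pt, extMap_one_apply,
      OTilde.realExt_mul_B, map_add, LinearMap.add_apply, map_smul, LinearMap.smul_apply,
      smul_eq_mul, realExt_comm h3 y (latticeIncl n'), Theta₁.mk_lat', map_neg, sub_neg_eq_add]
    ring

/-- The polarisation of `½ S(y,y)` is `S`, which gives `κ`, while the term linear in `y` is absorbed
by the action and by the reflection. The lattice part `-n` at `ε = -1` translates by `n = 2x`. On
lattice points the congruence `S(m,m) ≡ I(n,m)` reduces the half-integral phase to that of `p₁`. -/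
theorem delta_xiMap (a : xiCoverGroup J) : PointedMap.delta (xiMap a) = normalForm a.1.2 := by
  obtain ⟨⟨⟨n, ι⟩, ⟨x, q⟩⟩, h1, h2, h3, h4⟩ := a
  dsimp only at h1 h2 h3 h4
  change PointedMap.delta (quadMap q.B n (csign (ι + (J n n : ℤ)))) = normalForm ⟨x, q⟩
  have hk := csign_mul_self (ι + (J n n : ℤ))
  generalize csign (ι + (J n n : ℤ)) = k at hk
  have hp : ∀ X, (PointedMap.delta (quadMap (J := J) q.B n k)).p₀ X
      = (normalForm ⟨x, q⟩).p₀ X := fun X => by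
    change X * (thetaPrime J).bd _ = Theta₀.mk (extMap q.f X.pt + (1 - X.rsgn) • x) X.sgn
    induction X using Theta₀.cases with
    | h y => simp [quadMap_pos, thetaPrime_bd, h2, Theta₀.mk_one_mul]
    | h' y =>
      rw [quadMap_neg, thetaPrime_bd, Theta₀.mk_neg_one_mul, h1]
      simp only [h2, Theta₁.mk_lat', map_neg, Theta₀.rsgn_mk_neg_one, Theta₀.mk_pt,
        extMap_one_apply, Theta₀.mk_sgn]
      congr 1
      module
  have hκ : ∀ X Y, (PointedMap.delta (quadMap (J := J) q.B n k)).κ X Y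
      = (normalForm ⟨x, q⟩).κ X Y := fun X Y => by
    change ((quadMap q.B n k).fn Y)⁻¹ * ((thetaPrime J).act ((quadMap q.B n k).fn X) Y)⁻¹
      * (quadMap q.B n k).fn (X * Y) = Theta₁.mk 0 (cexp (X.rsgn * realExt q.B X.pt Y.pt))
    rw [mul_assoc, inv_mul_eq_iff_eq_mul, inv_mul_eq_iff_eq_mul]
    have hS := realExt_comm h3
    induction X using Theta₀.cases with
    | h y =>
      induction Y using Theta₀.cases with
      | h z =>
        rw [Theta₀.mk_one_mul, quadMap_pos, quadMap_pos, quadMap_pos, thetaPrime_act]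
        refine Theta₁.ext (by simp) ?_
        simp only [Theta₁.mk_mul_mk, Theta₁.mk_snd', Theta₁.mk_lat', ← cexp_add, map_add,
          LinearMap.add_apply, map_zero, LinearMap.zero_apply, Theta₀.mk_pt,
          Theta₀.rsgn_mk_one, hS y z]
        congr 1; ring
      | h' z =>
        rw [Theta₀.mk_one_mul, quadMap_pos, quadMap_neg, quadMap_neg, thetaPrime_act]
        refine Theta₁.ext (by simp) ?_
        simp only [Theta₁.mk_mul_mk, Theta₁.mk_snd', Theta₁.mk_lat', mul_right_comm _ k,
          ← mul_assoc, ← cexp_add, map_add, LinearMap.add_apply, map_zero, LinearMap.zero_apply,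
          Theta₀.mk_pt, Theta₀.rsgn_mk_one, hS y z]
        congr 2; ring
    | h' y =>
      induction Y using Theta₀.cases with
      | h z =>
        rw [Theta₀.mk_neg_one_mul, quadMap_pos, quadMap_neg, quadMap_neg, thetaPrime_act]
        refine Theta₁.ext (by simp) ?_
        simp only [Theta₁.mk_mul_mk, Theta₁.mk_snd', Theta₁.mk_lat', mul_right_comm _ k,
          ← cexp_add, map_sub, LinearMap.sub_apply, map_neg, LinearMap.neg_apply,
          Theta₀.mk_pt, Theta₀.rsgn_mk_neg_one, hS y z]
        congr 2; ring
      | h' z =>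
        rw [Theta₀.mk_neg_one_mul, neg_neg, quadMap_pos, quadMap_neg, quadMap_neg,
          thetaPrime_act]
        refine Theta₁.ext (by simp) ?_
        simp only [Theta₁.mk_mul_mk, Theta₁.mk_snd', Theta₁.mk_lat', mul_right_comm _ k,
          ← mul_assoc, ← cexp_add, map_sub, LinearMap.sub_apply, map_neg, LinearMap.neg_apply,
          Theta₀.mk_pt, Theta₀.rsgn_mk_neg_one, hS y z]
        -- Two reflections contribute the sign twice, so it disappears on `𝔱`.
        rw [mul_assoc _ k k, hk, mul_one]
        congr 1; ring
  refine WeakEnd.ext (funext hp) (funext fun α => ?_) (funext fun X => funext fun Y => hκ X Y)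
  refine Theta₁.ext ?_ ?_
  · change α.lat + _ = q.f α.lat
    rw [thetaPrime_bd, quadMap_pos, h2]
    exact add_zero _
  · change α.2 * _ = α.2 * _
    rw [thetaPrime_bd, quadMap_pos]
    congr 1
    rw [h1, Theta₁.mk_snd', cexp_eq_iff]
    obtain ⟨c, hc⟩ := (h4 α.lat).dvd
    refine ⟨symm J n α.lat - c, ?_⟩
    have hc' : ((symm J n α.lat - q.B α.lat α.lat : ℤ) : ℝ) = ((2 * c : ℤ) : ℝ) := by rw [hc]
    simp only [h2, LinearEquiv.coe_one, id_eq, map_smul, realExt_latticeIncl, smul_eq_mul]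
    push_cast [symm_apply] at hc' ⊢
    linear_combination (-1 / 2 : ℝ) * hc'

theorem normalForm_hat (a : TOTilde J) (X : Theta₀ L) (α : Theta₁ L) :
    (normalForm a).hat X α = Theta₁.mk (a.q.f α.lat) (α.2 * cexp
      (X.rsgn * realExt a.q.B X.pt (latticeIncl α.lat)
        - realExt J (latticeIncl (a.q.f α.lat)) a.x)) :=
  Theta₁.ext (add_zero _) (by
    rw [sub_eq_neg_add, cexp_add, ← mul_assoc]; rfl)

/-- The invertible weak endomorphism `normalForm a`. -/
noncomputable def normalFormUnit (a : TOTilde J) : (WeakEnd (thetaPrime J))ˣ :=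
  (isUnit_of_mul_unit normalForm (fun a b => Units.map PointedMap.deltaHom (normalFormCoh a b))
    normalForm_mul normalForm_one a).unit

theorem normalFormUnit_val (a : TOTilde J) : (normalFormUnit a).val = normalForm a := rfl

theorem xiMap_one : xiMap (1 : xiCoverGroup J) = 1 := by
  change quadMap (1 : OTilde J).B 0 (csign (0 + (J 0 0 : ℤ))) = 1
  have h0 : ∀ y, realExt (1 : OTilde J).B y y = 0 := fun y => realExt_zero y y
  refine PointedMap.ext (funext fun X => ?_)
  induction X using Theta₀.cases with
  | h y => rw [quadMap_pos]; simp [h0]; rfl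
  | h' y => rw [quadMap_neg]; simp [h0, csign_zero]; rfl

/-- The invertible pointed map `xiMap a`. -/
noncomputable def xiMapUnit (a : xiCoverGroup J) : (PointedMap (thetaPrime J))ˣ :=
  (isUnit_of_mul_unit xiMap (fun a b => normalFormCoh a.1.2 b.1.2) xiMap_mul xiMap_one a).unit

/-- `F⁻¹` undoes `hat` of `F`, so a value of the pulled-back map can be verified by an equation for
`F` alone, without the Künneth map of `F⁻¹`. -/
theorem pull_fn_eq {η : PointedMap (thetaPrime J)} {F : (WeakEnd (thetaPrime J))ˣ} {X : Theta₀ L}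
    {α : Theta₁ L} (h : F.val.hat X α = η.fn (F.val.p₀ X)) : (PointedMap.pull η F).fn X = α := by
  rw [PointedMap.pull_fn, ← h, ← WeakEnd.mul_hat, Units.inv_mul, WeakEnd.one_hat]

theorem pull_normalFormCoh_fn (a b c : TOTilde J) (X : Theta₀ L) :
    (PointedMap.pull (normalFormCoh a b : PointedMap (thetaPrime J)) (normalFormUnit c)).fn X
      = (normalFormCoh a b : PointedMap (thetaPrime J)).fn ((normalForm c).p₀ X) := by
  refine pull_fn_eq ?_
  rw [normalFormUnit_val, normalFormCoh, circleMap_fn, WeakEnd.hat_circle, normalForm_p₁_circle]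

/-- This is w4 for `xiCoverToActor`. All maps are circle-valued, hence compose pointwise, and `c`
acts by precomposition with the object part of its normal form. What remains is an identity of
exponents modulo `ε² = 1`. -/
theorem normalFormCoh_cocycle (a b c : TOTilde J) :
    PointedMap.pull (normalFormCoh a b : PointedMap (thetaPrime J)) (normalFormUnit c)
      * (normalFormCoh (a * b) c : PointedMap (thetaPrime J))
      = (normalFormCoh b c : PointedMap (thetaPrime J))
        * (normalFormCoh a (b * c) : PointedMap (thetaPrime J)) := by
  refine PointedMap.ext (funext fun X => ?_)
  nth_rewrite 2 [normalFormCoh]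
  nth_rewrite 3 [normalFormCoh]
  rw [mul_circleMap_fn, mul_circleMap_fn, pull_normalFormCoh_fn, normalFormCoh, circleMap_fn,
    normalFormCoh, circleMap_fn, Theta₁.mk_mul_mk, Theta₁.mk_mul_mk]
  congr 1
  simp only [← cexp_add]
  congr 1
  simp only [normalForm_p₀_rsgn, normalForm_p₀_pt, map_add, map_smul,
      LinearMap.add_apply, LinearMap.smul_apply, smul_eq_mul, TOTilde.mul_q, TOTilde.mul_x,
      OTilde.realExt_mul_B, OTilde.mul_f, extMap_mul_apply]
  have h := X.rsgn_sq
  linear_combination -realExt a.q.B (extMap b.q.f c.x) b.x * h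

theorem pull_quadMap_pos (S : LinearMap.BilinForm ℤ L) (n : L) (k : Circle) (g : TOTilde J)
    (y : LieAlg L) : (PointedMap.pull (quadMap S n k) (normalFormUnit g)).fn (Theta₀.mk y 1)
      = Theta₁.mk 0 (cexp (1 / 2 * realExt S (extMap g.q.f y) (extMap g.q.f y)
        + 1 / 2 * realExt J (latticeIncl n) (extMap g.q.f y))) := by
  refine pull_fn_eq ?_
  have hX : (normalForm g).p₀ (Theta₀.mk y 1) = Theta₀.mk (extMap g.q.f y) 1 :=
    Theta₀.ext (by simp) rfl
  rw [normalFormUnit_val, hX, quadMap_pos, WeakEnd.hat_circle, normalForm_p₁_circle]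

theorem pull_quadMap_neg (S : LinearMap.BilinForm ℤ L) (n : L) (k : Circle) (g : TOTilde J)
    (y : LieAlg L) :
    (PointedMap.pull (quadMap S (g.q.f n) k) (normalFormUnit g)).fn (Theta₀.mk y (-1))
      = Theta₁.mk (-n) (cexp (1 / 2 * realExt S (extMap g.q.f y + (2 : ℝ) • g.x)
          (extMap g.q.f y + (2 : ℝ) • g.x)
        + 1 / 2 * realExt J (latticeIncl (g.q.f n)) (extMap g.q.f y + (2 : ℝ) • g.x)
        - realExt g.q.B y (latticeIncl n) - realExt J (latticeIncl (g.q.f n)) g.x) * k) := by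
  refine pull_fn_eq ?_
  have hX : (normalForm g).p₀ (Theta₀.mk y (-1))
      = Theta₀.mk (extMap g.q.f y + (2 : ℝ) • g.x) (-1) :=
    Theta₀.ext (by simp; norm_num) rfl
  rw [normalFormUnit_val, hX, quadMap_neg, normalForm_hat]
  refine Theta₁.ext (by simp) ?_
  rw [Theta₁.mk_snd', Theta₁.mk_snd', Theta₁.mk_snd', mul_right_comm, ← cexp_add]
  congr 2
  simp only [Theta₁.mk_lat', map_neg, LinearMap.neg_apply, Theta₀.rsgn_mk_neg_one, Theta₀.mk_pt]
  ring

/-- This is w5 for `xiCoverToActor`. On both sheets the phases that depend on `y` differ by half of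
the relation `B - Bᵗ = J - f^*J` at `(y, n')`. The constant phase left over at `ε = -1` is the sign
by which `g` changes `ι`. -/
theorem pull_xiMap_mul (a : xiCoverGroup J) (g : TOTilde J) :
    PointedMap.pull (xiMap a) (normalFormUnit g)
        * (normalFormCoh a.1.2 g : PointedMap (thetaPrime J))
      = xiMap ((xiCover J).act a g)
        * (normalFormCoh g ((xiCover J).act a g).1.2 : PointedMap (thetaPrime J)) := by
  obtain ⟨h1, h2, h3, h4⟩ := a.2
  obtain ⟨h1', h2', h3', h4'⟩ := ((xiCover J).act a g).2
  have hB : ((xiCover J).act a g).1.2.q.B = pullForm g.q.f a.1.2.q.B :=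
    LinearMap.ext₂ fun c d => by
      change (g.q⁻¹ * a.1.2.q * g.q).B c d = a.1.2.q.B (g.q.f c) (g.q.f d)
      rw [OTilde.mul_B, OTilde.mul_B, OTilde.inv_B, h2, LinearEquiv.coe_one, id_eq, id_eq,
        OTilde.f_inv_apply, OTilde.f_inv_apply]
      ring
  have hn : a.1.1.n = g.q.f ((xiCover J).act a g).1.1.n := (g.q.inv_f_apply _).symm
  have hι : ((xiCover J).act a g).1.1.ι = a.1.1.ι
      + (g.q.B ((xiCover J).act a g).1.1.n ((xiCover J).act a g).1.1.n : ℤ) := rfl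
  rw [xiMap, xiMap, hB, hι, hn]
  generalize (xiCover J).act a g = b at *
  generalize b.1.1.n = n' at *
  generalize a.1.1.ι = ι
  generalize a.1.2 = s at *
  generalize b.1.2 = t at *
  have hk : csign (ι + (g.q.B n' n' : ℤ) + (J n' n' : ℤ))
      = csign (ι + (J (g.q.f n') (g.q.f n') : ℤ)) * cexp (1 / 2 * g.q.B n' n') := by
    rw [one_div_mul_eq_div, ← csign_intCast, ← csign_add]
    -- `B - Bᵗ` vanishes on the diagonal, so `J(n', n') = J(f n', f n')` and the two shifts of the
    -- sign agree.
    have h := g.q.cond n' n'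
    rw [sub_self, eq_comm, sub_eq_zero] at h
    rw [← h]
    congr 1
    ring
  rw [hk]
  generalize csign (ι + (J (g.q.f n') (g.q.f n') : ℤ)) = k
  have hcond := g.q.realExt_cond (latticeIncl n')
  have hS := realExt_comm h3
  refine PointedMap.ext (funext fun X => ?_)
  rw [normalFormCoh, normalFormCoh, mul_circleMap_fn, mul_circleMap_fn]
  induction X using Theta₀.cases with
  | h y =>
    rw [pull_quadMap_pos, quadMap_pos, Theta₁.mk_mul_mk, Theta₁.mk_mul_mk, ← cexp_add,
      ← cexp_add]
    congr 2
    have hc := hcond y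
    simp only [h1', h2', Theta₀.rsgn_mk_one, Theta₀.mk_pt, extMap_one_apply, realExt_pullForm,
      extMap_latticeIncl, map_smul, LinearMap.smul_apply, smul_eq_mul] at hc ⊢
    rw [hS _ g.x]
    linear_combination (1 / 2 : ℝ) * hc
  | h' y =>
    rw [pull_quadMap_neg, quadMap_neg, Theta₁.mk_mul_mk, Theta₁.mk_mul_mk]
    congr 1
    rw [← mul_assoc, ← mul_assoc, ← mul_assoc, mul_right_comm _ k]
    simp only [← cexp_add]
    congr 2
    have hc := hcond y
    simp only [h1', h2', Theta₀.rsgn_mk_neg_one, Theta₀.mk_pt, extMap_one_apply,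
      realExt_pullForm, extMap_latticeIncl, map_smul, LinearMap.smul_apply, smul_eq_mul,
      map_add, LinearMap.add_apply, realExt_latticeIncl] at hc ⊢
    rw [hS _ g.x]
    linear_combination (1 / 2 : ℝ) * hc

theorem normalFormUnit_mem [Module.Free ℤ L] (a : TOTilde J) :
    normalFormUnit a ∈ centrePreserving (thetaPrime J) := fun α h => by
  have hα : latticeIncl α.lat = latticeIncl 0 := (congrArg Theta₀.pt h).trans (map_zero _).symm
  rw [normalFormUnit_val, ← Theta₁.mk_eta α, latticeIncl_injective hα, normalForm_p₁_circle]

/-- The weak homomorphism from `xiCover J` to the centre-preserving weak actor of `Θ'`. -/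
noncomputable def xiCoverToActor [Module.Free ℤ L] (J : LinearMap.BilinForm ℤ L) :
    (xiCover J).WeakHom (wActPlus (thetaPrime J)) where
  p₀ g := ⟨normalFormUnit g, normalFormUnit_mem g⟩
  p₁ a := xiMapUnit a
  κ a b := normalFormCoh a b
  p₀_one := Subtype.ext (Units.ext normalForm_one)
  p₁_one := Units.ext xiMap_one
  w1 a := by
    refine Subtype.ext (Units.ext ?_)
    change normalForm ((xiCover J).bd a) = PointedMap.delta (xiMap a)
    rw [delta_xiMap]
    rfl
  w2 a b := Subtype.ext (Units.ext (normalForm_mul a b))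
  w3 a b := by
    rw [xiCover_bd, xiCover_bd]
    refine Units.ext ?_
    rw [Units.val_mul, Units.val_mul]
    exact xiMap_mul a b
  w4 a b c := Units.ext (normalFormCoh_cocycle a b c)
  w5 a g := Units.ext (pull_xiMap_mul a g)

end XiMap

/-! ### Pointed maps lying over a normal form -/

section FullyFaithful

open LieCrossedModule

variable {L : Type u} [AddCommGroup L] [Module.Finite ℤ L] {J : LinearMap.BilinForm ℤ L}

theorem eq_zero_of_continuous_disc {X : Type*} {F : LieAlg L → Disc X} (hF : Continuous F)
    (y : LieAlg L) : F y = F 0 :=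
  PreconnectedSpace.constant inferInstance hF

theorem Theta₀.continuous_mk (ε : ℤˣ) : Continuous (fun y : LieAlg L => mk y ε) :=
  Continuous.prodMk continuous_id continuous_const

theorem lat_eq_of_continuous {F : LieAlg L → Theta₁ L} (hF : Continuous F) (y : LieAlg L) :
    (F y).lat = (F 0).lat :=
  congrArg (fun m : Disc (Multiplicative L) => Multiplicative.toAdd m.get)
    (eq_zero_of_continuous_disc (continuous_fst.comp hF) y)

/-- `𝔱` is connected and the lattice discrete. -/
theorem LieCrossedModule.PointedMap.lat_fn_mk (η : PointedMap (thetaPrime J)) (y : LieAlg L)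
    (ε : ℤˣ) : (η.fn (Theta₀.mk y ε)).lat = (η.fn (Theta₀.mk 0 ε)).lat :=
  lat_eq_of_continuous (η.analytic.continuous.comp (Theta₀.continuous_mk ε)) y

theorem LieCrossedModule.PointedMap.lat_fn_pos (η : PointedMap (thetaPrime J)) (y : LieAlg L) :
    (η.fn (Theta₀.mk y 1)).lat = 0 :=
  (η.lat_fn_mk y 1).trans (congrArg Theta₁.lat η.map_one)

/-- This is fullness. Evaluating the axioms on translations and on the reflection determines `η`
completely: its lattice part yields `n`, its circle part on `𝔱` is forced, and its value at the
reflection is a square root of 1, recorded by `ι`. The comparison of `p₁` on lattice vectors becomes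
the congruence modulo 2. -/
theorem exists_xiMap_eq [Module.Free ℤ L] {η : PointedMap (thetaPrime J)} {g : TOTilde J}
    (hη : PointedMap.delta η = normalForm g) :
    ∃ a : xiCoverGroup J, a.1.2 = g ∧ xiMap a = η := by
  have hp₀ : ∀ X, X * (thetaPrime J).bd (η.fn X) = (normalForm g).p₀ X := fun X => by
    rw [← hη]; rfl
  have hp₁ : ∀ α, α * η.fn ((thetaPrime J).bd α) = (normalForm g).p₁ α := fun α => by
    rw [← hη]; rfl
  have hκ : ∀ X Y, η.fn (X * Y) = (thetaPrime J).act (η.fn X) Y * (η.fn Y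
      * (normalForm g).κ X Y) := fun X Y => by
    rw [← hη]
    change _ = _ * (_ * ((η.fn Y)⁻¹ * ((thetaPrime J).act (η.fn X) Y)⁻¹ * η.fn (X * Y)))
    group
  have hf : g.q.f = 1 := LinearEquiv.ext fun m => by
    have h := congrArg Theta₁.lat (hp₁ (Theta₁.mk m 1))
    rw [thetaPrime_bd, Theta₁.mul_lat', η.lat_fn_pos, add_zero] at h
    exact h.symm
  obtain ⟨n, hn⟩ : ∃ n, ∀ y, (η.fn (Theta₀.mk y (-1))).lat = -n :=
    ⟨-(η.fn (Theta₀.mk 0 (-1))).lat, fun y => by rw [neg_neg, η.lat_fn_mk]⟩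
  have hx : g.x = (1 / 2 : ℝ) • latticeIncl n := by
    have h := congrArg Theta₀.pt (hp₀ (Theta₀.mk 0 (-1)))
    rw [thetaPrime_bd, hn, Theta₀.mk_neg_one_mul] at h
    simp only [normalForm_p₀_pt, Theta₀.mk_pt, map_neg, map_zero, zero_sub, neg_neg, zero_add,
      Theta₀.rsgn_mk_neg_one] at h
    rw [h, smul_smul]
    norm_num
  have hpp : ∀ y z, (η.fn (Theta₀.mk (y + z) 1)).2 = (η.fn (Theta₀.mk y 1)).2
      * ((η.fn (Theta₀.mk z 1)).2 * cexp (realExt g.q.B y z)) := fun y z => by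
    have h := congrArg Prod.snd (hκ (Theta₀.mk y 1) (Theta₀.mk z 1))
    rw [Theta₀.mk_one_mul] at h
    simpa [thetaPrime_act, η.lat_fn_pos] using h
  have hpm : ∀ y, (η.fn (Theta₀.mk y (-1))).2 = (η.fn (Theta₀.mk y 1)).2
      * (η.fn (Theta₀.mk 0 (-1))).2 := fun y => by
    have h := congrArg Prod.snd (hκ (Theta₀.mk y 1) (Theta₀.mk 0 (-1)))
    rw [Theta₀.mk_one_mul] at h
    simpa [thetaPrime_act, η.lat_fn_pos] using h
  have hmp : ∀ y, (η.fn (Theta₀.mk (-y) (-1))).2 = (η.fn (Theta₀.mk 0 (-1))).2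
      * cexp (-realExt J (latticeIncl n) y) * (η.fn (Theta₀.mk y 1)).2 := fun y => by
    have h := congrArg Prod.snd (hκ (Theta₀.mk 0 (-1)) (Theta₀.mk y 1))
    rw [Theta₀.mk_neg_one_mul] at h
    simpa [thetaPrime_act, hn] using h
  have hmm : (η.fn (Theta₀.mk 0 (-1))).2 * (η.fn (Theta₀.mk 0 (-1))).2 = 1 := by
    have h := congrArg Prod.snd (hκ (Theta₀.mk 0 (-1)) (Theta₀.mk 0 (-1)))
    rw [Theta₀.mk_neg_one_mul, neg_neg, sub_zero] at h
    rw [show (Theta₀.mk 0 1 : Theta₀ L) = 1 from rfl, η.map_one] at h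
    simpa [thetaPrime_act] using h.symm
  -- Exchanging the summands in `hpp` gives symmetry modulo `ℤ` only; scaling `y` by every real
  -- number removes the ambiguity.
  have hB : ∀ y z, realExt g.q.B y z = realExt g.q.B z y := fun y z => by
    refine eq_of_cexp_mul fun t => ?_
    have h1 := hpp (t • y) z
    have h2 := hpp z (t • y)
    rw [add_comm, h2, ← mul_assoc, ← mul_assoc, mul_comm (η.fn (Theta₀.mk z 1)).2] at h1
    have h3 := mul_left_cancel h1
    simpa using h3.symm
  -- The point `(-y, -1)` is both `(-y, 1)(0, -1)` and `(0, -1)(y, 1)`, which expresses the value at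
  -- `-y` by that at `y`. Their product is also known, from `hpp` at `y + (-y) = 0`.
  have hsq : ∀ y, (η.fn (Theta₀.mk y 1)).2 * (η.fn (Theta₀.mk y 1)).2
      = cexp (realExt g.q.B y y + realExt J (latticeIncl n) y) := fun y => by
    have h1 := hpp y (-y)
    rw [add_neg_cancel, show (Theta₀.mk 0 1 : Theta₀ L) = 1 from rfl, η.map_one] at h1
    have h2 := (hpm (-y)).symm.trans (hmp y)
    rw [mul_assoc, mul_comm] at h2
    rw [mul_left_cancel h2, map_neg] at h1
    change 1 = _ at h1
    rw [show ∀ a b c : Circle, a * (b * a * c) = a * a * (b * c) from fun a b c => by ac_rfl,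
      ← cexp_add] at h1
    rw [eq_inv_of_mul_eq_one_left h1.symm, ← cexp_neg]
    congr 1
    ring
  -- The sign of the square root is settled by halving: the value at `y` is the square of the value
  -- at `y/2` times a known phase.
  have hval : ∀ y, (η.fn (Theta₀.mk y 1)).2
      = cexp (1 / 2 * realExt g.q.B y y + 1 / 2 * realExt J (latticeIncl n) y) := fun y => by
    have h1 := hpp ((1 / 2 : ℝ) • y) ((1 / 2 : ℝ) • y)
    rw [← add_smul, add_halves, one_smul, ← mul_assoc, hsq, ← cexp_add] at h1
    rw [h1]
    congr 1
    simp only [map_smul, LinearMap.smul_apply, smul_eq_mul]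
    ring
  obtain ⟨j, hj⟩ := exists_csign_of_mul_self hmm
  -- Subtracting `J(n,n)` undoes the shift built into `xiMap`.
  refine ⟨⟨(⟨n, j - (J n n : ℤ)⟩, g), hx, hf, fun c d => ?_, fun m => ?_⟩, rfl, ?_⟩
  · have h := hB (latticeIncl c) (latticeIncl d)
    rw [realExt_latticeIncl, realExt_latticeIncl] at h
    exact_mod_cast h
  · have h := congrArg Prod.snd (hp₁ (Theta₁.mk m 1))
    rw [thetaPrime_bd, Prod.snd_mul, Theta₁.mk_lat', hval, normalForm_p₁_snd, Theta₁.mk_snd',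
      one_mul, one_mul, Theta₁.mk_lat', cexp_eq_iff] at h
    obtain ⟨k, hk⟩ := h
    refine Int.modEq_iff_dvd.2 ⟨symm J n m - k, ?_⟩
    simp only [hx, hf, LinearEquiv.coe_one, id_eq, map_smul, realExt_latticeIncl,
      smul_eq_mul] at hk
    have : ((symm J n m - g.q.B m m : ℤ) : ℝ) = ((2 * (symm J n m - k) : ℤ) : ℝ) := by
      push_cast [symm_apply]
      linear_combination (-2 : ℝ) * hk
    exact_mod_cast this
  · change quadMap g.q.B n (csign (j - (J n n : ℤ) + (J n n : ℤ))) = η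
    rw [sub_add_cancel, ← hj]
    refine PointedMap.ext (funext fun X => ?_)
    induction X using Theta₀.cases with
    | h y =>
      rw [quadMap_pos]
      exact Theta₁.ext (η.lat_fn_pos y).symm (hval y).symm
    | h' y =>
      rw [quadMap_neg]
      exact Theta₁.ext (hn y).symm (by rw [Theta₁.mk_snd', ← hval]; exact (hpm y).symm)

/-- This is faithfulness: the value at the reflection `(0, -1)` alone exhibits `n` and `ι`. -/
theorem eq_of_xiMap_eq {a b : xiCoverGroup J} (h : a.1.2 = b.1.2) (h' : xiMap a = xiMap b) :
    a = b := by
  have h0 := congrArg (fun η => η.fn (Theta₀.mk 0 (-1))) h'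
  simp only [xiMap, quadMap_neg] at h0
  have hn : a.1.1.n = b.1.1.n := neg_injective (congrArg Theta₁.lat h0)
  have hι := congrArg Prod.snd h0
  simp only [map_zero, mul_zero, add_zero, cexp_zero, one_mul, Theta₁.mk_snd'] at hι
  have hι' := csign_injective hι
  rw [hn] at hι'
  exact Subtype.ext (Prod.ext (LTilde.ext hn (add_right_cancel hι')) h)

end FullyFaithful

/-! ### Central extensions from cocycles -/

/-- A normalised `2`-cocycle of `G` with values in the trivial `G`-module `A`. -/
structure TrivialCocycle (G A : Type*) [Group G] [CommGroup A] where
  k : G → G → A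
  one_left : ∀ x, k 1 x = 1
  one_right : ∀ x, k x 1 = 1
  cocycle : ∀ x y z, k x y * k (x * y) z = k y z * k x (y * z)

namespace TrivialCocycle

variable {G A : Type*} [Group G] [CommGroup A]

/-- The central extension of `G` by `A` that belongs to a cocycle. -/
@[ext]
structure Ext (c : TrivialCocycle G A) where
  a : A
  g : G

namespace Ext

variable {c : TrivialCocycle G A}

instance : Mul (Ext c) := ⟨fun x y => ⟨x.a * y.a * c.k x.g y.g, x.g * y.g⟩⟩
instance : One (Ext c) := ⟨⟨1, 1⟩⟩
instance : Inv (Ext c) := ⟨fun x => ⟨x.a⁻¹ * (c.k x.g⁻¹ x.g)⁻¹, x.g⁻¹⟩⟩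

@[simp] theorem mul_a (x y : Ext c) : (x * y).a = x.a * y.a * c.k x.g y.g := rfl
@[simp] theorem mul_g (x y : Ext c) : (x * y).g = x.g * y.g := rfl
@[simp] theorem one_a : (1 : Ext c).a = 1 := rfl
@[simp] theorem one_g : (1 : Ext c).g = 1 := rfl
@[simp] theorem inv_a (x : Ext c) : x⁻¹.a = x.a⁻¹ * (c.k x.g⁻¹ x.g)⁻¹ := rfl
@[simp] theorem inv_g (x : Ext c) : x⁻¹.g = x.g⁻¹ := rfl

instance : Group (Ext c) :=
  Group.ofLeftAxioms
    (fun x y z => Ext.ext (by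
      have h := c.cocycle x.g y.g z.g
      calc x.a * y.a * c.k x.g y.g * z.a * c.k (x.g * y.g) z.g
          = x.a * y.a * z.a * (c.k x.g y.g * c.k (x.g * y.g) z.g) := by ac_rfl
        _ = x.a * (y.a * z.a * c.k y.g z.g) * c.k x.g (y.g * z.g) := by rw [h]; ac_rfl)
      (mul_assoc _ _ _))
    (fun x => Ext.ext (by simp [c.one_left]) (one_mul _))
    (fun x => Ext.ext (by simp) (inv_mul_cancel _))

/-- The elements over `1` are central. -/
theorem mul_comm_of_g_eq_one {x : Ext c} (hx : x.g = 1) (y : Ext c) : x * y = y * x :=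
  Ext.ext (by simp [hx, c.one_left, c.one_right, mul_comm]) (by simp [hx])

end Ext

end TrivialCocycle

/-! ### Commutators with the reflection in a central extension -/

section Splitting

variable {L : Type u} [AddCommGroup L]

open TrivialCocycle

variable (c : TrivialCocycle (Theta₀ L) Circle)

/-- The commutator of lifts of `x / 2` and of the reflection, a lift of the translation by `x`. -/
noncomputable def commLift (x : LieAlg L) : Ext c :=
  (⟨1, Theta₀.mk ((1 / 2 : ℝ) • x) 1⟩ : Ext c) * ⟨1, Theta₀.mk 0 (-1)⟩
    * (⟨1, Theta₀.mk ((1 / 2 : ℝ) • x) 1⟩ : Ext c)⁻¹ * (⟨1, Theta₀.mk 0 (-1)⟩ : Ext c)⁻¹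

theorem commLift_g (x : LieAlg L) : (commLift c x).g = Theta₀.mk x 1 := by
  simp only [commLift, Ext.mul_g, Ext.inv_g]
  rw [mul_assoc, ← mul_inv_rev, mul_inv_eq_iff_eq_mul, Theta₀.mk_one_mul, Theta₀.mk_neg_one_mul,
    Theta₀.mk_one_mul]
  congr 1
  module

/-- Symmetry of the cocycle on `𝔱` means that the preimage of `𝔱` in the extension is abelian. -/
theorem Ext_comm_of_sgn
    (hc : ∀ x y, c.k (Theta₀.mk x 1) (Theta₀.mk y 1) = c.k (Theta₀.mk y 1) (Theta₀.mk x 1))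
    {a b : Ext c} (ha : a.g.sgn = 1) (hb : b.g.sgn = 1) : a * b = b * a := by
  have ha' : a.g = Theta₀.mk a.g.pt 1 := Theta₀.ext rfl ha
  have hb' : b.g = Theta₀.mk b.g.pt 1 := Theta₀.ext rfl hb
  refine Ext.ext ?_ ?_
  · simp only [Ext.mul_a]
    rw [ha', hb', hc, mul_comm a.a]
  · simp only [Ext.mul_g]
    rw [ha', hb', Theta₀.mk_one_mul, Theta₀.mk_one_mul, add_comm]

/-- Write `[ab, σ] = a [b, σ] (σ a⁻¹ σ⁻¹)`. The last two factors lie over `𝔱`, so they commute and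
the product becomes `[a, σ][b, σ]`. The central factor `z` by which the chosen lifts fail to be
multiplicative drops out of the commutator. -/
theorem commLift_add
    (hc : ∀ x y, c.k (Theta₀.mk x 1) (Theta₀.mk y 1) = c.k (Theta₀.mk y 1) (Theta₀.mk x 1))
    (x y : LieAlg L) : commLift c (x + y) = commLift c x * commLift c y := by
  obtain ⟨z, hz, hxy⟩ : ∃ z : Ext c, z.g = 1 ∧
      (⟨1, Theta₀.mk ((1 / 2 : ℝ) • (x + y)) 1⟩ : Ext c) = z
        * (⟨1, Theta₀.mk ((1 / 2 : ℝ) • x) 1⟩ * ⟨1, Theta₀.mk ((1 / 2 : ℝ) • y) 1⟩) := by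
    refine ⟨_, ?_, (mul_inv_eq_iff_eq_mul.1 rfl)⟩
    simp only [Ext.mul_g, Ext.inv_g]
    rw [mul_inv_eq_one, Theta₀.mk_one_mul, smul_add]
  have hB := commLift_g c y
  rw [commLift, hxy, commLift.eq_1 c x]
  generalize hb : (⟨1, Theta₀.mk ((1 / 2 : ℝ) • y) 1⟩ : Ext c) = b at *
  generalize hσ : (⟨1, Theta₀.mk 0 (-1)⟩ : Ext c) = σ at *
  generalize ha : (⟨1, Theta₀.mk ((1 / 2 : ℝ) • x) 1⟩ : Ext c) = a at *
  have hBe : commLift c y = b * σ * b⁻¹ * σ⁻¹ := by rw [commLift, hb, hσ]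
  have hs : (σ * a⁻¹ * σ⁻¹).g.sgn = 1 := by
    simp [← ha, ← hσ, Theta₀.mul_sgn, Theta₀.inv_sgn]
  have hcomm := Ext_comm_of_sgn c hc hs (b := commLift c y) (by rw [hB]; rfl)
  have hz' := Ext.mul_comm_of_g_eq_one hz
  calc z * (a * b) * σ * (z * (a * b))⁻¹ * σ⁻¹
      = z * (a * (b * σ * b⁻¹ * σ⁻¹) * (σ * a⁻¹)) * z⁻¹ * σ⁻¹ := by group
    _ = a * (b * σ * b⁻¹ * σ⁻¹) * (σ * a⁻¹) * σ⁻¹ := by rw [hz', mul_inv_cancel_right]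
    _ = a * (commLift c y * (σ * a⁻¹ * σ⁻¹)) := by rw [hBe]; group
    _ = a * σ * a⁻¹ * σ⁻¹ * commLift c y := by rw [← hcomm]; group

/-- `σ²` is central, so conjugation by `σ` inverts the commutator `[a, σ]`, and by additivity the
inverse lifts `-x`. Another choice of lift of the reflection differs by a central element and
changes nothing. -/
theorem reflection_mul_commLift
    (hc : ∀ x y, c.k (Theta₀.mk x 1) (Theta₀.mk y 1) = c.k (Theta₀.mk y 1) (Theta₀.mk x 1))
    (r : Circle) (x : LieAlg L) :
    (⟨r, Theta₀.mk 0 (-1)⟩ : Ext c) * commLift c x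
      = commLift c (-x) * ⟨r, Theta₀.mk 0 (-1)⟩ := by
  have h0 : commLift c 0 = 1 := by
    have h := commLift_add c hc 0 0
    rw [add_zero] at h
    exact left_eq_mul.1 h
  have hneg : commLift c (-x) = (commLift c x)⁻¹ := by
    rw [eq_inv_iff_mul_eq_one, ← commLift_add c hc, neg_add_cancel, h0]
  rw [hneg, eq_inv_mul_iff_mul_eq, commLift]
  generalize ha : (⟨1, Theta₀.mk ((1 / 2 : ℝ) • x) 1⟩ : Ext c) = a at *
  obtain ⟨z, hz, hr⟩ : ∃ z : Ext c, z.g = 1 ∧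
      (⟨r, Theta₀.mk 0 (-1)⟩ : Ext c) = z * ⟨1, Theta₀.mk 0 (-1)⟩ :=
    ⟨⟨r, 1⟩, rfl, Ext.ext (by simp [c.one_left]) (by simp)⟩
  rw [hr]
  have hσ : ((⟨1, Theta₀.mk 0 (-1)⟩ : Ext c) * ⟨1, Theta₀.mk 0 (-1)⟩).g = 1 :=
    Theta₀.ext (by simp [Theta₀.mul_pt, Theta₀.one_pt]) rfl
  generalize (⟨1, Theta₀.mk 0 (-1)⟩ : Ext c) = σ at *
  have hz' := Ext.mul_comm_of_g_eq_one hz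
  have hσ' := Ext.mul_comm_of_g_eq_one hσ
  calc a * σ * a⁻¹ * σ⁻¹ * (z * σ * (a * σ * a⁻¹ * σ⁻¹))
      = a * σ * a⁻¹ * σ⁻¹ * (z * (σ * (a * σ * a⁻¹ * σ⁻¹))) := by rw [mul_assoc z]
    _ = a * σ * a⁻¹ * σ⁻¹ * (σ * (a * σ * a⁻¹ * σ⁻¹) * z) := by rw [hz']
    _ = a * (σ * σ) * a⁻¹ * σ⁻¹ * z := by group
    _ = σ * σ * a * a⁻¹ * σ⁻¹ * z := by rw [hσ']
    _ = z * σ := by rw [hz']; group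

end Splitting

/-! ### Analytic splitting of the extension -/

section Splitting

open TrivialCocycle

theorem TrivialCocycle.Ext.mul_a_analytic {E H M E' H' G : Type*}
    [NormedAddCommGroup E] [NormedSpace ℝ E] [TopologicalSpace H] {I : ModelWithCorners ℝ E H}
    [TopologicalSpace M] [ChartedSpace H M]
    [NormedAddCommGroup E'] [NormedSpace ℝ E'] [TopologicalSpace H'] {I' : ModelWithCorners ℝ E' H'}
    [TopologicalSpace G] [ChartedSpace H' G] [Group G] [LieGroup I' ω G]
    {c : TrivialCocycle G Circle}
    (hk : ContMDiff (I'.prod I') (𝓡 1) ω (fun q : G × G => c.k q.1 q.2)) {x y : M → Ext c}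
    (hx : ContMDiff I (𝓡 1) ω (fun p => (x p).a) ∧ ContMDiff I I' ω (fun p => (x p).g))
    (hy : ContMDiff I (𝓡 1) ω (fun p => (y p).a) ∧ ContMDiff I I' ω (fun p => (y p).g)) :
    ContMDiff I (𝓡 1) ω (fun p => (x p * y p).a) ∧ ContMDiff I I' ω (fun p => (x p * y p).g) :=
  ⟨(hx.1.mul hy.1).mul (hk.comp (hx.2.prodMk hy.2)), hx.2.mul hy.2⟩

theorem TrivialCocycle.Ext.inv_a_analytic {E H M E' H' G : Type*}
    [NormedAddCommGroup E] [NormedSpace ℝ E] [TopologicalSpace H] {I : ModelWithCorners ℝ E H}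
    [TopologicalSpace M] [ChartedSpace H M]
    [NormedAddCommGroup E'] [NormedSpace ℝ E'] [TopologicalSpace H'] {I' : ModelWithCorners ℝ E' H'}
    [TopologicalSpace G] [ChartedSpace H' G] [Group G] [LieGroup I' ω G]
    {c : TrivialCocycle G Circle}
    (hk : ContMDiff (I'.prod I') (𝓡 1) ω (fun q : G × G => c.k q.1 q.2)) {x : M → Ext c}
    (hx : ContMDiff I (𝓡 1) ω (fun p => (x p).a) ∧ ContMDiff I I' ω (fun p => (x p).g)) :
    ContMDiff I (𝓡 1) ω (fun p => (x p)⁻¹.a) ∧ ContMDiff I I' ω (fun p => (x p)⁻¹.g) :=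
  ⟨hx.1.inv.mul (hk.comp (hx.2.inv.prodMk hx.2)).inv, hx.2.inv⟩

variable {L : Type u} [AddCommGroup L] [Module.Finite ℤ L]

/-- An analytic cocycle of `𝔱 ⋊ {±1}` that is symmetric on `𝔱` is an analytic coboundary. -/
theorem exists_coboundary (c : TrivialCocycle (Theta₀ L) Circle)
    (hk : ContMDiff ((𝓘(ℝ, LieAlg L).prod (𝓡 0)).prod (𝓘(ℝ, LieAlg L).prod (𝓡 0))) (𝓡 1) ω
      (fun q : Theta₀ L × Theta₀ L => c.k q.1 q.2))
    (hc : ∀ x y, c.k (Theta₀.mk x 1) (Theta₀.mk y 1) = c.k (Theta₀.mk y 1) (Theta₀.mk x 1)) :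
    ∃ h : Theta₀ L → Circle, h 1 = 1 ∧ ContMDiff (𝓘(ℝ, LieAlg L).prod (𝓡 0)) (𝓡 1) ω h ∧
      ∀ X Y, c.k X Y = (h Y)⁻¹ * (h X)⁻¹ * h (X * Y) := by
  -- `U(1)` is divisible, so the lift of the reflection can be corrected to have square 1.
  obtain ⟨r, hr⟩ : ∃ r : Circle, r * r * c.k (Theta₀.mk 0 (-1)) (Theta₀.mk 0 (-1)) = 1 := by
    obtain ⟨t, ht⟩ := cexp_surjective (c.k (Theta₀.mk 0 (-1)) (Theta₀.mk 0 (-1)))⁻¹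
    refine ⟨cexp (t / 2), ?_⟩
    rw [← cexp_add, add_halves, ht, inv_mul_cancel]
  set refl : ℤˣ → Ext c := fun ε => ⟨if ε = 1 then 1 else r, Theta₀.mk 0 ε⟩ with hrefl
  have hrefl1 : refl 1 = 1 := rfl
  have hrefl2 : refl (-1) * refl (-1) = 1 :=
    Ext.ext hr (Theta₀.ext (by simp [hrefl, Theta₀.mul_pt, Theta₀.one_pt]) rfl)
  -- The additive lift on `𝔱` and the involutive lift of the reflection satisfy the relations of the
  -- semidirect product, so together they are a homomorphic section. Its circle component is the
  -- required cochain, and it is analytic because it is built from the cocycle by group operations.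
  set lift : Theta₀ L → Ext c := fun X => commLift c X.pt * refl X.sgn with hlift
  have hg : ∀ X, (lift X).g = X := fun X => by
    rw [hlift, Ext.mul_g, commLift_g, Theta₀.mk_one_mul, add_zero]
    rfl
  have hswap : ∀ x, refl (-1) * commLift c x = commLift c (-x) * refl (-1) :=
    reflection_mul_commLift c hc r
  have hmul : ∀ X Y, lift X * lift Y = lift (X * Y) := fun X Y => by
    induction X using Theta₀.cases with
    | h x =>
      rw [hlift]
      change commLift c x * refl 1 * (commLift c Y.pt * refl Y.sgn) = _
      rw [hrefl1, mul_one, ← mul_assoc, ← commLift_add c hc, ← Y.mk_eta, Theta₀.mk_one_mul]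
      rfl
    | h' x =>
      rw [hlift]
      change commLift c x * refl (-1) * (commLift c Y.pt * refl Y.sgn) = _
      rw [mul_assoc, ← mul_assoc (refl (-1)), hswap, mul_assoc, ← mul_assoc,
        ← commLift_add c hc, ← Y.mk_eta, Theta₀.mk_neg_one_mul, ← sub_eq_add_neg]
      change commLift c (x - Y.pt) * (refl (-1) * refl Y.sgn)
        = commLift c (x - Y.pt) * refl (-Y.sgn)
      rcases Int.units_eq_one_or Y.sgn with hY | hY
      · rw [hY, hrefl1, mul_one]
      · rw [hY, hrefl2, neg_neg, hrefl1]
  refine ⟨fun X => (lift X).a, ?_, ?_, fun X Y => ?_⟩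
  · have h1 : lift 1 = 1 := by
      have h := hmul 1 1
      rw [one_mul] at h
      exact left_eq_mul.1 h.symm
    exact congrArg Ext.a h1
  · have hT : ContMDiff (𝓘(ℝ, LieAlg L).prod (𝓡 0)) (𝓡 1) ω (fun _ : Theta₀ L => (1 : Circle)) ∧
        ContMDiff (𝓘(ℝ, LieAlg L).prod (𝓡 0)) (𝓘(ℝ, LieAlg L).prod (𝓡 0)) ω
          (fun X : Theta₀ L => Theta₀.mk ((1 / 2 : ℝ) • X.pt) 1) :=
      ⟨contMDiff_const, Theta₀.mk_analytic
        ((contMDiff_const (I := 𝓘(ℝ, LieAlg L).prod (𝓡 0)) (I' := 𝓘(ℝ))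
          (c := (1 / 2 : ℝ))).smul Theta₀.pt_analytic) contMDiff_const⟩
    have hσ : ContMDiff (𝓘(ℝ, LieAlg L).prod (𝓡 0)) (𝓡 1) ω (fun _ : Theta₀ L => (1 : Circle)) ∧
        ContMDiff (𝓘(ℝ, LieAlg L).prod (𝓡 0)) (𝓘(ℝ, LieAlg L).prod (𝓡 0)) ω
          (fun _ : Theta₀ L => (Theta₀.mk 0 (-1) : Theta₀ L)) :=
      ⟨contMDiff_const, contMDiff_const⟩
    have hR : ContMDiff (𝓘(ℝ, LieAlg L).prod (𝓡 0)) (𝓡 1) ω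
        (fun X : Theta₀ L => (refl X.sgn).a) ∧
        ContMDiff (𝓘(ℝ, LieAlg L).prod (𝓡 0)) (𝓘(ℝ, LieAlg L).prod (𝓡 0)) ω
          (fun X : Theta₀ L => (refl X.sgn).g) :=
      ⟨Theta₀.disc_analytic (𝓡 1) fun ε => (refl ε).a,
        Theta₀.mk_analytic contMDiff_const Theta₀.sgn_analytic⟩
    exact (Ext.mul_a_analytic hk (Ext.mul_a_analytic hk (Ext.mul_a_analytic hk
      (Ext.mul_a_analytic hk (x := fun X : Theta₀ L =>
        (⟨1, Theta₀.mk ((1 / 2 : ℝ) • X.pt) 1⟩ : Ext c)) (y := fun _ => ⟨1, Theta₀.mk 0 (-1)⟩)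
        hT hσ)
      (Ext.inv_a_analytic hk (x := fun X : Theta₀ L =>
        (⟨1, Theta₀.mk ((1 / 2 : ℝ) • X.pt) 1⟩ : Ext c)) hT))
      (Ext.inv_a_analytic hk (x := fun _ : Theta₀ L => (⟨1, Theta₀.mk 0 (-1)⟩ : Ext c)) hσ))
      hR).1
  · have h := congrArg Ext.a (hmul X Y)
    rw [Ext.mul_a, hg, hg] at h
    change c.k X Y = (lift Y).a⁻¹ * (lift X).a⁻¹ * (lift (X * Y)).a
    rw [← h, ← mul_inv, mul_comm (lift X).a, inv_mul_cancel_left]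

end Splitting

/-! ### Weak endomorphisms that are trivial on objects -/

section TrivialOnObjects

/-- `L` is free, so a character of order two lifts to an integral functional once exponents are
chosen on a basis. -/
theorem exists_basis_sign {L : Type*} [AddCommGroup L] [Module.Free ℤ L] (φ : L →+ Additive Circle) (hφ : ∀ m, φ m + φ m = 0) :
    ∃ l : L →ₗ[ℤ] ℤ, ∀ m, φ m = Additive.ofMul (csign (l m : ℤ)) := by
  let b := Module.Free.chooseBasis ℤ L
  have hb : ∀ i, ∃ k : ℤ, φ (b i) = Additive.ofMul (csign k) := fun i =>
    exists_csign_of_mul_self (z := Additive.toMul (φ (b i))) (hφ (b i))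
  choose k hk using hb
  refine ⟨b.constr ℤ k, fun m => ?_⟩
  have h : φ.toIntLinearMap = (halfExp.comp (Int.castAddHom (ZMod 2))).toIntLinearMap
      ∘ₗ b.constr ℤ k := b.ext fun i => by
    change φ (b i) = halfExp ((b.constr ℤ k (b i) : ℤ) : ZMod 2)
    rw [b.constr_basis, hk]
    rfl
  exact LinearMap.congr_fun h m

open LieCrossedModule

variable {L : Type u} [AddCommGroup L] [Module.Finite ℤ L] [Module.Free ℤ L]
  {J : LinearMap.BilinForm ℤ L}

theorem bd_eq_one_iff (α : Theta₁ L) : (thetaPrime J).bd α = 1 ↔ α.lat = 0 := by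
  constructor
  · intro h
    exact latticeIncl_injective ((congrArg Theta₀.pt h).trans (map_zero latticeIncl).symm)
  · intro h
    rw [← α.mk_eta, h, thetaPrime_bd_circle]

/-- A weak endomorphism that is trivial on objects and on `U(1)`, and whose Künneth map is
symmetric on `𝔱`, is isomorphic to a normal form. -/
theorem exists_normalForm_of_p₀_eq (W : WeakEnd (thetaPrime J)) (hp₀ : ∀ X, W.p₀ X = X)
    (hz : ∀ z, W.p₁ (Theta₁.mk 0 z) = Theta₁.mk 0 z)
    (hsymm : ∀ x y, (W.κ (Theta₀.mk x 1) (Theta₀.mk y 1)).2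
      = (W.κ (Theta₀.mk y 1) (Theta₀.mk x 1)).2) :
    ∃ (g : TOTilde J) (η : (PointedMap (thetaPrime J))ˣ),
      normalForm g * PointedMap.delta (η : PointedMap (thetaPrime J)) = W := by
  have hlat : ∀ X Y, (W.κ X Y).lat = 0 := fun X Y => by
    have h := W.w2 X Y
    rw [hp₀, hp₀, hp₀, mul_eq_left, bd_eq_one_iff] at h
    exact h
  have hκ : ∀ X Y, W.κ X Y = Theta₁.mk 0 (W.κ X Y).2 := fun X Y => Theta₁.ext (hlat X Y) rfl
  -- `κ` takes values in `U(1)`, which is acted on trivially, so w4 is the cocycle identity of a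
  -- central extension.
  have hact : ∀ X Y Z, (thetaPrime J).act (W.κ X Y) Z = W.κ X Y := fun X Y Z => by
    rw [thetaPrime_act, hlat]
    refine Theta₁.ext (by simp [hlat]) (by simp)
  let c : TrivialCocycle (Theta₀ L) Circle :=
    { k := fun X Y => (W.κ X Y).2
      one_left := fun X => congrArg Prod.snd (W.κ_one_left X)
      one_right := fun X => congrArg Prod.snd (W.κ_one_right X)
      cocycle := fun X Y Z => by
        have h := congrArg Prod.snd (W.w4 X Y Z)
        rwa [hact] at h }
  obtain ⟨h, h1, ha, hh⟩ := exists_coboundary c (contMDiff_snd.comp W.κ_analytic) hsymm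
  obtain ⟨W', hW'⟩ : ∃ W' : WeakEnd (thetaPrime J),
      W' * PointedMap.delta (circleMap J h h1 ha : PointedMap (thetaPrime J)) = W :=
    ⟨W * (Units.map PointedMap.deltaHom (circleMap J h h1 ha)⁻¹).val, by
      rw [mul_assoc]
      change W * ((Units.map PointedMap.deltaHom (circleMap J h h1 ha)⁻¹).val
        * (Units.map PointedMap.deltaHom (circleMap J h h1 ha)).val) = W
      rw [← Units.val_mul, ← map_mul, inv_mul_cancel, map_one, Units.val_one, mul_one]⟩
  have hp₀' : ∀ X, W'.p₀ X = X := fun X => by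
    have h := congrArg (fun W => WeakEnd.p₀ W X) hW'
    simp only [WeakEnd.mul_p₀, delta_circleMap_p₀, hp₀] at h
    exact h
  have hz' : ∀ z, W'.p₁ (Theta₁.mk 0 z) = Theta₁.mk 0 z := fun z => by
    have h := congrArg (fun W => WeakEnd.p₁ W (Theta₁.mk 0 z)) hW'
    simp only [WeakEnd.mul_p₁, delta_circleMap_p₁, thetaPrime_bd_circle, h1, hz, mul_one] at h
    exact h
  have hκ' : ∀ X Y, W'.κ X Y = 1 := fun X Y => by
    have h := congrArg (fun W => WeakEnd.κ W X Y) hW'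
    simp only [WeakEnd.mul_κ, delta_circleMap_κ, WeakEnd.hat_circle, hz', delta_circleMap_p₀] at h
    rw [hκ X Y, ← hh X Y] at h
    exact mul_eq_right.1 h
  have hadd : ∀ α β, W'.p₁ (α * β) = W'.p₁ α * W'.p₁ β := fun α β => by
    rw [← W'.w3, hκ', mul_one]
  have hp₁lat : ∀ α, (W'.p₁ α).lat = α.lat := fun α => by
    have h := W'.w1 α
    rw [hp₀'] at h
    exact latticeIncl_injective (congrArg Theta₀.pt h).symm
  let φ : L →+ Additive Circle :=
    { toFun := fun m => Additive.ofMul (W'.p₁ (Theta₁.mk m 1)).2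
      map_zero' := by rw [hz']; rfl
      map_add' := fun m n => by
        have h : Theta₁.mk (m + n) 1 = Theta₁.mk m 1 * Theta₁.mk n 1 := by
          rw [Theta₁.mk_mul_mk, mul_one]
        rw [h, hadd]; rfl }
  -- The Künneth map is now trivial, so w5 against the reflection, which acts on `L` by `-1`, makes
  -- `φ` even and hence of order two.
  have hφneg : ∀ m, φ (-m) = φ m := fun m => by
    have h := congrArg Prod.snd (W'.w5 (Theta₁.mk m 1) (Theta₀.mk 0 (-1)))
    rw [hκ', hκ', mul_one, mul_one, thetaPrime_act, thetaPrime_act, hp₀'] at h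
    simp only [Theta₁.mk_lat', Theta₁.mk_snd', Theta₀.mk_sgn, Theta₀.mk_pt, map_zero, cexp_zero,
      mul_one, Units.val_neg, Units.val_one, neg_smul, one_smul] at h
    exact congrArg Additive.ofMul h.symm
  have hφ2 : ∀ m, φ m + φ m = 0 := fun m => by
    nth_rewrite 1 [← hφneg m]
    rw [map_neg, neg_add_cancel]
  obtain ⟨l, hl⟩ := exists_basis_sign φ hφ2
  have hp₁ : ∀ α, (W'.p₁ α).2 = α.2 * csign (l α.lat : ℤ) := fun α => by
    have h : α = Theta₁.mk 0 α.2 * Theta₁.mk α.lat 1 := by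
      rw [Theta₁.mk_mul_mk, zero_add, mul_one]; rfl
    conv_lhs => rw [h, hadd, hz']
    exact congrArg (α.2 * ·) (congrArg Additive.toMul (hl α.lat))
  -- Since `l(m)² ≡ l(m)` modulo 2, the map `exp(πi S(x,x))` with `S = l ⊗ l` equals the sign
  -- character on lattice points, and its coboundary is the Künneth map of the normal form of `(id,
  -- S)`.
  let S : LinearMap.BilinForm ℤ L := LinearMap.BilinForm.linMulLin l l
  have hS : ∀ m n, S m n = l m * l n := fun m n => LinearMap.BilinForm.linMulLin_apply _ _
  have hScomm := realExt_comm (B := S) fun m n => by rw [hS, hS, mul_comm]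
  let g : TOTilde J := ⟨0, ⟨1, S, fun _ _ => rfl, fun m n => by
    rw [hS, hS, mul_comm, sub_self]; exact (sub_self _).symm⟩⟩
  let u := circleMap J (fun X => cexp (1 / 2 * realExt S X.pt X.pt))
    (by simp [Theta₀.one_pt]) (cexp_analytic (contMDiff_const.mul
      (realExt_analytic _ Theta₀.pt_analytic Theta₀.pt_analytic)))
  have hu : W' * PointedMap.delta (u : PointedMap (thetaPrime J)) = normalForm g := by
    refine WeakEnd.ext_theta (fun X => ?_) (fun X => ?_) (fun α => ?_) (fun α => ?_)
      (fun X Y => ?_) (fun X Y => ?_)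
    · rw [WeakEnd.mul_p₀, delta_circleMap_p₀, hp₀']; simp [g]
    · rw [WeakEnd.mul_p₀, delta_circleMap_p₀, hp₀']; simp
    · rw [WeakEnd.mul_p₁, delta_circleMap_p₁, hp₁lat]; rfl
    · rw [WeakEnd.mul_p₁, delta_circleMap_p₁, hp₁, normalForm_p₁_snd, csign_intCast]
      simp only [g, Theta₁.mk_snd', Theta₁.mk_lat', map_zero, neg_zero, cexp_zero, mul_one,
        mul_assoc, ← cexp_add, thetaPrime_bd, Theta₀.mk_pt, realExt_latticeIncl, hS]
      obtain ⟨k, hk⟩ := (Int.even_mul_succ_self (l α.lat)).two_dvd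
      have hk' : (((l α.lat) * (l α.lat + 1) : ℤ) : ℝ) = ((2 * k : ℤ) : ℝ) := by rw [hk]
      push_cast at hk'
      rw [(cexp_eq_one_iff _).2 ⟨k, by push_cast; linear_combination (1 / 2 : ℝ) * hk'⟩, mul_one]
    · rw [WeakEnd.mul_κ, hκ', one_mul, delta_circleMap_κ, WeakEnd.hat_circle, hz']; rfl
    · rw [WeakEnd.mul_κ, hκ', one_mul, delta_circleMap_κ, WeakEnd.hat_circle, hz',
        normalForm_κ_snd, Theta₁.mk_snd', ← cexp_neg, ← cexp_neg, ← cexp_add, ← cexp_add]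
      congr 1
      simp only [g, Theta₀.mul_pt_real, map_add, map_smul, LinearMap.add_apply,
        LinearMap.smul_apply, smul_eq_mul, hScomm Y.pt X.pt]
      linear_combination (1 / 2 * realExt S Y.pt Y.pt) * X.rsgn_sq
  refine ⟨g, u⁻¹ * circleMap J h h1 ha, ?_⟩
  rw [← hu, ← hW', mul_assoc W', Units.val_mul]
  congr 1
  change _ * PointedMap.deltaHom _ = PointedMap.deltaHom _
  rw [map_mul]
  change PointedMap.deltaHom u.val * _ = _
  rw [← mul_assoc, ← map_mul, Units.mul_inv, map_one, one_mul]

end TrivialOnObjects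

/-- An alternating integral bilinear form is the antisymmetrisation of an integral form. -/
theorem exists_antisymmetrization {L : Type*} [AddCommGroup L] [Module.Free ℤ L]
    [Module.Finite ℤ L] (w : LinearMap.BilinForm ℤ L) (hw : ∀ m n, w m n = -w n m) :
    ∃ B : LinearMap.BilinForm ℤ L, ∀ m n, B m n - B n m = w m n := by
  let b := Module.finBasis ℤ L
  -- The strictly upper triangular part of `w` in a basis.
  let B : LinearMap.BilinForm ℤ L :=
    Matrix.toBilin b (Matrix.of fun i j => if i < j then w (b i) (b j) else 0)
  have hB : ∀ i j, B (b i) (b j) = if i < j then w (b i) (b j) else 0 := fun i j => by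
    have h := LinearMap.BilinForm.toMatrix_apply b B i j
    rw [← h, LinearMap.BilinForm.toMatrix_toBilin]
    rfl
  refine ⟨B, fun m n => ?_⟩
  have h : B - B.flip = w := by
    refine b.ext fun i => b.ext fun j => ?_
    change B (b i) (b j) - B (b j) (b i) = w (b i) (b j)
    rw [hB, hB]
    have := hw (b i) (b j)
    rcases lt_trichotomy i j with hij | rfl | hij
    · rw [if_pos hij, if_neg hij.asymm, sub_zero]
    · rw [if_neg (lt_irrefl i)]
      omega
    · rw [if_pos hij, if_neg hij.asymm]
      omega
  rw [← h]
  rfl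

/-! ### Extracting a normal form from a centre-preserving weak automorphism -/

section Structure

open LieCrossedModule

variable {L : Type u} [AddCommGroup L] [Module.Finite ℤ L] {J : LinearMap.BilinForm ℤ L}

theorem sgn_eq_of_continuous {F : LieAlg L → Theta₀ L} (hF : Continuous F) (y : LieAlg L) :
    (F y).sgn = (F 0).sgn :=
  congrArg Disc.get (eq_zero_of_continuous_disc (Theta₀.sgn_analytic.continuous.comp hF) y)

theorem lat_κ_mk (W : WeakEnd (thetaPrime J)) (y z : LieAlg L) (ε δ : ℤˣ) :
    (W.κ (Theta₀.mk y ε) (Theta₀.mk z δ)).lat = (W.κ (Theta₀.mk 0 ε) (Theta₀.mk 0 δ)).lat :=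
  (lat_eq_of_continuous (F := fun y => W.κ (Theta₀.mk y ε) (Theta₀.mk z δ))
    (W.κ_analytic.continuous.comp ((Theta₀.continuous_mk ε).prodMk continuous_const)) y).trans
  (lat_eq_of_continuous (F := fun z => W.κ (Theta₀.mk 0 ε) (Theta₀.mk z δ))
    (W.κ_analytic.continuous.comp (continuous_const.prodMk (Theta₀.continuous_mk δ))) z)

theorem lat_κ_one_left (W : WeakEnd (thetaPrime J)) (y : LieAlg L) (X : Theta₀ L) :
    (W.κ (Theta₀.mk y 1) X).lat = 0 := by
  rw [← X.mk_eta, lat_κ_mk]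
  exact congrArg Theta₁.lat (W.κ_one_left _)

theorem lat_κ_one_right (W : WeakEnd (thetaPrime J)) (y : LieAlg L) (X : Theta₀ L) :
    (W.κ X (Theta₀.mk y 1)).lat = 0 := by
  rw [← X.mk_eta, lat_κ_mk]
  exact congrArg Theta₁.lat (W.κ_one_right _)

theorem sgn_p₀_pos (W : WeakEnd (thetaPrime J)) (y : LieAlg L) :
    (W.p₀ (Theta₀.mk y 1)).sgn = 1 :=
  (sgn_eq_of_continuous (W.p₀_analytic.continuous.comp (Theta₀.continuous_mk 1)) y).trans
    (congrArg Theta₀.sgn W.p₀_one)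

theorem bd_eq_one_of_lat {α : Theta₁ L} (h : α.lat = 0) : (thetaPrime J).bd α = 1 := by
  rw [← α.mk_eta, h, thetaPrime_bd_circle]

/-- Otherwise `p₀` would map everything into the identity component and could not be surjective. -/
theorem sgn_p₀_neg (W : (WeakEnd (thetaPrime J))ˣ) :
    (W.val.p₀ (Theta₀.mk 0 (-1))).sgn = -1 := by
  rcases Int.units_eq_one_or (W.val.p₀ (Theta₀.mk 0 (-1))).sgn with h | h
  · exfalso
    have hall : ∀ X, (W.val.p₀ X).sgn = 1 := fun X => by
      induction X using Theta₀.cases with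
      | h y => exact sgn_p₀_pos _ y
      | h' y =>
        have h2 := W.val.w2 (Theta₀.mk y 1) (Theta₀.mk 0 (-1))
        rw [bd_eq_one_of_lat (lat_κ_one_left _ _ _), mul_one, Theta₀.mk_one_mul, add_zero] at h2
        rw [← h2, Theta₀.mul_sgn, sgn_p₀_pos, h, mul_one]
    have h3 := hall (W⁻¹.val.p₀ (Theta₀.mk 0 (-1)))
    rw [PointedMap.p₀_inv, Theta₀.mk_sgn] at h3
    exact absurd h3 (by decide)
  · exact h

/-- The circle part of the Künneth map on `𝔱`. -/
noncomputable def kappaPos (W : WeakEnd (thetaPrime J)) (x y : LieAlg L) : Additive Circle :=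
  Additive.ofMul (W.κ (Theta₀.mk x 1) (Theta₀.mk y 1)).2

theorem kappaPos_cocycle (W : WeakEnd (thetaPrime J)) (x y z : LieAlg L) :
    kappaPos W x y + kappaPos W (x + y) z = kappaPos W y z + kappaPos W x (y + z) := by
  have h := congrArg Prod.snd (W.w4 (Theta₀.mk x 1) (Theta₀.mk y 1) (Theta₀.mk z 1))
  rw [thetaPrime_act, lat_κ_one_left, map_zero, map_zero, LinearMap.zero_apply, cexp_zero,
    mul_one, Theta₀.mk_one_mul, Theta₀.mk_one_mul] at h
  exact congrArg Additive.ofMul h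

/-- The commutator of the Künneth map on `𝔱`. -/
noncomputable def commPairing (W : WeakEnd (thetaPrime J)) :
    LieAlg L →+ LieAlg L →+ Additive Circle :=
  AddMonoidHom.mk' (fun x => AddMonoidHom.mk' (fun y => kappaPos W x y - kappaPos W y x)
    (fun y y' => by
      -- Commutators in a central extension with abelian quotient are biadditive: this combines
      -- three instances of the cocycle identity.
      have h1 := kappaPos_cocycle W y y' x
      have h2 := kappaPos_cocycle W y x y'
      have h3 := kappaPos_cocycle W x y y'
      rw [add_comm y' x] at h1
      rw [add_comm y x] at h2
      linear_combination (norm := abel) h2 - h1 - h3))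
    (fun x x' => by
      refine AddMonoidHom.ext fun y => ?_
      have h1 := kappaPos_cocycle W x x' y
      have h2 := kappaPos_cocycle W x y x'
      have h3 := kappaPos_cocycle W y x x'
      rw [add_comm x' y] at h1
      rw [add_comm y x] at h3
      change kappaPos W (x + x') y - kappaPos W y (x + x')
        = kappaPos W x y - kappaPos W y x + (kappaPos W x' y - kappaPos W y x')
      linear_combination (norm := abel) h1 - h2 + h3)

theorem commPairing_apply (W : WeakEnd (thetaPrime J)) (x y : LieAlg L) :
    commPairing W x y = kappaPos W x y - kappaPos W y x := rfl

theorem commPairing_continuous (W : WeakEnd (thetaPrime J)) (y : LieAlg L) :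
    Continuous (fun x => commPairing W x y) := by
  have h1 : Continuous fun x => (W.κ (Theta₀.mk x 1) (Theta₀.mk y 1)).2 :=
    continuous_snd.comp (W.κ_analytic.continuous.comp
      ((Theta₀.continuous_mk 1).prodMk continuous_const))
  have h2 : Continuous fun x => (W.κ (Theta₀.mk y 1) (Theta₀.mk x 1)).2 :=
    continuous_snd.comp (W.κ_analytic.continuous.comp
      (continuous_const.prodMk (Theta₀.continuous_mk 1)))
  exact (continuous_ofMul.comp h1).sub (continuous_ofMul.comp h2)

theorem p₁_mk_snd {W : (WeakEnd (thetaPrime J))ˣ}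
    (hW : W ∈ centrePreserving (thetaPrime J)) (m : L) (z : Circle) :
    (W.val.p₁ (Theta₁.mk m z)).2 = z * (W.val.p₁ (Theta₁.mk m 1)).2 := by
  have h := W.val.w3 (Theta₁.mk 0 z) (Theta₁.mk m 1)
  rw [thetaPrime_bd_circle, W.val.κ_one_left, mul_one, Theta₁.mk_mul_mk, zero_add, mul_one,
    hW _ (thetaPrime_bd_circle z)] at h
  exact congrArg Prod.snd h.symm

/-- Biadditive maps to the circle that are continuous in the first variable are determined by
their values on the lattice. -/
theorem biadditive_ext {D : LieAlg L →+ LieAlg L →+ Additive Circle}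
    (hD : ∀ y, Continuous (fun x => D x y)) (h : ∀ m y, D (latticeIncl m) y = 0)
    (x y : LieAlg L) : D x y = 0 := by
  induction x using LieAlg.induction_on with
  | hadd x x' hx hx' => rw [map_add, AddMonoidHom.add_apply, hx, hx', add_zero]
  | h0 r m =>
    -- For rational multiples the denominator is moved to the second variable, where it divides `y`;
    -- the first variable is then in the lattice. Real multiples follow by density.
    have hq : ∀ q : ℚ, D ((q : ℝ) • latticeIncl m) y = 0 := fun q => by
      have hq0 : (q.den : ℝ) ≠ 0 := by exact_mod_cast q.den_nz
      have h1 : (q : ℝ) • latticeIncl m = q.num • ((1 / q.den : ℝ) • latticeIncl m) := by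
        rw [← Int.cast_smul_eq_zsmul ℝ, smul_smul, mul_one_div]
        congr 1
        exact_mod_cast (Rat.num_div_den q).symm
      have h2 : y = q.den • ((1 / q.den : ℝ) • y) := by
        rw [← Nat.cast_smul_eq_nsmul ℝ, smul_smul, mul_one_div, div_self hq0, one_smul]
      have h3 : q.den • ((1 / q.den : ℝ) • latticeIncl m) = latticeIncl m := by
        rw [← Nat.cast_smul_eq_nsmul ℝ, smul_smul, mul_one_div, div_self hq0, one_smul]
      rw [h1, map_zsmul, AddMonoidHom.zsmul_apply, h2, map_nsmul, ← AddMonoidHom.nsmul_apply,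
        ← map_nsmul, h3, h, smul_zero]
    have hcont : Continuous fun r : ℝ => D (r • latticeIncl m) y :=
      (hD y).comp (by fun_prop : Continuous fun r : ℝ => r • (latticeIncl m : LieAlg L))
    exact congrFun (Rat.denseRange_cast.equalizer hcont continuous_const (funext hq)) r

variable [Module.Free ℤ L]

/-- By connectedness only the pair of reflections needs attention. The image of the reflection has
sign `-1` and thus squares to 1, so w2 leaves no room for a lattice part. Consequently `p₀` is a
homomorphism. -/
theorem lat_κ_eq_zero (W : (WeakEnd (thetaPrime J))ˣ) (X Y : Theta₀ L) :
    (W.val.κ X Y).lat = 0 := by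
  induction X using Theta₀.cases with
  | h y => exact lat_κ_one_left _ _ _
  | h' y =>
    induction Y using Theta₀.cases with
    | h z => exact lat_κ_one_right _ _ _
    | h' z =>
      rw [lat_κ_mk]
      have h := congrArg Theta₀.pt (W.val.w2 (Theta₀.mk 0 (-1)) (Theta₀.mk 0 (-1)))
      rw [Theta₀.mk_neg_one_mul, neg_neg, sub_zero, show (Theta₀.mk 0 1 : Theta₀ L) = 1 from rfl,
        W.val.p₀_one, Theta₀.mul_pt, Theta₀.mul_pt, Theta₀.mul_sgn, sgn_p₀_neg] at h
      simp only [Units.val_neg, Units.val_one, neg_smul, one_smul, add_neg_cancel, neg_mul_neg,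
        mul_one, zero_add, thetaPrime_bd, Theta₀.mk_pt, Theta₀.one_pt] at h
      exact latticeIncl_injective (h.trans (map_zero latticeIncl).symm)

theorem p₀_mul_of_unit (W : (WeakEnd (thetaPrime J))ˣ) (X Y : Theta₀ L) :
    W.val.p₀ (X * Y) = W.val.p₀ X * W.val.p₀ Y := by
  rw [← W.val.w2, bd_eq_one_of_lat (lat_κ_eq_zero W X Y), mul_one]

/-- The linear part of an invertible weak endomorphism. -/
noncomputable def linPart (W : (WeakEnd (thetaPrime J))ˣ) : LieAlg L →+ LieAlg L where
  toFun y := (W.val.p₀ (Theta₀.mk y 1)).pt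
  map_zero' := congrArg Theta₀.pt W.val.p₀_one
  map_add' y z := by
    rw [← Theta₀.mk_one_mul, p₀_mul_of_unit, Theta₀.mul_pt, sgn_p₀_pos, Units.val_one, one_smul]

theorem p₀_pos (W : (WeakEnd (thetaPrime J))ˣ) (y : LieAlg L) :
    W.val.p₀ (Theta₀.mk y 1) = Theta₀.mk (linPart W y) 1 :=
  Theta₀.ext rfl (sgn_p₀_pos _ y)

theorem linPart_latticeIncl (W : (WeakEnd (thetaPrime J))ˣ) (α : Theta₁ L) :
    linPart W (latticeIncl α.lat) = latticeIncl (W.val.p₁ α).lat :=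
  congrArg Theta₀.pt (W.val.w1 α)

theorem linPart_inv (W : (WeakEnd (thetaPrime J))ˣ) (y : LieAlg L) :
    linPart W⁻¹ (linPart W y) = y := by
  have h := PointedMap.inv_p₀ W (Theta₀.mk y 1)
  rw [p₀_pos, p₀_pos] at h
  exact congrArg Theta₀.pt h

/-- The lattice automorphism underlying an invertible weak endomorphism. -/
noncomputable def latPart (W : (WeakEnd (thetaPrime J))ˣ) : L ≃ₗ[ℤ] L :=
  AddEquiv.toIntLinearEquiv
    { toFun := fun m => (W.val.p₁ (Theta₁.mk m 1)).lat
      invFun := fun m => (W⁻¹.val.p₁ (Theta₁.mk m 1)).lat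
      left_inv := fun m => latticeIncl_injective (by
        rw [← linPart_latticeIncl, Theta₁.mk_lat', ← linPart_latticeIncl, linPart_inv]; rfl)
      right_inv := fun m => latticeIncl_injective (by
        rw [← linPart_latticeIncl, Theta₁.mk_lat', ← linPart_latticeIncl]
        exact linPart_inv W⁻¹ _)
      map_add' := fun m n => latticeIncl_injective (by
        rw [map_add, ← linPart_latticeIncl, ← linPart_latticeIncl, ← linPart_latticeIncl,
          ← map_add, Theta₁.mk_lat', map_add latticeIncl]
        rfl) }

theorem latPart_apply (W : (WeakEnd (thetaPrime J))ˣ) (α : Theta₁ L) :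
    latPart W α.lat = (W.val.p₁ α).lat :=
  latticeIncl_injective ((linPart_latticeIncl W (Theta₁.mk α.lat 1)).symm.trans
    (linPart_latticeIncl W α))

/-- A continuous additive map is real linear, and the two sides agree on `L`. -/
theorem linPart_eq_extMap (W : (WeakEnd (thetaPrime J))ˣ) (y : LieAlg L) :
    linPart W y = extMap (latPart W) y := by
  have hcont : Continuous (linPart W) :=
    Theta₀.pt_analytic.continuous.comp
      (W.val.p₀_analytic.continuous.comp (Theta₀.continuous_mk 1))
  refine LinearMap.congr_fun (f := ((linPart W).toRealLinearMap hcont).toLinearMap)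
    (g := extMap (latPart W)) (LieAlg.linear_ext fun m => ?_) y
  exact linPart_latticeIncl W (Theta₁.mk m 1)

/-- A homomorphism on `𝔱 ⋊ {±1}` is determined by `𝔱` and the image of the reflection; the factor
`1/2` compensates `1 - ε = 2`. -/
theorem p₀_eq (W : (WeakEnd (thetaPrime J))ˣ) (X : Theta₀ L) :
    W.val.p₀ X = Theta₀.mk (extMap (latPart W) X.pt
      + (1 - X.rsgn) • (1 / 2 : ℝ) • (W.val.p₀ (Theta₀.mk 0 (-1))).pt) X.sgn := by
  induction X using Theta₀.cases with
  | h y =>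
    rw [p₀_pos, linPart_eq_extMap]
    simp
  | h' y =>
    have h : Theta₀.mk y (-1) = Theta₀.mk y 1 * Theta₀.mk 0 (-1) := by
      rw [Theta₀.mk_one_mul, add_zero]
    rw [h, p₀_mul_of_unit, p₀_pos, linPart_eq_extMap, ← h,
      ← (W.val.p₀ (Theta₀.mk 0 (-1))).mk_eta, sgn_p₀_neg, Theta₀.mk_one_mul]
    simp only [Theta₀.mk_pt, Theta₀.rsgn_mk_neg_one, Theta₀.mk_sgn, smul_smul]
    norm_num

/-- w5 for a lattice vector and a translation compares the two orders of `κ`. The actions on source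
and target contribute `J` and its pullback, and preservation of the centre lets the circle factor
pass through `p₁`. -/
theorem commPairing_lattice {W : (WeakEnd (thetaPrime J))ˣ}
    (hW : W ∈ centrePreserving (thetaPrime J)) (m : L) (y : LieAlg L) :
    commPairing W.val (latticeIncl m) y = e (realExt J (latticeIncl m) y
      - realExt J (extMap (latPart W) (latticeIncl m)) (extMap (latPart W) y)) := by
  have h := congrArg Prod.snd (W.val.w5 (Theta₁.mk m 1) (Theta₀.mk y 1))
  rw [thetaPrime_act, thetaPrime_act, p₀_pos, ← latPart_apply] at h
  simp only [thetaPrime_bd, Theta₁.mk_lat', Theta₁.mk_snd', Theta₀.mk_sgn, Theta₀.mk_pt,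
    Units.val_one, one_smul, one_mul, Prod.snd_mul, linPart_eq_extMap] at h
  rw [p₁_mk_snd hW _ (cexp _)] at h
  have h' := congrArg Additive.ofMul h
  simp only [ofMul_mul] at h'
  rw [commPairing_apply, map_sub, extMap_latticeIncl]
  change _ + e (realExt J (latticeIncl (latPart W m)) (extMap (latPart W) y))
    + kappaPos W.val (latticeIncl m) y = e (realExt J (latticeIncl m) y) + _
    + kappaPos W.val y (latticeIncl m) at h'
  linear_combination (norm := abel) h'

/-- The difference of `J` and its pullback along the lattice automorphism. -/
noncomputable def formDefect (W : (WeakEnd (thetaPrime J))ˣ) : LinearMap.BilinForm ℤ L :=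
  J - pullForm (latPart W) J

theorem realExt_formDefect (W : (WeakEnd (thetaPrime J))ˣ) (x y : LieAlg L) :
    realExt (formDefect W) x y = realExt J x y
      - realExt J (extMap (latPart W) x) (extMap (latPart W) y) := by
  have h := realExt_add (formDefect W) (pullForm (latPart W) J) x y
  rw [formDefect, sub_add_cancel, realExt_pullForm] at h
  rw [h, formDefect, add_sub_cancel_right]

/-- Both sides are biadditive and continuous in `x`, so `biadditive_ext` reduces the equality to
lattice vectors. -/
theorem commPairing_eq {W : (WeakEnd (thetaPrime J))ˣ}
    (hW : W ∈ centrePreserving (thetaPrime J)) (x y : LieAlg L) :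
    commPairing W.val x y = e (realExt (formDefect W) x y) := by
  let D' : LieAlg L →+ LieAlg L →+ Additive Circle :=
    AddMonoidHom.mk' (fun x => e.comp (realExt (formDefect W) x).toAddMonoidHom)
      (fun x x' => by ext y; simp)
  have h := biadditive_ext (D := commPairing W.val - D') (fun y => ?_) (fun m y => ?_) x y
  · exact sub_eq_zero.1 h
  · exact (commPairing_continuous W.val y).sub (cexp_continuous.comp
      (((realExt (formDefect W)).flip y).continuous_of_finiteDimensional))
  · change commPairing W.val (latticeIncl m) y - e (realExt (formDefect W) (latticeIncl m) y) = 0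
    rw [commPairing_lattice hW, realExt_formDefect, sub_self]

/-- A commutator is antisymmetric, and scaling by all reals lifts this from `U(1)` to `ℝ`.
Antisymmetry of `J - f^*J` is the same as invariance of `I` under `f`. -/
theorem formDefect_neg {W : (WeakEnd (thetaPrime J))ˣ}
    (hW : W ∈ centrePreserving (thetaPrime J)) (m n : L) :
    formDefect W m n = -formDefect W n m := by
  have h : realExt (formDefect W) (latticeIncl m) (latticeIncl n)
      = -realExt (formDefect W) (latticeIncl n) (latticeIncl m) := by
    refine eq_of_cexp_mul fun t => ?_
    have h1 := commPairing_eq hW (t • latticeIncl m) (latticeIncl n)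
    have h2 := commPairing_eq hW (latticeIncl n) (t • latticeIncl m)
    have h3 : commPairing W.val (t • latticeIncl m) (latticeIncl n)
        = -commPairing W.val (latticeIncl n) (t • latticeIncl m) := by
      rw [commPairing_apply, commPairing_apply, neg_sub]
    rw [h1, h2, ← map_neg, map_smul, map_smul, LinearMap.smul_apply, smul_eq_mul, smul_eq_mul,
      ← mul_neg] at h3
    exact h3
  rw [realExt_latticeIncl, realExt_latticeIncl] at h
  exact_mod_cast h

/-- An integral `B` with `B - Bᵗ = J - f^*J` exists since the right side is antisymmetric. The
normal form built from it has the same object part as `W`, so the quotient is trivial on objects.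
Its commutator pairing therefore vanishes, its Künneth map is symmetric on `𝔱`, and
`exists_normalForm_of_p₀_eq` applies. -/
theorem exists_normalForm_eq {W : (WeakEnd (thetaPrime J))ˣ}
    (hW : W ∈ centrePreserving (thetaPrime J)) :
    ∃ (g : TOTilde J) (η : (PointedMap (thetaPrime J))ˣ),
      normalForm g * PointedMap.delta (η : PointedMap (thetaPrime J)) = W := by
  obtain ⟨B, hB⟩ := exists_antisymmetrization (formDefect W) (formDefect_neg hW)
  have hdef : ∀ m n, formDefect W m n = J m n - J (latPart W m) (latPart W n) :=
    fun m n => rfl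
  let g : TOTilde J := ⟨(1 / 2 : ℝ) • (W.val.p₀ (Theta₀.mk 0 (-1))).pt,
    ⟨latPart W, B, fun m n => by
      have h := formDefect_neg hW m n
      rw [hdef, hdef] at h
      rw [symm_apply, symm_apply]
      omega, fun m n => by rw [hB, hdef]⟩⟩
  have hp₀ : ∀ X, ((normalFormUnit g)⁻¹ * W).val.p₀ X = X := fun X => by
    rw [Units.val_mul, WeakEnd.mul_p₀, p₀_eq W]
    exact PointedMap.inv_p₀ (normalFormUnit g) X
  have hmem : (normalFormUnit g)⁻¹ * W ∈ centrePreserving (thetaPrime J) :=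
    mul_mem (inv_mem (normalFormUnit_mem g)) hW
  obtain ⟨g', η, h⟩ := exists_normalForm_of_p₀_eq ((normalFormUnit g)⁻¹ * W).val hp₀
    (fun z => hmem _ (thetaPrime_bd_circle z)) (fun x y => by
      have hl : ∀ x, extMap (latPart ((normalFormUnit g)⁻¹ * W)) x = x := fun x => by
        rw [← linPart_eq_extMap]
        exact congrArg Theta₀.pt (hp₀ _)
      have h := commPairing_eq hmem x y
      rw [realExt_formDefect, hl, hl, sub_self, map_zero, commPairing_apply] at h
      exact Additive.ofMul.injective (sub_eq_zero.1 h))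
  refine ⟨g * g', (normalFormCoh g g')⁻¹ * η, ?_⟩
  have h2 : normalForm g * (normalForm g' * PointedMap.delta (η : PointedMap (thetaPrime J)))
      = W := by
    rw [h, ← normalFormUnit_val g, ← Units.val_mul, mul_inv_cancel_left]
  rw [← normalForm_mul, ← h2, Units.val_mul, mul_assoc, mul_assoc]
  congr 2
  change PointedMap.deltaHom _ * PointedMap.deltaHom _ = PointedMap.deltaHom _
  rw [← map_mul, ← mul_assoc, Units.mul_inv, one_mul]

theorem xiCoverToActor_isEquivalence : (xiCoverToActor J).toFunctor.IsEquivalence := by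
  refine CrossedModule.WeakHom.toFunctor_isEquivalence _ (fun a b hab h => ?_) (fun g η h => ?_)
    (fun W => ?_)
  · exact eq_of_xiMap_eq hab (congrArg Units.val h)
  · obtain ⟨a, ha, ha'⟩ := exists_xiMap_eq (congrArg (fun W => (Units.val (Subtype.val W))) h)
    exact ⟨a, ha, Units.ext ha'⟩
  · obtain ⟨g, η, h⟩ := exists_normalForm_eq W.2
    exact ⟨g, η, Subtype.ext (Units.ext h)⟩

end Structure

end CatTorus

theorem mainTheorem3 {L : Type*} [AddCommGroup L] [Module.Free ℤ L] [Module.Finite ℤ L]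
    (J : LinearMap.BilinForm ℤ L)
    (hI : Function.Bijective (CatTorus.symm J : L → Module.Dual ℤ L)) :
    CatTorus.CrossedModule.EquivalentCatGroups
      (CatTorus.CrossedModule.S (CatTorus.LieCrossedModule.wActPlus (CatTorus.thetaPrime J)))
      (CatTorus.CrossedModule.S (CatTorus.xiPrime J)) :=
  CatTorus.CrossedModule.equivalentCatGroups_of_span
    (CatTorus.xiCoverToActor J).toFunctor (CatTorus.xiCoverToXi J).toFunctor
    (CatTorus.xiCoverToActor J).coreMonoidal (CatTorus.xiCoverToXi J).coreMonoidal
    CatTorus.xiCoverToActor_isEquivalence CatTorus.xiCoverToXi_isEquivalence
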